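/- Let $m:\mathbb N\to\mathbb N$ be bounded by a polynomial, and let $R\subseteq\{0,1\}^*\times\{0,1\}^*$ be a relation such that the set of pairs $(x,y)$ with $R(x,y)$ is decidable in polynomial space. A word $y\in\{0,1\}^{m(|x|)}$ with $R(x,y)$ is called a witness for $x$. For $W:\{1,\dots,m(|x|)\}\to\mathbb N$ put $W(y)=\sum_{i:\,y_i=1}W(i)$. The weighted decision problem is $$\mathcal L_w=\{(x,W,w_0): \text{there is a witness } y \text{ for } x \text{ with } W(y)\le w_0\},$$ and $\mathcal L_w^{(d)}$ is its restriction to triples in which all values of $W$ are at most $m(|x|)^d$. For a constant $c$, the problem min-weight-search takes as input $x$ and $W:\{1,\dots,m(|x|)\}\to\{0,1,\dots,m(|x|)^c\}$, and asks for a witness for $x$ of minimum weight $W(y)$, or for a rejection if there is no witness. (Numbers are written in binary; words that do not encode an input are to be rejected.) A catalytic logspace machine with oracle $A\subseteq\{0,1\}^*$ is a deterministic Turing machine with a read-only input tape, a one-way write-only output tape, work tapes of $O(\log n)$ cells, a binary read-write catalytic tape of $n^k$ cells for a constant $k$ ($n$ being the input length), and a one-way write-only query tape, which is erased after each query to $A$.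 It solves a search problem if, on every input and for all initial contents $\tau$ of the catalytic tape, it halts with the catalytic tape containing $\tau$ again, having output a solution if one exists (which solution may depend on $\tau$) and having rejected otherwise. **Theorem.** For every such $m$ and $R$ and every constant $c$, min-weight-search is solved by a catalytic logspace machine with oracle $\mathcal L_w$; that is, min-weight-search $\le^{\mathrm{CL}}_T$ weighted-decision. Moreover, there is a constant $d$ such that it is solved by a catalytic logspace machine with oracle $\mathcal L_w^{(d)}$, so that weighted decision for polynomially bounded weights suffices. -/

import Mathlib

namespace CatalyticLogspace

/-! ### Tapes -/

/-- The three possible head movements. -/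
inductive Move where
  | left
  | right
  | stay

/-- A tape with finitely many cells, delimited by end markers. The head at position `0` scans the
left end marker, at position `i + 1` the cell with index `i`, and at position `cells.length + 1`
the right end marker. -/
structure Tape (α : Type) where
  cells : List α
  head : ℕ

namespace Tape

variable {α : Type}

/-- A tape with the given contents, the head on the first cell. -/
def init (l : List α) : Tape α := ⟨l, 1⟩

/-- The scanned symbol; `none` on the two end markers. -/
def read (T : Tape α) : Option α :=
  match T.head with
  | 0 => none
  | i + 1 => T.cells[i]?

/-- Overwrite the scanned cell (`none`: leave it as it is). End markers are never overwritten. -/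
def write (T : Tape α) (a : Option α) : Tape α :=
  match a, T.head with
  | some b, i + 1 => ⟨T.cells.set i b, T.head⟩
  | _, _ => T

/-- Move the head; it never leaves the part of the tape between the two end markers. -/
def move (T : Tape α) : Move → Tape α
  | .left => ⟨T.cells, T.head - 1⟩
  | .right => ⟨T.cells, min (T.head + 1) (T.cells.length + 1)⟩
  | .stay => T

end Tape

/-! ### Polynomial space -/

/-- A deterministic single-tape Turing machine with an accepting and a rejecting state. -/
structure TM where
  Q : Type
  [finQ : Fintype Q]
  [decQ : DecidableEq Q]
  Γ : Type
  [finΓ : Fintype Γ]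
  /-- the tape symbols that represent the input bits -/
  bit : Bool → Γ
  blank : Γ
  start : Q
  accept : Q
  reject : Q
  accept_ne_reject : accept ≠ reject
  /-- new state, symbol to be written, head movement -/
  δ : Q → Option Γ → Q × Option Γ × Move

attribute [instance] TM.finQ TM.decQ TM.finΓ

namespace TM

structure Cfg (M : TM) where
  state : M.Q
  tape : Tape M.Γ

/-- One step; the machine halts in the states `accept` and `reject`. -/
def step (M : TM) (C : M.Cfg) : Option M.Cfg :=
  if C.state = M.accept ∨ C.state = M.reject then none
  else
    let a := M.δ C.state C.tape.read
    some ⟨a.1, (C.tape.write a.2.1).move a.2.2⟩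

/-- The initial configuration on input `w`, with `s` blank cells to the right of the input. -/
def init (M : TM) (s : ℕ) (w : List Bool) : M.Cfg :=
  ⟨M.start, Tape.init (w.map M.bit ++ List.replicate s M.blank)⟩

end TM

/-- `L` is decided by a deterministic Turing machine in polynomial space: on inputs of length `n`
the machine has a tape of `n + p(n)` cells, for a polynomial `p`. -/
def InPSPACE (L : Language Bool) : Prop :=
  ∃ (M : TM) (p : Polynomial ℕ), ∀ w : List Bool, ∃ C : M.Cfg,
    StateTransition.Reaches M.step (M.init (p.eval w.length) w) C ∧
      ((w ∈ L ∧ C.state = M.accept) ∨ (w ∉ L ∧ C.state = M.reject))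

/-! ### Catalytic oracle machines -/

/-- What a catalytic oracle machine does in one ordinary step. -/
structure Action (Q Γ : Type) (t : ℕ) where
  next : Q
  inMove : Move
  catWrite : Option Bool
  catMove : Move
  workWrite : Fin t → Option Γ
  workMove : Fin t → Move
  /-- a bit to be appended on the one-way write-only output tape, if any -/
  out : Option Bool
  /-- a bit to be appended on the one-way write-only query tape, if any -/
  ask : Option Bool

/-- A deterministic catalytic oracle Turing machine: a read-only input tape, a binary read-write
catalytic tape, `t` read-write work tapes over a finite alphabet, a one-way write-only output tape
and a one-way write-only query tape. -/
structure CatalyticTM where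
  Q : Type
  [finQ : Fintype Q]
  [decQ : DecidableEq Q]
  Γ : Type
  [finΓ : Fintype Γ]
  blank : Γ
  t : ℕ
  start : Q
  accept : Q
  reject : Q
  query : Q
  yes : Q
  no : Q
  special_nodup : [accept, reject, query].Nodup
  /-- the ordinary steps, depending on the state and on the symbols scanned on the input tape, on
  the catalytic tape and on the work tapes -/
  δ : Q → Option Bool → Option Bool → (Fin t → Option Γ) → Action Q Γ t

attribute [instance] CatalyticTM.finQ CatalyticTM.decQ CatalyticTM.finΓ

namespace CatalyticTM

structure Cfg (M : CatalyticTM) where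
  state : M.Q
  input : Tape Bool
  cat : Tape Bool
  work : Fin M.t → Tape M.Γ
  out : List Bool
  ask : List Bool

open Classical in
/-- One step with oracle `A`. In the states `accept` and `reject` the machine halts. In the state
`query` it passes to `yes` or `no`, according to whether the word on the query tape is in `A`, and
the query tape is erased. In all other states it acts according to `δ`. -/
noncomputable def step (M : CatalyticTM) (A : Language Bool) (C : M.Cfg) : Option M.Cfg :=
  if C.state = M.accept ∨ C.state = M.reject then none
  else if C.state = M.query then
    some { C with state := if C.ask ∈ A then M.yes else M.no, ask := [] }
  else
    let a := M.δ C.state C.input.read C.cat.read (fun i => (C.work i).read)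
    some
      { state := a.next
        input := C.input.move a.inMove
        cat := (C.cat.write a.catWrite).move a.catMove
        work := fun i => ((C.work i).write (a.workWrite i)).move (a.workMove i)
        out := C.out ++ a.out.toList
        ask := C.ask ++ a.ask.toList }

/-- The initial configuration on input `w`, with catalytic tape contents `τ` and with `s` blank
cells on each work tape. -/
def init (M : CatalyticTM) (s : ℕ) (w τ : List Bool) : M.Cfg where
  state := M.start
  input := Tape.init w
  cat := Tape.init τ
  work := fun _ => Tape.init (List.replicate s M.blank)
  out := []
  ask := []

end CatalyticTM

/-- The search problem `S` (where `S w` is the set of solutions of the instance `w`) is computable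
in catalytic logspace with oracle `A`. On inputs of length `n` the machine has `O(log n)` cells of
work space and `n ^ k` cells of catalytic space. For every input and all initial contents `τ` of
the catalytic tape it halts with `τ` restored; it accepts with a solution on its output tape if
there is a solution (which one may depend on `τ`), and rejects if there is none. -/
def SearchInCL (A : Language Bool) (S : List Bool → Set (List Bool)) : Prop :=
  ∃ (M : CatalyticTM) (k : ℕ), ∀ w τ : List Bool, τ.length = w.length ^ k →
    ∃ C : M.Cfg,
      StateTransition.Reaches (M.step A) (M.init (k * (Nat.log 2 w.length + 1)) w τ) C ∧
        C.cat.cells = τ ∧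
        ((C.state = M.accept ∧ C.out ∈ S w) ∨ (C.state = M.reject ∧ S w = ∅))

/-! ### Encodings -/

/-- The injective encoding of finite sequences of binary words by binary words: a word
`b₁ ⋯ bᵣ` becomes `1 b₁ ⋯ 1 bᵣ 0`, and these codes are concatenated. -/
def encode (ws : List (List Bool)) : List Bool :=
  ws.flatMap fun w => (w.flatMap fun b => [true, b]) ++ [false]

/-- The encoding of `(x, W)`, with the weights in binary. -/
def encodeInstance (x : List Bool) {m : ℕ} (W : Fin m → ℕ) : List Bool :=
  encode (x :: List.ofFn fun i => (W i).bits)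

/-- The encoding of `(x, W, w₀)`, with the numbers in binary. -/
def encodeQuery (x : List Bool) {m : ℕ} (W : Fin m → ℕ) (w₀ : ℕ) : List Bool :=
  encode (x :: (List.ofFn fun i => (W i).bits) ++ [w₀.bits])

/-! ### Weighted decision and minimum-weight search -/

/-- The set of pairs in the relation `R`, as a language. -/
def relationLanguage (R : List Bool → List Bool → Prop) : Language Bool :=
  {q | ∃ x y, q = encode [x, y] ∧ R x y}

/-- The weight `∑_{i : yᵢ = 1} W(i)` of a word `y` of length `m`. -/
def weight {m : ℕ} (W : Fin m → ℕ) (y : Fin m → Bool) : ℕ :=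
  ∑ i, if y i then W i else 0

/-- The weighted decision problem of the witness relation `R` with witness length `m`. -/
def weightedDecision (m : ℕ → ℕ) (R : List Bool → List Bool → Prop) : Language Bool :=
  {q | ∃ (x : List Bool) (W : Fin (m x.length) → ℕ) (w₀ : ℕ), q = encodeQuery x W w₀ ∧
    ∃ y : Fin (m x.length) → Bool, R x (List.ofFn y) ∧ weight W y ≤ w₀}

/-- The weighted decision problem for weights that are at most `m ^ d`. -/
def weightedDecisionBdd (m : ℕ → ℕ) (R : List Bool → List Bool → Prop) (d : ℕ) :
    Language Bool :=
  {q | ∃ (x : List Bool) (W : Fin (m x.length) → ℕ) (w₀ : ℕ), q = encodeQuery x W w₀ ∧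
    (∀ i, W i ≤ m x.length ^ d) ∧
    ∃ y : Fin (m x.length) → Bool, R x (List.ofFn y) ∧ weight W y ≤ w₀}

/-- The minimum-weight search problem for weights that are at most `m ^ c`: the solutions of the
instance `(x, W)` are the witnesses for `x` of minimum weight. Words that do not encode an
instance have no solutions. -/
def minWeightSearch (m : ℕ → ℕ) (R : List Bool → List Bool → Prop) (c : ℕ) (q : List Bool) :
    Set (List Bool) :=
  {z | ∃ (x : List Bool) (W : Fin (m x.length) → ℕ), q = encodeInstance x W ∧
    (∀ i, W i ≤ m x.length ^ c) ∧
    ∃ y : Fin (m x.length) → Bool, z = List.ofFn y ∧ R x (List.ofFn y) ∧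
      ∀ y' : Fin (m x.length) → Bool, R x (List.ofFn y') → weight W y ≤ weight W y'}

end CatalyticLogspace

namespace CatalyticLogspace

set_option linter.unusedSectionVars false

/-! ### Machine fragments -/

/-! Write `r = m(|x|)`. The proof is a compress-or-isolate argument. Call an index `i` ambiguous for
given weights if some minimum-weight witness contains `i` and another one does not. For polynomially
bounded weights the oracle yields the minimum weight by trying all bounds `w₀ = 0, 1, …`. Lowering
the weight of `i` by one lowers the minimum iff some minimum-weight witness contains `i`; raising it
by one does not raise the minimum iff some minimum-weight witness avoids `i`. So ambiguity can be
tested, and if no index is ambiguous, the minimum-weight witness is unique and can be written bit by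
bit (`amb_iff`, `IsMin.apply_eq_true_iff`).

To break ties, the input weights are multiplied by a number `S` exceeding the sum of all
perturbations, and a small perturbation of each weight is read from the catalytic tape; minimum
weight for the perturbed weights then implies minimum weight for the original ones
(`isMin_of_scaled`). The tape is viewed as `r` blocks of `r` fields of `a + 1` bits, where `a` is
least with `r ≤ 2 ^ a`; each block is one candidate perturbation. If some block leaves no ambiguity,
the witness is written and the tape is never touched.

Otherwise every block has an ambiguous index `i`. The perturbation at `i` is then determined by the
other fields: ambiguity says that the best word with `i` and the best word without `i` have equal
weight, and only the former weight depends on the perturbation at `i` (`Amb.unique`). So the field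
at `i` is redundant. It takes over the contents of the first field, which in turn stores `i` in `a`
bits and leaves one bit free. The `r` blocks give `r` free bits, all set to one, and these are used
as a new perturbation. Going through the indices, the bit of `k` is cleared whenever `k` occurs in a
minimum-weight witness; after that all minimum-weight witnesses contain `k`, and they were of
minimum weight before, so `k` is no longer ambiguous and no ambiguity is created
(`not_amb_of_decrease`). At the end no ambiguity is left and the witness is written. The tape is
restored by trying all values of the redundant field until `i` becomes ambiguous
(`Packed.ambAt_iff`). `ev_minWitness` puts the two cases together.

To run this on a Turing machine, programs are written as terms `Tm` over logarithmically many bits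
per variable, with denotational semantics `ev`. They are compiled to program fragments acting on
registers that lie on parallel tracks of one work tape (`Tm.compile_spec`), and the fragments become
machines (`reaches_of_runs`); `searchInCL_of_ev` sums this up. A single query first certifies that
the input is an instance with a witness. All further queries have weights at most `r ^ (c + 5)`
(`query_bound`), so one program serves both oracles. -/

/-- The memory of a catalytic oracle machine with a single work tape. -/
structure Mem (Γ : Type) where
  input : Tape Bool
  cat : Tape Bool
  work : Tape Γ
  out : List Bool
  ask : List Bool

/-- The effect of one step on the memory. -/
structure Eff (Γ : Type) where
  inMove : Move := .stay
  catWrite : Option Bool := none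
  catMove : Move := .stay
  workWrite : Option Γ := none
  workMove : Move := .stay
  out : Option Bool := none
  ask : Option Bool := none

def Eff.apply {Γ : Type} (e : Eff Γ) (C : Mem Γ) : Mem Γ where
  input := C.input.move e.inMove
  cat := (C.cat.write e.catWrite).move e.catMove
  work := (C.work.write e.workWrite).move e.workMove
  out := C.out ++ e.out.toList
  ask := C.ask ++ e.ask.toList

/-- The scanned symbols. -/
structure Scan (Γ : Type) where
  inp : Option Bool
  cat : Option Bool
  work : Option Γ

def Mem.scan {Γ : Type} (C : Mem Γ) : Scan Γ := ⟨C.input.read, C.cat.read, C.work.read⟩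

/-- A program fragment with one entry and one exit (`none`). In a state with `call` the query is
submitted first, and the second argument of `δ` is the answer of the oracle. -/
structure Frag (Γ : Type) where
  Q : Type
  [finQ : Fintype Q]
  [decQ : DecidableEq Q]
  start : Q
  call : Q → Bool
  δ : Q → Bool → Scan Γ → Option Q × Eff Γ

attribute [instance] Frag.finQ Frag.decQ

namespace Frag

variable {Γ : Type} {A : Language Bool}

open Classical in
noncomputable def step (F : Frag Γ) (A : Language Bool) (q : F.Q) (C : Mem Γ) :
    Option F.Q × Mem Γ :=
  if F.call q then
    ((F.δ q (decide (C.ask ∈ A)) C.scan).1,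
      (F.δ q (decide (C.ask ∈ A)) C.scan).2.apply { C with ask := [] })
  else ((F.δ q false C.scan).1, (F.δ q false C.scan).2.apply C)

/-- `F.Run A q C C'`: started in the state `q` with memory `C` the fragment reaches its exit with
memory `C'`. Queries are only allowed with the work head on a cell of the work tape. -/
inductive Run (F : Frag Γ) (A : Language Bool) : F.Q → Mem Γ → Mem Γ → Prop
  | exit {q C C'} : (F.call q = true → C.work.read ≠ none) → F.step A q C = (none, C') →
      Run F A q C C'
  | next {q q' C C₁ C'} : (F.call q = true → C.work.read ≠ none) →
      F.step A q C = (some q', C₁) → Run F A q' C₁ C' → Run F A q C C'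

def Runs (F : Frag Γ) (A : Language Bool) (C C' : Mem Γ) : Prop := F.Run A F.start C C'

/-- A single step. -/
def act (f : Scan Γ → Eff Γ) : Frag Γ where
  Q := Unit
  start := ()
  call _ := false
  δ _ _ s := (none, f s)

/-- A single query. -/
def oracle (f : Bool → Scan Γ → Eff Γ) : Frag Γ where
  Q := Unit
  start := ()
  call _ := true
  δ _ b s := (none, f b s)

def seq (F G : Frag Γ) : Frag Γ where
  Q := F.Q ⊕ G.Q
  start := .inl F.start
  call := Sum.elim F.call G.call
  δ
    | .inl q, b, s => (some (((F.δ q b s).1).elim (.inr G.start) .inl), (F.δ q b s).2)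
    | .inr q, b, s => (((G.δ q b s).1).map .inr, (G.δ q b s).2)

def cond (c : Scan Γ → Bool) (F G : Frag Γ) : Frag Γ where
  Q := Option (F.Q ⊕ G.Q)
  start := none
  call
    | none => false
    | some q => Sum.elim F.call G.call q
  δ
    | none, _, s => (some (some (if c s then .inl F.start else .inr G.start)), {})
    | some (.inl q), b, s => (((F.δ q b s).1).map (some ∘ .inl), (F.δ q b s).2)
    | some (.inr q), b, s => (((G.δ q b s).1).map (some ∘ .inr), (G.δ q b s).2)

def loop (c : Scan Γ → Bool) (F : Frag Γ) : Frag Γ where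
  Q := Option F.Q
  start := none
  call
    | none => false
    | some q => F.call q
  δ
    | none, _, s => (if c s then some (some F.start) else none, {})
    | some q, b, s => (some (F.δ q b s).1, (F.δ q b s).2)

@[simp] theorem apply_nil (C : Mem Γ) : Eff.apply {} C = C := by
  cases C; simp [Eff.apply, Tape.move, Tape.write]

theorem act_runs (f : Scan Γ → Eff Γ) (C : Mem Γ) : (act f).Runs A C ((f C.scan).apply C) :=
  .exit (by simp [act]) (by simp [step, act])

open Classical in
theorem oracle_runs (f : Bool → Scan Γ → Eff Γ) {C : Mem Γ} (h : C.work.read ≠ none) :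
    (oracle f).Runs A C ((f (decide (C.ask ∈ A)) C.scan).apply { C with ask := [] }) :=
  .exit (fun _ => h) (by simp [step, oracle])

theorem seq_run_inr {F G : Frag Γ} {q : G.Q} {C C' : Mem Γ} (h : G.Run A q C C') :
    (seq F G).Run A (Sum.inr q : F.Q ⊕ G.Q) C C' := by
  induction h with
  | exit h1 h2 =>
    refine .exit h1 ?_
    simp only [step, seq, Sum.elim_inr] at h2 ⊢
    split_ifs at h2 ⊢ <;> simp_all
  | next h1 h2 _ ih =>
    refine .next h1 ?_ ih
    simp only [step, seq, Sum.elim_inr] at h2 ⊢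
    split_ifs at h2 ⊢ <;> simp_all

theorem seq_runs {F G : Frag Γ} {C C₁ C' : Mem Γ} (h : F.Runs A C C₁) (h' : G.Runs A C₁ C') :
    (seq F G).Runs A C C' := by
  have key : ∀ q C C₁, F.Run A q C C₁ → G.Runs A C₁ C' → (seq F G).Run A (Sum.inl q : F.Q ⊕ G.Q) C C' := by
    intro q C C₁ h
    induction h with
    | exit h1 h2 =>
      intro h'
      refine .next (q' := (Sum.inr G.start : F.Q ⊕ G.Q)) h1 ?_ (seq_run_inr h')
      simp only [step, seq, Sum.elim_inl] at h2 ⊢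
      split_ifs at h2 ⊢ <;> simp_all
    | next h1 h2 _ ih =>
      intro h'
      refine .next h1 ?_ (ih h')
      simp only [step, seq, Sum.elim_inl] at h2 ⊢
      split_ifs at h2 ⊢ <;> simp_all
  exact key _ _ _ h h'

theorem cond_run_inl {c : Scan Γ → Bool} {F G : Frag Γ} {q : F.Q} {C C' : Mem Γ}
    (h : F.Run A q C C') : (cond c F G).Run A (some (Sum.inl q) : Option (F.Q ⊕ G.Q)) C C' := by
  induction h with
  | exit h1 h2 =>
    refine .exit h1 ?_
    simp only [step, cond, Sum.elim_inl] at h2 ⊢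
    split_ifs at h2 ⊢ <;> simp_all
  | next h1 h2 _ ih =>
    refine .next h1 ?_ ih
    simp only [step, cond, Sum.elim_inl] at h2 ⊢
    split_ifs at h2 ⊢ <;> simp_all

theorem cond_run_inr {c : Scan Γ → Bool} {F G : Frag Γ} {q : G.Q} {C C' : Mem Γ}
    (h : G.Run A q C C') : (cond c F G).Run A (some (Sum.inr q) : Option (F.Q ⊕ G.Q)) C C' := by
  induction h with
  | exit h1 h2 =>
    refine .exit h1 ?_
    simp only [step, cond, Sum.elim_inr] at h2 ⊢
    split_ifs at h2 ⊢ <;> simp_all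
  | next h1 h2 _ ih =>
    refine .next h1 ?_ ih
    simp only [step, cond, Sum.elim_inr] at h2 ⊢
    split_ifs at h2 ⊢ <;> simp_all

theorem cond_runs_true {c : Scan Γ → Bool} {F G : Frag Γ} {C C' : Mem Γ}
    (hc : c C.scan = true) (h : F.Runs A C C') : (cond c F G).Runs A C C' :=
  .next (q' := (some (Sum.inl F.start) : Option (F.Q ⊕ G.Q))) (by simp [cond]) (by simp [step, cond, hc]) (cond_run_inl h)

theorem cond_runs_false {c : Scan Γ → Bool} {F G : Frag Γ} {C C' : Mem Γ}
    (hc : c C.scan = false) (h : G.Runs A C C') : (cond c F G).Runs A C C' :=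
  .next (q' := (some (Sum.inr G.start) : Option (F.Q ⊕ G.Q))) (by simp [cond]) (by simp [step, cond, hc]) (cond_run_inr h)

theorem loop_runs_false {c : Scan Γ → Bool} {F : Frag Γ} {C : Mem Γ}
    (hc : c C.scan = false) : (loop c F).Runs A C C :=
  .exit (by simp [loop]) (by simp [step, loop, hc])

theorem loop_runs_true {c : Scan Γ → Bool} {F : Frag Γ} {C C₁ C' : Mem Γ}
    (hc : c C.scan = true) (h : F.Runs A C C₁) (h' : (loop c F).Runs A C₁ C') :
    (loop c F).Runs A C C' := by
  have key : ∀ q C C₁, F.Run A q C C₁ → (loop c F).Runs A C₁ C' →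
      (loop c F).Run A (some q : Option F.Q) C C' := by
    intro q C C₁ h
    induction h with
    | exit h1 h2 =>
      intro h'
      refine .next (q' := (loop c F).start) h1 ?_ h'
      simp only [step, loop] at h2 ⊢
      split_ifs at h2 ⊢ <;> simp_all
    | next h1 h2 _ ih =>
      intro h'
      refine .next h1 ?_ (ih h')
      simp only [step, loop] at h2 ⊢
      split_ifs at h2 ⊢ <;> simp_all
  exact .next (q' := (some F.start : Option F.Q)) (by simp [loop]) (by simp [step, loop, hc]) (key _ _ _ h h')

/-! ### From fragments to machines -/

/-- The action of the machine that belongs to a step of a fragment. -/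
def lift {Q : Type} (g : Option Γ) (a : Option Q × Eff Γ) :
    Action (Fin 6 ⊕ Q) (Γ × Option Q) 1 where
  next := a.1.elim (.inl 5) .inr
  inMove := a.2.inMove
  catWrite := a.2.catWrite
  catMove := a.2.catMove
  workWrite _ := (a.2.workWrite.or g).map (·, none)
  workMove _ := a.2.workMove
  out := a.2.out
  ask := a.2.ask

/-- An action that does nothing but to change the state and to write on the work tape. -/
def goto {Q : Type} (q : Fin 6 ⊕ Q) (g : Option (Γ × Option Q)) :
    Action (Fin 6 ⊕ Q) (Γ × Option Q) 1 where
  next := q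
  inMove := .stay
  catWrite := none
  catMove := .stay
  workWrite _ := g
  workMove _ := .stay
  out := none
  ask := none

/-- The machine that runs the fragment `F` and then accepts or rejects according to the symbol
scanned on the work tape. During a query the state to be resumed is kept in the scanned cell. -/
def toMachine [Fintype Γ] (F : Frag Γ) (blank : Γ) (acc : Option Γ → Bool) : CatalyticTM where
  -- The extra states `0, …, 5` are accept, reject, query, yes, no, and the exit of the fragment.
  Q := Fin 6 ⊕ F.Q
  Γ := Γ × Option F.Q
  blank := (blank, none)
  t := 1
  start := .inr F.start
  accept := .inl 0
  reject := .inl 1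
  query := .inl 2
  yes := .inl 3
  no := .inl 4
  special_nodup := by simp
  δ q i c wk :=
    match q with
    | .inr q =>
      if F.call q then goto (.inl 2) (((wk 0).map Prod.fst).map (·, some q))
      else lift ((wk 0).map Prod.fst) (F.δ q false ⟨i, c, (wk 0).map Prod.fst⟩)
    | .inl j =>
      if j = 5 then goto (.inl (if acc ((wk 0).map Prod.fst) then 0 else 1)) none
      else match (wk 0).bind Prod.snd with
        | some q => lift ((wk 0).map Prod.fst)
            (F.δ q (decide (j = 3)) ⟨i, c, (wk 0).map Prod.fst⟩)
        | none => goto (.inl 5) none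

/-- The tape with the symbols of `T`, and no return address. -/
def embTape (Q : Type) (T : Tape Γ) : Tape (Γ × Option Q) := ⟨T.cells.map (·, none), T.head⟩

theorem embTape_read {Q : Type} (T : Tape Γ) :
    (embTape Q T).read = T.read.map (·, none) := by
  obtain ⟨l, h⟩ := T
  cases h <;> simp [embTape, Tape.read]

theorem embTape_move {Q : Type} (T : Tape Γ) (d : Move) :
    (embTape Q T).move d = embTape Q (T.move d) := by
  cases d <;> simp [embTape, Tape.move]

/-- A step of a fragment that writes nothing is simulated by rewriting the scanned symbol. This
keeps the contents and erases a return address left in the cell by a query. -/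
theorem embTape_write {Q : Type} (T : Tape Γ) (a : Option Γ) :
    (embTape Q T).write ((a.or T.read).map (·, none)) = embTape Q (T.write a) := by
  obtain ⟨l, h⟩ := T
  cases h with
  | zero => cases a <;> simp [embTape, Tape.write, Tape.read]
  | succ h =>
    cases a with
    | some a => simp [embTape, Tape.write, List.map_set]
    | none =>
      simp only [Option.none_or, Tape.read, embTape, Tape.write]
      cases hl : l[h]? with
      | none => simp
      | some b =>
        simp only [Option.map_some, Tape.mk.injEq, and_true]
        rw [← List.map_set]
        congr 1
        refine List.ext_getElem? fun i => ?_
        rw [List.getElem?_set]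
        split_ifs with h1 h2
        · subst h1; exact hl.symm
        · subst h1; simp_all
        · rfl

theorem write_write (T : Tape Γ) (a b : Γ) :
    (T.write (some a)).write (some b) = T.write (some b) := by
  obtain ⟨l, h⟩ := T
  cases h <;> simp [Tape.write]

theorem map_fst_map {Q : Type} (q : Q) (o : Option Γ) :
    (o.map (fun g => (g, q))).map Prod.fst = o := by
  cases o <;> rfl

variable [Fintype Γ] (F : Frag Γ) (blank : Γ) (acc : Option Γ → Bool)

/-- The configuration of the machine with a given memory. -/
def cfg (q : Fin 6 ⊕ F.Q) (C : Mem Γ) : (F.toMachine blank acc).Cfg where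
  state := q
  input := C.input
  cat := C.cat
  work _ := embTape F.Q C.work
  out := C.out
  ask := C.ask

theorem step_ordinary {q : F.Q} {C : Mem Γ} (h : F.call q = false) :
    (F.toMachine blank acc).step A (cfg F blank acc (.inr q) C) =
      some (cfg F blank acc ((F.step A q C).1.elim (.inl 5) .inr) (F.step A q C).2) := by
  simp [CatalyticTM.step, cfg, toMachine, step, h, lift, Eff.apply, embTape_read, Mem.scan,
    embTape_write, embTape_move, Function.comp_def]

/-- Three machine steps simulate one step of the fragment: store the state in the scanned cell,
query, and resume from the stored state. The states `yes` and `no` are the same for all queries, so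
the state must survive on the tape; on an end marker it could not be stored, whence `hr`. -/
theorem reaches_of_call {q : F.Q} {C : Mem Γ} (h : F.call q = true) (hr : C.work.read ≠ none) :
    StateTransition.Reaches ((F.toMachine blank acc).step A) (cfg F blank acc (.inr q) C)
      (cfg F blank acc ((F.step A q C).1.elim (.inl 5) .inr) (F.step A q C).2) := by
  classical
  obtain ⟨g, hg⟩ := Option.ne_none_iff_exists'.1 hr
  let T' : Tape (Γ × Option F.Q) := (embTape F.Q C.work).write (some (g, some q))
  let C1 : (F.toMachine blank acc).Cfg :=
    ⟨.inl 2, C.input, C.cat, fun _ => T', C.out, C.ask⟩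
  let C2 : (F.toMachine blank acc).Cfg :=
    ⟨if C.ask ∈ A then .inl 3 else .inl 4, C.input, C.cat, fun _ => T', C.out, []⟩
  have hT : T'.read = some (g, some q) := by
    revert hg
    obtain ⟨i, c, ⟨l, h⟩, o, k⟩ := C
    cases h with
    | zero => simp [Tape.read]
    | succ h =>
      intro hg
      simp only [Tape.read] at hg
      obtain ⟨h1, h2⟩ := List.getElem?_eq_some_iff.1 hg
      simp [T', embTape, Tape.read, Tape.write, h1]
  refine .head (b := C1) ?_ (.head (b := C2) ?_ (.single ?_))
  · simp [CatalyticTM.step, cfg, toMachine, h, goto, embTape_read, C1, T', hg,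
      Tape.move]
    rfl
  · simp [CatalyticTM.step, toMachine, C1, C2]
    rfl
  · have key : ∀ e : Option Γ, T'.write (some (e.getD g, none)) =
        embTape F.Q (C.work.write e) := by
      intro e
      rw [← embTape_write, hg, Option.or_some, Option.map_some]
      exact write_write _ _ _
    by_cases hA : C.ask ∈ A <;>
    simp [CatalyticTM.step, toMachine, C2, hA, hT, cfg, step, h, lift, Eff.apply, key,
      embTape_move, Mem.scan, hg] <;> rfl

theorem reaches_of_run {q : F.Q} {C C' : Mem Γ} (h : F.Run A q C C') :
    StateTransition.Reaches ((F.toMachine blank acc).step A) (cfg F blank acc (.inr q) C)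
      (cfg F blank acc (.inl 5) C') := by
  have one : ∀ (q : F.Q) (C : Mem Γ), (F.call q = true → C.work.read ≠ none) →
      StateTransition.Reaches ((F.toMachine blank acc).step A) (cfg F blank acc (.inr q) C)
        (cfg F blank acc ((F.step A q C).1.elim (.inl 5) .inr) (F.step A q C).2) := by
    intro q C h
    cases hq : F.call q with
    | false => exact .single (by rw [step_ordinary F blank acc hq]; rfl)
    | true => exact reaches_of_call F blank acc hq (h hq)
  induction h with
  | exit h1 h2 => simpa [h2] using one _ _ h1
  | next h1 h2 _ ih =>
    have := one _ _ h1
    rw [h2] at this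
    exact .trans this ih

theorem reaches_of_runs {C C' : Mem Γ} (h : F.Runs A C C') :
    StateTransition.Reaches ((F.toMachine blank acc).step A) (cfg F blank acc (.inr F.start) C)
      (cfg F blank acc (.inl (if acc C'.work.read then 0 else 1)) C') := by
  refine .trans (reaches_of_run F blank acc h) (.single ?_)
  have hc := map_fst_map (none : Option F.Q) C'.work.read
  rw [Option.map_map] at hc
  simp [CatalyticTM.step, cfg, toMachine, goto, embTape_read, hc, Tape.move, Tape.write]
  rfl

end Frag

/-! ### Head movements -/

/-- The three two-way tapes of a fragment. -/
inductive Side where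
  | inp
  | cat
  | work

namespace Side

variable {Γ : Type}

def moveEff (d : Move) : Side → Eff Γ
  | inp => { inMove := d }
  | cat => { catMove := d }
  | work => { workMove := d }

def atEnd (c : Scan Γ) : Side → Bool
  | inp => c.inp.isNone
  | cat => c.cat.isNone
  | work => c.work.isNone

def len (C : Mem Γ) : Side → ℕ
  | inp => C.input.cells.length
  | cat => C.cat.cells.length
  | work => C.work.cells.length

def head (C : Mem Γ) : Side → ℕ
  | inp => C.input.head
  | cat => C.cat.head
  | work => C.work.head

def setHead (C : Mem Γ) (h : ℕ) : Side → Mem Γ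
  | inp => { C with input := ⟨C.input.cells, h⟩ }
  | cat => { C with cat := ⟨C.cat.cells, h⟩ }
  | work => { C with work := ⟨C.work.cells, h⟩ }

variable (sd : Side) (C : Mem Γ)

theorem moveEff_right : (sd.moveEff .right).apply C =
    sd.setHead C (min (sd.head C + 1) (sd.len C + 1)) := by
  cases sd <;> simp [moveEff, setHead, head, len, Eff.apply, Tape.move, Tape.write]

theorem moveEff_left : (sd.moveEff .left).apply C = sd.setHead C (sd.head C - 1) := by
  cases sd <;> simp [moveEff, setHead, head, Eff.apply, Tape.move, Tape.write]

@[simp] theorem setHead_setHead (h h' : ℕ) :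
    sd.setHead (sd.setHead C h) h' = sd.setHead C h' := by
  cases sd <;> rfl

@[simp] theorem head_setHead (h : ℕ) : sd.head (sd.setHead C h) = h := by
  cases sd <;> rfl

@[simp] theorem len_setHead (h : ℕ) : sd.len (sd.setHead C h) = sd.len C := by
  cases sd <;> rfl

theorem atEnd_zero : sd.atEnd (sd.setHead C 0).scan = true := by
  cases sd <;> rfl

theorem atEnd_succ (h : ℕ) : sd.atEnd (sd.setHead C (h + 1)).scan = decide (sd.len C ≤ h) := by
  rw [Bool.eq_iff_iff, decide_eq_true_iff]
  cases sd <;> simp [atEnd, Mem.scan, setHead, Tape.read, len]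

end Side

/-- The memory with other contents of the work tape. -/
def Mem.withWork {Γ : Type} (C : Mem Γ) (l : List Γ) (h : ℕ) : Mem Γ := { C with work := ⟨l, h⟩ }

namespace Frag

open Mem

variable {Γ : Type} {A : Language Bool}

/-- Move the head back to the first cell. -/
def rewind (sd : Side) : Frag Γ :=
  -- The unconditional first move is for a head on the right end marker, where the loop would stop
  -- at once.
  seq (act fun _ => sd.moveEff .left)
    (seq (loop (fun c => !sd.atEnd c) (act fun _ => sd.moveEff .left))
      (act fun _ => sd.moveEff .right))

theorem rewind_runs (sd : Side) (C : Mem Γ) (h : ℕ) (hh : h ≤ sd.len C) :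
    (rewind sd).Runs A (sd.setHead C (h + 1)) (sd.setHead C 1) := by
  have key : ∀ h, h ≤ sd.len C → (loop (fun c => !sd.atEnd c)
      (act fun _ => sd.moveEff .left)).Runs A (sd.setHead C h) (sd.setHead C 0) := by
    intro h
    induction h with
    | zero => exact fun _ => loop_runs_false (by simp [sd.atEnd_zero])
    | succ h ih =>
      intro hh
      refine loop_runs_true (by simp [sd.atEnd_succ]; omega) ?_ (ih (by omega))
      simpa [sd.moveEff_left] using act_runs (A := A) (fun _ => sd.moveEff .left)
        (sd.setHead C (h + 1))
  refine seq_runs (act_runs _ _) (seq_runs (C₁ := sd.setHead C 0) ?_ ?_)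
  · simpa [sd.moveEff_left] using key h hh
  · simpa [sd.moveEff_right] using act_runs (A := A) (fun _ => sd.moveEff .right)
      (sd.setHead C 0)

/-! ### Operations on the tracks of the work tape -/

variable {I : Type} [DecidableEq I]

/-- Move right as long as track `x` shows `b`. -/
def scanTrack (b : Bool) (x : I) : Frag (I → Bool) :=
  loop (fun c => c.work.any fun g => g x == b) (act fun _ => { workMove := .right })

/-- An empty `l₂` stands for the right end marker, so the condition on `l₂.head?` covers both ways
of stopping. -/
theorem scanTrack_runs {b : Bool} {x : I} (C : Mem (I → Bool)) (l₂ : List (I → Bool))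
    (h₂ : ∀ g ∈ l₂.head?, g x = !b) (l₁ : List (I → Bool)) (pre : List (I → Bool))
    (h₁ : ∀ g ∈ l₁, g x = b) :
    (scanTrack b x).Runs A (withWork C (pre ++ l₁ ++ l₂) (pre.length + 1))
      (withWork C (pre ++ l₁ ++ l₂) ((pre ++ l₁).length + 1)) := by
  induction l₁ generalizing pre with
  | nil =>
    simp only [List.append_nil]
    refine loop_runs_false ?_
    cases l₂ with
    | nil => simp [Mem.scan, Tape.read, withWork]
    | cons g l₂ =>
      have := h₂ g (by simp)
      simp [Mem.scan, Tape.read, withWork, this]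
  | cons g l₁ ih =>
    have hg := h₁ g (by simp)
    refine loop_runs_true ?_ (act_runs _ _) ?_
    · simp [Mem.scan, Tape.read, withWork, hg]
    · have := ih (pre ++ [g]) fun a ha => h₁ a (by simp [ha])
      simpa [scanTrack, Eff.apply, withWork, Tape.move, Tape.write] using this

/-- Apply `φ` to all cells. -/
def sweep (φ : (I → Bool) → (I → Bool)) : Frag (I → Bool) :=
  seq (loop (fun c => c.work.isSome)
    (act fun c => { workWrite := c.work.map φ, workMove := .right })) (rewind .work)

theorem sweep_runs (φ : (I → Bool) → (I → Bool)) (C : Mem (I → Bool)) (l : List (I → Bool)) :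
    (sweep φ).Runs A (withWork C l 1) (withWork C (l.map φ) 1) := by
  have key : ∀ post pre : List (I → Bool), (loop (fun c => c.work.isSome)
      (act fun c => { workWrite := c.work.map φ, workMove := .right })).Runs A
      (withWork C (pre ++ post) (pre.length + 1))
      (withWork C (pre ++ post.map φ) ((pre ++ post).length + 1)) := by
    intro post
    induction post with
    | nil =>
      intro pre
      simpa using loop_runs_false (by simp [Mem.scan, Tape.read, withWork])
    | cons g post ih =>
      intro pre
      refine loop_runs_true ?_ (act_runs _ _) ?_
      · simp [Mem.scan, Tape.read, withWork]
      · have := ih (pre ++ [φ g])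
        simpa [Eff.apply, withWork, Tape.move, Tape.write, Mem.scan, Tape.read] using this
  refine seq_runs (key l []) ?_
  simpa [withWork, Side.setHead] using
    rewind_runs (A := A) .work (withWork C (l.map φ) 1) l.length (by simp [Side.len, withWork])

/-- Change the first `!b` on track `x` to `b`, and the `b`s before it to `!b`. -/
def bump (b : Bool) (x : I) : Frag (I → Bool) :=
  seq (scanTrack b x)
    (cond (fun c => c.work.isSome)
      (seq (act fun c => { workWrite := c.work.map (Function.update · x b), workMove := .left })
        (seq (loop (fun c => c.work.isSome)
            (act fun c => { workWrite := c.work.map (Function.update · x (!b)),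
                            workMove := .left }))
          (act fun _ => { workMove := .right })))
      (rewind .work))

/-- With the least significant bit first, this is the carry of an increment for `b = true` and the
borrow of a decrement for `b = false`. -/
theorem bump_runs {b : Bool} {x : I} (C : Mem (I → Bool)) (l₁ l₂ : List (I → Bool))
    (g : I → Bool) (h₁ : ∀ g ∈ l₁, g x = b) (hg : g x = !b) :
    (bump b x).Runs A (withWork C (l₁ ++ g :: l₂) 1)
      (withWork C (l₁.map (Function.update · x (!b)) ++ Function.update g x b :: l₂) 1) := by
  have h := scanTrack_runs (A := A) C (g :: l₂) (by simpa using hg) l₁ [] h₁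
  simp only [List.nil_append, List.length_nil, zero_add] at h
  have key : ∀ (l₁ l₂ : List (I → Bool)), (loop (fun c => c.work.isSome)
      (act fun c => { workWrite := c.work.map (Function.update · x (!b)),
                      workMove := .left })).Runs A
      (withWork C (l₁ ++ l₂) l₁.length)
      (withWork C (l₁.map (Function.update · x (!b)) ++ l₂) 0) := by
    intro l₁
    induction l₁ using List.reverseRecOn with
    | nil =>
      intro l₂
      exact loop_runs_false (by simp [Mem.scan, Tape.read, withWork])
    | append_singleton l₁ a ih =>
      intro l₂
      refine loop_runs_true ?_ (act_runs _ _) ?_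
      · simp [Mem.scan, Tape.read, withWork]
      · have := ih (Function.update a x (!b) :: l₂)
        simpa [Eff.apply, withWork, Tape.move, Tape.write, Mem.scan, Tape.read] using this
  refine seq_runs h (cond_runs_true ?_ (seq_runs (act_runs _ _) (seq_runs
    (C₁ := withWork C (l₁.map (Function.update · x (!b)) ++ Function.update g x b :: l₂) 0) ?_ ?_)))
  · simp [Mem.scan, Tape.read, withWork]
  · have := key l₁ (Function.update g x b :: l₂)
    simpa [Eff.apply, withWork, Tape.move, Tape.write, Mem.scan, Tape.read] using this
  · have := act_runs (A := A) (fun _ => { workMove := .right })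
      (withWork C (l₁.map (Function.update · x (!b)) ++ Function.update g x b :: l₂) 0)
    simpa [Eff.apply, withWork, Tape.move, Tape.write, Mem.scan, Tape.read] using this

/-- Overflow and underflow leave the number as it is, so that the arithmetic of registers saturates
at both ends. -/
theorem bump_runs_of_forall {b : Bool} {x : I} (C : Mem (I → Bool)) (l : List (I → Bool))
    (h : ∀ g ∈ l, g x = b) : (bump b x).Runs A (withWork C l 1) (withWork C l 1) := by
  have h := scanTrack_runs (A := A) C [] (by simp) l [] h
  simp only [List.nil_append, List.length_nil, zero_add, List.append_nil] at h
  refine seq_runs h (cond_runs_false ?_ ?_)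
  · simp [Mem.scan, Tape.read, withWork]
  · simpa [withWork, Side.setHead] using
      rewind_runs (A := A) .work (withWork C l 1) l.length (by simp [Side.len, withWork])

end Frag

/-! ### Registers -/

/-- The state of a computation as seen by the programs below. -/
structure St where
  cat : List Bool
  out : List Bool
  ask : List Bool

/-- The contents of `s` cells of the work tape that hold the binary numbers `ρ i` on its tracks. -/
def cells (T s : ℕ) (ρ : ℕ → ℕ) : List (Fin T → Bool) :=
  (List.range s).map fun j i => (ρ i).testBit j

@[simp] theorem length_cells (T s : ℕ) (ρ : ℕ → ℕ) : (cells T s ρ).length = s := by simp [cells]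

theorem getElem_cells {T s : ℕ} (ρ : ℕ → ℕ) {j : ℕ} (hj : j < (cells T s ρ).length) :
    (cells T s ρ)[j] = fun i : Fin T => (ρ i).testBit j := by simp [cells]

/-- The memory with given registers, state and head positions. -/
def memAt (T s : ℕ) (w : List Bool) (ρ : ℕ → ℕ) (st : St) (hi hc hw : ℕ) : Mem (Fin T → Bool) :=
  ⟨⟨w, hi⟩, ⟨st.cat, hc⟩, ⟨cells T s ρ, hw⟩, st.out, st.ask⟩

/-- The memory with all heads on the first cell. -/
abbrev mem (T s : ℕ) (w : List Bool) (ρ : ℕ → ℕ) (st : St) : Mem (Fin T → Bool) :=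
  memAt T s w ρ st 1 1 1

/-- A positive number is `2 ^ p * (2 * q + 1)`, and subtracting one flips exactly its lowest `p + 1`
bits. Read in either direction this describes both increments and decrements. -/
theorem testBit_succ_pred (p q j : ℕ) :
    (2 ^ p * (2 * q + 1)).testBit j =
        (if j < p then false else if j = p then true else q.testBit (j - p - 1)) ∧
      (2 ^ p * (2 * q + 1) - 1).testBit j =
        (if j < p then true else if j = p then false else q.testBit (j - p - 1)) := by
  have h1 := Nat.testBit_two_pow_mul_add (2 * q + 1) (Nat.two_pow_pos p) j
  have hp : 2 ^ p - 1 < 2 ^ p := Nat.sub_lt (Nat.two_pow_pos p) one_pos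
  have h2 := Nat.testBit_two_pow_mul_add (2 * q) hp j
  have e : 2 ^ p * (2 * q + 1) - 1 = 2 ^ p * (2 * q) + (2 ^ p - 1) := by
    have := Nat.two_pow_pos p
    rw [mul_add]; omega
  rw [add_zero] at h1
  rw [e, h1, h2]
  constructor
  · split_ifs with h h'
    · simp
    · subst h'; simp [Nat.testBit_zero]
    · obtain ⟨k, hk⟩ : ∃ k, j - p = k + 1 := ⟨j - p - 1, by omega⟩
      rw [hk, Nat.testBit_succ]
      congr 1; omega
  · split_ifs with h h'
    · simp [Nat.testBit_two_pow_sub_one, h]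
    · subst h'; simp [Nat.testBit_zero]
    · obtain ⟨k, hk⟩ : ∃ k, j - p = k + 1 := ⟨j - p - 1, by omega⟩
      rw [hk, Nat.testBit_succ]
      congr 1; omega

/-- The binary expansions of `v` and `v'` are related as in `Frag.bump b`. -/
def BumpTo (b : Bool) (s v v' : ℕ) : Prop :=
  ∃ p < s, (∀ j < p, v.testBit j = b) ∧ v.testBit p = !b ∧
    ∀ j, v'.testBit j = if j < p then !b else if j = p then b else v.testBit j

theorem bumpTo_succ {s v : ℕ} (h : v + 1 < 2 ^ s) : BumpTo true s v (v + 1) := by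
  obtain ⟨p, m, ⟨q, rfl⟩, hv⟩ := Nat.exists_eq_two_pow_mul_odd (Nat.succ_ne_zero v)
  have hv' : v = 2 ^ p * (2 * q + 1) - 1 := by omega
  refine ⟨p, ?_, ?_, ?_, ?_⟩
  · rw [← Nat.pow_lt_pow_iff_right (one_lt_two)]
    refine lt_of_le_of_lt ?_ h
    rw [Nat.succ_eq_add_one] at hv
    rw [hv]; exact Nat.le_mul_of_pos_right _ (by omega)
  · intro j hj; rw [hv', (testBit_succ_pred p q j).2, if_pos hj]
  · rw [hv', (testBit_succ_pred p q p).2]; simp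
  · intro j
    rw [← Nat.succ_eq_add_one, hv, (testBit_succ_pred p q j).1, hv', (testBit_succ_pred p q j).2]
    split_ifs <;> rfl

theorem bumpTo_pred {s v : ℕ} (h0 : 0 < v) (h : v < 2 ^ s) : BumpTo false s v (v - 1) := by
  obtain ⟨p, m, ⟨q, rfl⟩, hv⟩ := Nat.exists_eq_two_pow_mul_odd h0.ne'
  refine ⟨p, ?_, ?_, ?_, ?_⟩
  · rw [← Nat.pow_lt_pow_iff_right (one_lt_two)]
    refine lt_of_le_of_lt ?_ h
    rw [hv]; exact Nat.le_mul_of_pos_right _ (by omega)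
  · intro j hj; rw [hv, (testBit_succ_pred p q j).1, if_pos hj]
  · rw [hv, (testBit_succ_pred p q p).1]; simp
  · intro j
    rw [hv, (testBit_succ_pred p q j).1, (testBit_succ_pred p q j).2]
    split_ifs <;> rfl

section Registers

variable {T s : ℕ} [NeZero T] {w : List Bool} {A : Language Bool}

open Function (update)

theorem ofNat_val {x : ℕ} (hx : x < T) : ((Fin.ofNat T x : Fin T) : ℕ) = x := by
  simp [Nat.mod_eq_of_lt hx]

theorem cells_update (ρ : ℕ → ℕ) {x : ℕ} (hx : x < T) (v : ℕ) :
    cells T s (update ρ x v) =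
      (List.range s).map fun j => update (fun i : Fin T => (ρ i).testBit j) (Fin.ofNat T x)
        (v.testBit j) := by
  refine List.map_congr_left fun j _ => funext fun i => ?_
  by_cases hi : i = Fin.ofNat T x
  · subst hi; rw [Function.update_self, ofNat_val hx, Function.update_self]
  · rw [Function.update_of_ne hi, Function.update_of_ne]
    rintro rfl
    exact hi (by ext; rw [ofNat_val hx])

theorem withWork_mem (ρ ρ' : ℕ → ℕ) (st : St) (hi hc h h' : ℕ) :
    Mem.withWork (memAt T s w ρ st hi hc h) (cells T s ρ') h' = memAt T s w ρ' st hi hc h' :=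
  rfl

theorem withWork_mem_self (ρ : ℕ → ℕ) (st : St) (hi hc h h' : ℕ) :
    memAt T s w ρ st hi hc h' = Mem.withWork (memAt T s w ρ st hi hc h) (cells T s ρ) h' :=
  rfl

namespace Frag

theorem bump_runs_of_bumpTo {b : Bool} {x : ℕ} (hx : x < T) {v' : ℕ} (ρ : ℕ → ℕ) (st : St)
    (hi hc : ℕ) (h : BumpTo b s (ρ x) v') :
    (bump b (Fin.ofNat T x)).Runs A (memAt T s w ρ st hi hc 1)
      (memAt T s w (update ρ x v') st hi hc 1) := by
  obtain ⟨p, hp, h1, h2, h3⟩ := h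
  have hs : List.range s = List.range p ++ p :: (List.range' (p + 1) (s - p - 1)) := by
    rw [List.range_eq_range', List.range_eq_range', ← List.range'_succ]
    have := List.range'_append_1 (s := 0) (m := p) (n := s - p)
    rw [zero_add] at this
    rw [show p + (s - p) = s by omega] at this
    rw [← this]; congr 2; omega
  have := bump_runs (A := A) (b := b) (x := Fin.ofNat T x) (memAt T s w ρ st hi hc 1)
    ((List.range p).map fun j i => (ρ i).testBit j)
    ((List.range' (p + 1) (s - p - 1)).map fun j i => (ρ i).testBit j)
    (fun i => (ρ i).testBit p) ?_ ?_
  · convert this using 1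
    · rw [withWork_mem_self ρ st hi hc 1 1]
      congr 1
      rw [cells, hs]; simp
    · rw [← withWork_mem ρ (update ρ x v') st hi hc 1 1, cells_update ρ hx, hs]
      congr 1
      rw [List.map_append, List.map_cons, List.map_map]
      congr 1
      · refine List.map_congr_left fun j hj => ?_
        rw [h3, if_pos (List.mem_range.1 hj)]; rfl
      · congr 1
        · rw [h3]; simp
        · refine List.map_congr_left fun j hj => ?_
          have := List.mem_range'_1.1 hj
          rw [h3, if_neg (by omega), if_neg (by omega), Function.update_eq_self_iff]
          simp only [ofNat_val hx]
  · simp only [List.mem_map, List.mem_range]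
    rintro _ ⟨j, hj, rfl⟩
    simp only [ofNat_val hx]; exact h1 j hj
  · simp only [ofNat_val hx]; exact h2

theorem inc_runs {x : ℕ} (hx : x < T) (ρ : ℕ → ℕ) (st : St) (h : ρ x < 2 ^ s) :
    (bump true (Fin.ofNat T x)).Runs A (mem T s w ρ st)
      (mem T s w (update ρ x (min (ρ x + 1) (2 ^ s - 1))) st) := by
  rcases Nat.lt_or_ge (ρ x + 1) (2 ^ s) with h' | h'
  · rw [min_eq_left (by omega)]
    exact bump_runs_of_bumpTo hx ρ st 1 1 (bumpTo_succ h')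
  · have e : ρ x = 2 ^ s - 1 := by omega
    rw [min_eq_right (by omega), ← e, Function.update_eq_self]
    refine bump_runs_of_forall (mem T s w ρ st) _ ?_
    simp only [cells, List.mem_map, List.mem_range]
    rintro _ ⟨j, hj, rfl⟩
    simp only [ofNat_val hx, e, Nat.testBit_two_pow_sub_one]
    simpa using hj

theorem dec_runs {x : ℕ} (hx : x < T) (ρ : ℕ → ℕ) (st : St) (h : ρ x < 2 ^ s) :
    (bump false (Fin.ofNat T x)).Runs A (mem T s w ρ st)
      (mem T s w (update ρ x (ρ x - 1)) st) := by
  rcases Nat.eq_zero_or_pos (ρ x) with h' | h'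
  · rw [show ρ x - 1 = ρ x by omega, Function.update_eq_self]
    refine bump_runs_of_forall (mem T s w ρ st) _ ?_
    simp only [cells, List.mem_map, List.mem_range]
    rintro _ ⟨j, hj, rfl⟩
    simp only [ofNat_val hx, h', Nat.zero_testBit]
  · exact bump_runs_of_bumpTo hx ρ st 1 1 (bumpTo_pred h' h)

/-- Set track `x`, cell by cell. -/
def assign (x : Fin T) (f : (Fin T → Bool) → Bool) : Frag (Fin T → Bool) :=
  sweep fun g => update g x (f g)

theorem assign_runs {x : ℕ} (hx : x < T) (f : (Fin T → Bool) → Bool) (ρ : ℕ → ℕ) (st : St)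
    (v : ℕ) (h : ∀ j < s, f (fun i => (ρ i).testBit j) = v.testBit j) :
    (assign (Fin.ofNat T x) f).Runs A (mem T s w ρ st) (mem T s w (update ρ x v) st) := by
  have := sweep_runs (A := A) (fun g => update g (Fin.ofNat T x) (f g)) (mem T s w ρ st)
    (cells T s ρ)
  convert this using 1
  · rfl
  · rfl
  rw [mem, ← withWork_mem ρ (update ρ x v) st 1 1 1 1, cells_update ρ hx, cells, List.map_map]
  congr 1
  refine List.map_congr_left fun j hj => ?_
  rw [← h j (List.mem_range.1 hj)]
  rfl

def clear (x : Fin T) : Frag (Fin T → Bool) := assign x fun _ => false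

def setTop (x : Fin T) : Frag (Fin T → Bool) := assign x fun _ => true

def copy (x y : Fin T) : Frag (Fin T → Bool) := assign x fun g => g y

theorem clear_runs {x : ℕ} (hx : x < T) (ρ : ℕ → ℕ) (st : St) :
    (clear (Fin.ofNat T x)).Runs A (mem T s w ρ st) (mem T s w (update ρ x 0) st) :=
  assign_runs hx _ ρ st 0 (by simp)

theorem setTop_runs {x : ℕ} (hx : x < T) (ρ : ℕ → ℕ) (st : St) :
    (setTop (Fin.ofNat T x)).Runs A (mem T s w ρ st) (mem T s w (update ρ x (2 ^ s - 1)) st) :=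
  assign_runs hx _ ρ st _ (by intro j hj; simp [Nat.testBit_two_pow_sub_one, hj])

theorem copy_runs {x y : ℕ} (hx : x < T) (hy : y < T) (ρ : ℕ → ℕ) (st : St) :
    (copy (Fin.ofNat T x) (Fin.ofNat T y)).Runs A (mem T s w ρ st)
      (mem T s w (update ρ x (ρ y)) st) :=
  assign_runs hx _ ρ st _ (by intro j _; simp only [ofNat_val hy])

/-- Move the work head to the first nonzero bit of a register. -/
theorem find_runs {x : ℕ} (hx : x < T) (ρ : ℕ → ℕ) (st : St) (hi hc : ℕ) (h : ρ x < 2 ^ s) :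
    ∃ p ≤ s, (p < s ↔ ρ x ≠ 0) ∧ (scanTrack false (Fin.ofNat T x)).Runs A
      (memAt T s w ρ st hi hc 1) (memAt T s w ρ st hi hc (p + 1)) := by
  by_cases h0 : ρ x = 0
  · refine ⟨s, le_rfl, by simp [h0], ?_⟩
    have := scanTrack_runs (A := A) (b := false) (x := Fin.ofNat T x)
      (memAt T s w ρ st hi hc 1) [] (by simp) (cells T s ρ) [] ?_
    · simpa [withWork_mem] using this
    · simp only [cells, List.mem_map, List.mem_range]
      rintro _ ⟨j, hj, rfl⟩
      simp only [ofNat_val hx, h0, Nat.zero_testBit]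
  · obtain ⟨p, hp, h1, h2, -⟩ := bumpTo_pred (Nat.pos_of_ne_zero h0) h
    refine ⟨p, hp.le, by simp [h0, hp], ?_⟩
    have hl : p < (cells T s ρ).length := by simpa using hp
    have := scanTrack_runs (A := A) (b := false) (x := Fin.ofNat T x)
      (memAt T s w ρ st hi hc 1) ((cells T s ρ).drop p) ?_ ((cells T s ρ).take p) [] ?_
    · simpa [min_eq_left hp.le, withWork_mem] using this
    · rw [List.head?_drop, List.getElem?_eq_getElem hl]
      rintro g ⟨⟩
      rw [getElem_cells]
      simp only [ofNat_val hx]; simpa using h2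
    · intro g hg
      obtain ⟨j, hj, rfl⟩ := List.mem_iff_getElem.1 hg
      rw [List.getElem_take, getElem_cells]
      simp only [ofNat_val hx]; exact h1 j (by simp at hj; omega)

theorem atEnd_work_mem (p : ℕ) (ρ : ℕ → ℕ) (st : St) (hi hc : ℕ) :
    (memAt T s w ρ st hi hc (p + 1)).scan.work.isSome = decide (p < s) := by
  rw [Bool.eq_iff_iff, decide_eq_true_iff]
  simp [Mem.scan, memAt, Tape.read]

theorem rewind_work_runs {p : ℕ} (hp : p ≤ s) (ρ : ℕ → ℕ) (st : St) (hi hc : ℕ) :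
    (rewind .work).Runs A (memAt T s w ρ st hi hc (p + 1)) (memAt T s w ρ st hi hc 1) :=
  rewind_runs .work (memAt T s w ρ st hi hc 1) p (by simpa [Side.len, memAt] using hp)

/-- Run `F` or `G` according to whether a register is zero or not. -/
def ifZero (x : Fin T) (F G : Frag (Fin T → Bool)) : Frag (Fin T → Bool) :=
  seq (scanTrack false x)
    (cond (fun c => c.work.isSome) (seq (rewind .work) G) (seq (rewind .work) F))

theorem ifZero_runs {x : ℕ} (hx : x < T) {F G : Frag (Fin T → Bool)} (ρ : ℕ → ℕ) (st : St)
    (hi hc : ℕ) (h : ρ x < 2 ^ s) {C : Mem (Fin T → Bool)}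
    (hr : if ρ x = 0 then F.Runs A (memAt T s w ρ st hi hc 1) C
      else G.Runs A (memAt T s w ρ st hi hc 1) C) :
    (ifZero (Fin.ofNat T x) F G).Runs A (memAt T s w ρ st hi hc 1) C := by
  obtain ⟨p, hp, h1, h2⟩ := find_runs (A := A) (w := w) hx ρ st hi hc h
  refine seq_runs h2 ?_
  split_ifs at hr with h0
  · refine cond_runs_false ?_ (seq_runs (rewind_work_runs hp ρ st hi hc) hr)
    rw [atEnd_work_mem p]; simpa [h0] using h1
  · refine cond_runs_true ?_ (seq_runs (rewind_work_runs hp ρ st hi hc) hr)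
    rw [atEnd_work_mem p]; simpa [h0] using h1

/-- Decrease the register `x` to zero, and run `F` after each decrement. -/
def forDown (x : Fin T) (F : Frag (Fin T → Bool)) : Frag (Fin T → Bool) :=
  seq (seq (scanTrack false x)
    (loop (fun c => c.work.isSome)
      (seq (rewind .work) (seq (bump false x) (seq F (scanTrack false x)))))) (rewind .work)

theorem bump_false_runs {x : ℕ} (hx : x < T) (ρ : ℕ → ℕ) (st : St) (hi hc : ℕ)
    (h : ρ x < 2 ^ s) (h0 : ρ x ≠ 0) :
    (bump false (Fin.ofNat T x)).Runs A (memAt T s w ρ st hi hc 1)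
      (memAt T s w (update ρ x (ρ x - 1)) st hi hc 1) :=
  bump_runs_of_bumpTo hx ρ st hi hc (bumpTo_pred (Nat.pos_of_ne_zero h0) h)

/-- The loop rule: `P k` is an invariant with `k` rounds left, and it forces the body to hand back
the counter `x` unchanged. It also speaks of the heads on the input and on the catalytic tape,
because the loops of `walk` move them. -/
theorem forDown_runs {x : ℕ} (hx : x < T) {F : Frag (Fin T → Bool)}
    (P : ℕ → (ℕ → ℕ) → St → ℕ → ℕ → Prop) (hP : ∀ k ρ st hi hc, P k ρ st hi hc → ρ x < 2 ^ s ∧ ρ x = k)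
    (hF : ∀ k ρ st hi hc, P (k + 1) ρ st hi hc → ∃ ρ' st' hi' hc',
      F.Runs A (memAt T s w (update ρ x k) st hi hc 1) (memAt T s w ρ' st' hi' hc' 1) ∧
        P k ρ' st' hi' hc')
    {n : ℕ} {ρ : ℕ → ℕ} {st : St} {hi hc : ℕ} (h : P n ρ st hi hc) : ∃ ρ' st' hi' hc',
      (forDown (Fin.ofNat T x) F).Runs A (memAt T s w ρ st hi hc 1)
        (memAt T s w ρ' st' hi' hc' 1) ∧ P 0 ρ' st' hi' hc' := by
  have key : ∀ n ρ st hi hc, P n ρ st hi hc → ∀ p ≤ s, (p < s ↔ ρ x ≠ 0) →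
      ∃ ρ' st' hi' hc', (loop (fun c => c.work.isSome)
        (seq (rewind .work) (seq (bump false (Fin.ofNat T x))
          (seq F (scanTrack false (Fin.ofNat T x)))))).Runs A
        (memAt T s w ρ st hi hc (p + 1)) (memAt T s w ρ' st' hi' hc' (s + 1)) ∧
          P 0 ρ' st' hi' hc' := by
    intro n
    induction n with
    | zero =>
      intro ρ st hi hc h p hp hps
      have : p = s := by
        have := (hP _ _ _ _ _ h).2
        simp only [this, ne_eq, not_true_eq_false, iff_false] at hps
        omega
      subst this
      exact ⟨ρ, st, hi, hc, loop_runs_false (by rw [atEnd_work_mem p]; simp), h⟩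
    | succ n ih =>
      intro ρ st hi hc h p hp hps
      obtain ⟨hb, hv⟩ := hP _ _ _ _ _ h
      obtain ⟨ρ₁, st₁, hi₁, hc₁, hr₁, h₁⟩ := hF _ _ _ _ _ h
      obtain ⟨q, hq, hqs, hr₂⟩ := find_runs (A := A) (w := w) hx ρ₁ st₁ hi₁ hc₁
        (hP _ _ _ _ _ h₁).1
      obtain ⟨ρ₂, st₂, hi₂, hc₂, hr₃, h₃⟩ := ih _ _ _ _ h₁ q hq hqs
      refine ⟨ρ₂, st₂, hi₂, hc₂, loop_runs_true ?_ (seq_runs (rewind_work_runs hp _ _ _ _)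
        (seq_runs (bump_false_runs hx ρ st hi hc hb (by omega)) (seq_runs ?_ hr₂))) hr₃, h₃⟩
      · rw [atEnd_work_mem p]; simpa using hps.2 (by omega)
      · rw [hv]; exact hr₁
  obtain ⟨p, hp, hps, hr⟩ := find_runs (A := A) (w := w) hx ρ st hi hc (hP _ _ _ _ _ h).1
  obtain ⟨ρ', st', hi', hc', hr', h'⟩ := key _ _ _ _ _ h p hp hps
  exact ⟨ρ', st', hi', hc', seq_runs (seq_runs hr hr') (rewind_work_runs le_rfl _ _ _ _), h'⟩

end Frag

end Registers

/-! ### A programming language for catalytic logspace -/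

/-- Terms have a value and may have effects on the catalytic, output and query tapes. Variables are
de Bruijn indices; `fold n a b` computes `n` and `a` and then replaces the current value `v` by the
value of `b` in the environment `v :: k`, for `k = n - 1, …, 0`. The term `wk k t` is `t` in the
environment without its first `k` entries. -/
inductive Tm where
  | var (i : ℕ)
  | zero
  | top
  | succ (t : Tm)
  | pred (t : Tm)
  | inp (f : Option Bool → Bool) (t : Tm)
  | cat (t : Tm)
  | wr (t u : Tm)
  | ask (t : Tm)
  | out (t : Tm)
  | query
  | seq (t u : Tm)
  | bind (t u : Tm)
  | ifz (t u v : Tm)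
  | fold (n a b : Tm)
  | wk (k : ℕ) (t : Tm)

/-- The loop of `Tm.fold`. -/
def iter (f : ℕ → ℕ → St → ℕ × St) : ℕ → ℕ → St → ℕ × St
  | 0, a, st => (a, st)
  | k + 1, a, st => iter f k (f k a st).1 (f k a st).2

open Classical in
/-- The semantics of terms on input `w` with oracle `A`. Numbers are at most `N`. -/
noncomputable def ev (w : List Bool) (A : Language Bool) (N : ℕ) : Tm → List ℕ → St → ℕ × St
  | .var i, env, st => (env.getD i 0, st)
  | .zero, _, st => (0, st)
  | .top, _, st => (N, st)
  | .succ t, env, st => (min ((ev w A N t env st).1 + 1) N, (ev w A N t env st).2)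
  | .pred t, env, st => ((ev w A N t env st).1 - 1, (ev w A N t env st).2)
  | .inp f t, env, st => ((f w[(ev w A N t env st).1]?).toNat, (ev w A N t env st).2)
  | .cat t, env, st =>
    (((ev w A N t env st).2.cat.getD (ev w A N t env st).1 false).toNat, (ev w A N t env st).2)
  | .wr t u, env, st =>
    let p := ev w A N t env st
    let q := ev w A N u env p.2
    (0, { q.2 with cat := q.2.cat.set p.1 (q.1 != 0) })
  | .ask t, env, st =>
    let p := ev w A N t env st
    (p.1, { p.2 with ask := p.2.ask ++ [p.1 != 0] })
  | .out t, env, st =>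
    let p := ev w A N t env st
    (p.1, { p.2 with out := p.2.out ++ [p.1 != 0] })
  | .query, _, st => ((decide (st.ask ∈ A)).toNat, { st with ask := [] })
  | .seq t u, env, st => ev w A N u env (ev w A N t env st).2
  | .bind t u, env, st => ev w A N u ((ev w A N t env st).1 :: env) (ev w A N t env st).2
  | .ifz t u v, env, st =>
    let p := ev w A N t env st
    if p.1 = 0 then ev w A N u env p.2 else ev w A N v env p.2
  | .fold n a b, env, st =>
    let p := ev w A N n env st
    let q := ev w A N a env p.2
    iter (fun k v st => ev w A N b (v :: k :: env) st) p.1 q.1 q.2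
  | .wk k t, env, st => ev w A N t (env.drop k) st

/-- The number of registers used. -/
def Tm.size : Tm → ℕ
  | .var _ | .zero | .top | .query => 1
  | .succ t | .pred t | .inp _ t | .cat t | .ask t | .out t | .wk _ t => t.size
  | .wr t u => max t.size (1 + u.size)
  | .seq t u => max t.size u.size
  | .bind t u => max t.size (1 + u.size)
  | .ifz t u v => max t.size (max u.size v.size)
  | .fold n a b => max n.size (max (1 + a.size) (2 + b.size))

theorem Tm.size_pos (t : Tm) : 0 < t.size := by
  induction t <;> simp_all [Tm.size]

open Function (update)

namespace Frag

variable {T s : ℕ} [NeZero T] {w : List Bool} {A : Language Bool}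

/-- Write a bit into the register `x`, which must be zero. -/
def setBit (x : Fin T) (f : Scan (Fin T → Bool) → Bool) : Frag (Fin T → Bool) :=
  act fun c => { workWrite := c.work.map fun g => update g x (f c) }

/-- A register that is zero becomes a given bit by changing its lowest digit only, which lies in the
first cell, under the head. -/
theorem cells_set_bit {x : ℕ} (hx : x < T) (hs : 0 < s) (ρ : ℕ → ℕ) (h : ρ x = 0) (b : Bool) :
    ∃ g, (cells T s ρ)[0]? = some g ∧
      (cells T s ρ).set 0 (update g (Fin.ofNat T x) b) = cells T s (update ρ x b.toNat) := by
  obtain ⟨s, rfl⟩ : ∃ k, s = k + 1 := ⟨s - 1, by omega⟩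
  refine ⟨_, by simp only [cells, List.range_succ_eq_map, List.map_cons]; rfl, ?_⟩
  rw [cells_update ρ hx]
  simp only [cells, List.range_succ_eq_map, List.map_cons, List.set_cons_zero, List.map_map]
  congr 1
  · cases b <;> rfl
  · refine List.map_congr_left fun j _ => ?_
    refine (Function.update_eq_self_iff.2 ?_).symm
    have : (b.toNat).testBit (j + 1) = false := by
      cases b <;> simp [Nat.testBit_succ]
    simp only [Function.comp_apply, ofNat_val hx, h, Nat.zero_testBit, this]

theorem setBit_runs {x : ℕ} (hx : x < T) (hs : 0 < s) (f : Scan (Fin T → Bool) → Bool) (ρ : ℕ → ℕ)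
    (st : St) (hi hc : ℕ) (h : ρ x = 0) :
    (setBit (Fin.ofNat T x) f).Runs A (memAt T s w ρ st hi hc 1)
      (memAt T s w (update ρ x (f (memAt T s w ρ st hi hc 1).scan).toNat) st hi hc 1) := by
  obtain ⟨g, h1, h2⟩ := cells_set_bit hx hs ρ h (f (memAt T s w ρ st hi hc 1).scan)
  have := act_runs (A := A)
    (fun c => { workWrite := c.work.map fun g => update g (Fin.ofNat T x) (f c) })
    (memAt T s w ρ st hi hc 1)
  have hr : (memAt T s w ρ st hi hc 1).scan.work = some g := h1
  simp only [hr, Option.map_some] at this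
  generalize f (memAt T s w ρ st hi hc 1).scan = b at this h2 ⊢
  convert this using 1
  · rfl
  · simp only [Eff.apply, memAt, Tape.move, Tape.write, Option.toList, List.append_nil,
      Mem.mk.injEq, true_and]
    rw [← h2]
    simp

theorem oracle_setBit_runs {x : ℕ} (hx : x < T) (hs : 0 < s) (ρ : ℕ → ℕ)
    (st : St) (h : ρ x = 0) [Decidable (st.ask ∈ A)] :
    (oracle fun b (c : Scan (Fin T → Bool)) =>
      { workWrite := c.work.map fun g => update g (Fin.ofNat T x) b }).Runs A
      (mem T s w ρ st)
      (mem T s w (update ρ x (decide (st.ask ∈ A)).toNat) { st with ask := [] }) := by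
  obtain ⟨g, h1, h2⟩ := cells_set_bit hx hs ρ h (decide (st.ask ∈ A))
  have hr : (mem T s w ρ st).scan.work = some g := h1
  have hr' : (mem T s w ρ st).work.read = some g := h1
  have := oracle_runs (A := A) (fun b (c : Scan (Fin T → Bool)) =>
    { workWrite := c.work.map fun g => update g (Fin.ofNat T x) b }) (C := mem T s w ρ st)
    (by rw [hr']; simp)
  simp only [hr, Option.map_some] at this
  convert this using 1
  · simp only [Eff.apply, memAt, Tape.move, Tape.write, Option.toList, List.append_nil,
      Mem.mk.injEq, true_and]
    rw [← h2]
    simp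

/-- Move a head to the right, as often as register `x` says, and set the register to zero. -/
def walk (sd : Side) (x : Fin T) : Frag (Fin T → Bool) :=
  forDown x (act fun _ => sd.moveEff .right)

/-- The head stops at the right end marker, so a position beyond the input is read as `none`, in
agreement with `w[i]?`. The invariant is the place where the head will end up. -/
theorem walk_inp_runs {x : ℕ} (hx : x < T) (ρ : ℕ → ℕ) (st : St) (h : ρ x < 2 ^ s) :
    (walk .inp (Fin.ofNat T x)).Runs A (mem T s w ρ st)
      (memAt T s w (update ρ x 0) st (min (ρ x) w.length + 1) 1 1) := by
  obtain ⟨ρ', st', hi', hc', hr, h', hρ, hst, rfl, hhi⟩ := forDown_runs (A := A) (w := w) (s := s) hx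
    (F := act fun _ => Side.inp.moveEff .right)
    (fun k ρ' st' hi hc => ρ' = update ρ x k ∧ k < 2 ^ s ∧ st' = st ∧ hc = 1 ∧
      min (hi + k) (w.length + 1) = min (ρ x) w.length + 1 ∧ hi ≤ w.length + 1)
    (by rintro k _ _ hi hc ⟨rfl, h1, -⟩; simpa using h1)
    (by
      rintro k _ st' hi hc ⟨rfl, h1, hst, rfl, h2, h3⟩
      subst st'
      refine ⟨_, _, min (hi + 1) (w.length + 1), 1, ?_, rfl, by omega, rfl, rfl, by omega, by omega⟩
      have := act_runs (A := A) (fun _ => Side.inp.moveEff .right)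
        (memAt T s w (update (update ρ x (k + 1)) x k) st hi 1 1)
      simpa [Side.moveEff_right, memAt, Side.setHead, Side.len, Side.head] using this)
    (n := ρ x) (ρ := ρ) (st := st) (hi := 1) (hc := 1) ⟨by simp, h, rfl, rfl, by omega, by omega⟩
  subst h' st'
  rwa [show hi' = min (ρ x) w.length + 1 by omega] at hr

theorem walk_cat_runs {x : ℕ} (hx : x < T) (ρ : ℕ → ℕ) (st : St) (h : ρ x < 2 ^ s) :
    (walk .cat (Fin.ofNat T x)).Runs A (mem T s w ρ st)
      (memAt T s w (update ρ x 0) st 1 (min (ρ x) st.cat.length + 1) 1) := by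
  obtain ⟨ρ', st', hi', hc', hr, h', hρ, hst, rfl, hhi⟩ := forDown_runs (A := A) (w := w) (s := s) hx
    (F := act fun _ => Side.cat.moveEff .right)
    (fun k ρ' st' hi hc => ρ' = update ρ x k ∧ k < 2 ^ s ∧ st' = st ∧ hi = 1 ∧
      min (hc + k) (st.cat.length + 1) = min (ρ x) st.cat.length + 1 ∧ hc ≤ st.cat.length + 1)
    (by rintro k _ _ hi hc ⟨rfl, h1, -⟩; simpa using h1)
    (by
      rintro k _ st' hi hc ⟨rfl, h1, hst, rfl, h2, h3⟩
      subst st'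
      refine ⟨_, _, 1, min (hc + 1) (st.cat.length + 1), ?_, rfl, by omega, rfl, rfl, by omega,
        by omega⟩
      have := act_runs (A := A) (fun _ => Side.cat.moveEff .right)
        (memAt T s w (update (update ρ x (k + 1)) x k) st 1 hc 1)
      simpa [Side.moveEff_right, memAt, Side.setHead, Side.len, Side.head] using this)
    (n := ρ x) (ρ := ρ) (st := st) (hi := 1) (hc := 1) ⟨by simp, h, rfl, rfl, by omega, by omega⟩
  subst h' st'
  rwa [show hc' = min (ρ x) st.cat.length + 1 by omega] at hr

theorem rewind_inp_runs {p : ℕ} (hp : p ≤ w.length) (ρ : ℕ → ℕ) (st : St) (hc hw : ℕ) :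
    (rewind .inp).Runs A (memAt T s w ρ st (p + 1) hc hw) (memAt T s w ρ st 1 hc hw) :=
  rewind_runs .inp (memAt T s w ρ st 1 hc hw) p hp

theorem rewind_cat_runs {p : ℕ} (ρ : ℕ → ℕ) (st : St) (hp : p ≤ st.cat.length) (hi hw : ℕ) :
    (rewind .cat).Runs A (memAt T s w ρ st hi (p + 1) hw) (memAt T s w ρ st hi 1 hw) :=
  rewind_runs .cat (memAt T s w ρ st hi 1 hw) p hp

end Frag

open Frag

/-- The fragment of a term. The variables are in the registers `Γ`; the registers from `x` on are
free, and the value of the term is put into `x`. -/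
def Tm.compile (T : ℕ) [NeZero T] : Tm → List ℕ → ℕ → Frag (Fin T → Bool)
  | .var i, Γ, x =>
    match Γ[i]? with
    | some y => copy (.ofNat T x) (.ofNat T y)
    | none => clear (.ofNat T x)
  | .zero, _, x => clear (.ofNat T x)
  | .top, _, x => setTop (.ofNat T x)
  | .succ t, Γ, x => .seq (t.compile T Γ x) (bump true (.ofNat T x))
  | .pred t, Γ, x => .seq (t.compile T Γ x) (bump false (.ofNat T x))
  | .inp f t, Γ, x => .seq (t.compile T Γ x) (.seq (walk .inp (.ofNat T x))
      (.seq (setBit (.ofNat T x) fun c => f c.inp) (rewind .inp)))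
  | .cat t, Γ, x => .seq (t.compile T Γ x) (.seq (walk .cat (.ofNat T x))
      (.seq (setBit (.ofNat T x) fun c => c.cat.getD false) (rewind .cat)))
  | .wr t u, Γ, x => .seq (t.compile T Γ x) (.seq (u.compile T Γ (x + 1))
      (.seq (walk .cat (.ofNat T x))
        (.seq (ifZero (.ofNat T (x + 1)) (act fun _ => { catWrite := some false })
          (act fun _ => { catWrite := some true })) (rewind .cat))))
  | .ask t, Γ, x => .seq (t.compile T Γ x)
      (ifZero (.ofNat T x) (act fun _ => { ask := some false }) (act fun _ => { ask := some true }))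
  | .out t, Γ, x => .seq (t.compile T Γ x)
      (ifZero (.ofNat T x) (act fun _ => { out := some false }) (act fun _ => { out := some true }))
  | .query, _, x => .seq (clear (.ofNat T x))
      (oracle fun b c => { workWrite := c.work.map fun g => update g (.ofNat T x) b })
  | .seq t u, Γ, x => .seq (t.compile T Γ x) (u.compile T Γ x)
  | .bind t u, Γ, x => .seq (t.compile T Γ x)
      (.seq (u.compile T (x :: Γ) (x + 1)) (copy (.ofNat T x) (.ofNat T (x + 1))))
  | .ifz t u v, Γ, x => .seq (t.compile T Γ x)
      (ifZero (.ofNat T x) (u.compile T Γ x) (v.compile T Γ x))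
  | .fold n a b, Γ, x => .seq (n.compile T Γ x) (.seq (a.compile T Γ (x + 1))
      (.seq (forDown (.ofNat T x) (.seq (b.compile T ((x + 1) :: x :: Γ) (x + 2))
        (copy (.ofNat T (x + 1)) (.ofNat T (x + 2))))) (copy (.ofNat T x) (.ofNat T (x + 1)))))
  | .wk k t, Γ, x => t.compile T (Γ.drop k) x

/-! ### Correctness of the compilation of terms. -/

section Compile

variable {T s : ℕ} [NeZero T] {w : List Bool} {A : Language Bool}

theorem map_congr_regs {Γ : List ℕ} {x : ℕ} (hΓ : ∀ y ∈ Γ, y < x) {ρ ρ' : ℕ → ℕ}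
    (h : ∀ i < x, ρ' i = ρ i) : Γ.map ρ' = Γ.map ρ :=
  List.map_congr_left fun y hy => h y (hΓ y hy)

/-- What a correct fragment for a term does. -/
def Spec (T s : ℕ) (w : List Bool) (A : Language Bool) (F : Frag (Fin T → Bool)) (x : ℕ)
    (ρ : ℕ → ℕ) (st : St) (r : ℕ × St) : Prop :=
  ∃ ρ', F.Runs A (mem T s w ρ st) (mem T s w ρ' r.2) ∧ ρ' x = r.1 ∧ (∀ i < x, ρ' i = ρ i) ∧
    ∀ i, ρ' i < 2 ^ s

theorem spec_update {F : Frag (Fin T → Bool)} {x : ℕ} {ρ ρ₁ : ℕ → ℕ} {st st' : St} {v : ℕ}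
    (hr : F.Runs A (mem T s w ρ st) (mem T s w (update ρ₁ x v) st')) (h : ∀ i < x, ρ₁ i = ρ i)
    (hb : ∀ i, ρ₁ i < 2 ^ s) (hv : v < 2 ^ s) : Spec T s w A F x ρ st (v, st') := by
  refine ⟨_, hr, by simp, fun i hi => ?_, fun i => ?_⟩
  · rw [Function.update_of_ne hi.ne, h i hi]
  · rw [Function.update_apply]; split_ifs
    · exact hv
    · exact hb i

theorem toNat_lt (hs : 0 < s) (b : Bool) : b.toNat < 2 ^ s :=
  lt_of_lt_of_le (Bool.toNat_lt b) (Nat.le_self_pow hs.ne' 2)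

/-- Induction on the term, with a stack discipline: registers below `x` hold the environment and are
preserved, `x` receives the value, and the `t.size` registers from `x` on suffice as scratch space.
Numbers are bounded by `2 ^ s - 1`, the largest value of `s` bits. -/
theorem Tm.compile_spec (hs : 0 < s) (t : Tm) : ∀ (Γ : List ℕ) (x : ℕ) (ρ : ℕ → ℕ) (st : St),
    (∀ y ∈ Γ, y < x) → x + t.size ≤ T → (∀ i, ρ i < 2 ^ s) →
    Spec T s w A (t.compile T Γ x) x ρ st (ev w A (2 ^ s - 1) t (Γ.map ρ) st) := by
  have h2 : 0 < 2 ^ s := Nat.two_pow_pos s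
  induction t with
  | var i =>
    intro Γ x ρ st hΓ hT hρ
    simp only [Tm.size] at hT
    simp only [ev, Tm.compile, List.getD_eq_getElem?_getD, List.getElem?_map]
    cases h : Γ[i]? with
    | none =>
      exact spec_update (clear_runs (by omega) _ _) (fun _ _ => rfl) hρ h2
    | some y =>
      have hy := hΓ y (List.mem_of_getElem? h)
      exact spec_update (copy_runs (by omega) (by omega) _ _) (fun _ _ => rfl) hρ (hρ y)
  | zero =>
    intro Γ x ρ st hΓ hT hρ
    simp only [Tm.size] at hT
    exact spec_update (clear_runs (by omega) _ _) (fun _ _ => rfl) hρ h2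
  | top =>
    intro Γ x ρ st hΓ hT hρ
    simp only [Tm.size] at hT
    exact spec_update (setTop_runs (by omega) _ _) (fun _ _ => rfl) hρ (by omega)
  | succ t ih =>
    intro Γ x ρ st hΓ hT hρ
    have := t.size_pos
    simp only [Tm.size] at hT
    obtain ⟨ρ₁, hr, h1, h2, h3⟩ := ih Γ x ρ st hΓ hT hρ
    rw [ev, ← h1]
    exact spec_update (seq_runs hr (inc_runs (by omega) _ _ (h3 _))) h2 h3 (by omega)
  | pred t ih =>
    intro Γ x ρ st hΓ hT hρ
    have := t.size_pos
    simp only [Tm.size] at hT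
    obtain ⟨ρ₁, hr, h1, h2, h3⟩ := ih Γ x ρ st hΓ hT hρ
    have := h3 x
    rw [ev, ← h1]
    exact spec_update (seq_runs hr (dec_runs (by omega) _ _ (h3 _))) h2 h3 (by omega)
  | inp f t ih =>
    intro Γ x ρ st hΓ hT hρ
    have := t.size_pos
    simp only [Tm.size] at hT
    obtain ⟨ρ₁, hr, h1, h2, h3⟩ := ih Γ x ρ st hΓ hT hρ
    have hx : x < T := by omega
    rw [ev, ← h1]
    have hr2 := setBit_runs (A := A) (w := w) (s := s) hx hs (fun c => f c.inp) (update ρ₁ x 0)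
      (ev w A (2 ^ s - 1) t (Γ.map ρ) st).2 (min (ρ₁ x) w.length + 1) 1 (by simp)
    have e : (memAt T s w (update ρ₁ x 0) (ev w A (2 ^ s - 1) t (Γ.map ρ) st).2
        (min (ρ₁ x) w.length + 1) 1 1).scan.inp = w[ρ₁ x]? := by
      simp only [Mem.scan, memAt, Tape.read]
      rcases le_total (ρ₁ x) w.length with h | h
      · rw [min_eq_left h]
      · rw [min_eq_right h, List.getElem?_eq_none le_rfl, List.getElem?_eq_none h]
    simp only [e, Function.update_idem] at hr2
    exact spec_update (seq_runs hr (seq_runs (walk_inp_runs hx _ _ (h3 _)) (seq_runs hr2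
      (rewind_inp_runs (by omega) _ _ _ _)))) h2 h3 (toNat_lt hs _)
  | cat t ih =>
    intro Γ x ρ st hΓ hT hρ
    have := t.size_pos
    simp only [Tm.size] at hT
    obtain ⟨ρ₁, hr, h1, h2, h3⟩ := ih Γ x ρ st hΓ hT hρ
    have hx : x < T := by omega
    rw [ev, ← h1]
    set st' := (ev w A (2 ^ s - 1) t (Γ.map ρ) st).2
    have hr2 := setBit_runs (A := A) (w := w) (s := s) hx hs (fun c => c.cat.getD false)
      (update ρ₁ x 0) st' 1 (min (ρ₁ x) st'.cat.length + 1) (by simp)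
    have e : (memAt T s w (update ρ₁ x 0) st' 1
        (min (ρ₁ x) st'.cat.length + 1) 1).scan.cat = st'.cat[ρ₁ x]? := by
      simp only [Mem.scan, memAt, Tape.read]
      rcases le_total (ρ₁ x) st'.cat.length with h | h
      · rw [min_eq_left h]
      · rw [min_eq_right h, List.getElem?_eq_none le_rfl, List.getElem?_eq_none h]
    simp only [e, Function.update_idem, ← List.getD_eq_getElem?_getD] at hr2
    exact spec_update (seq_runs hr (seq_runs (walk_cat_runs hx _ _ (h3 _)) (seq_runs hr2
      (rewind_cat_runs _ _ (by omega) _ _)))) h2 h3 (toNat_lt hs _)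
  | wr t u iht ihu =>
    intro Γ x ρ st hΓ hT hρ
    have := u.size_pos
    simp only [Tm.size] at hT
    obtain ⟨ρ₁, hr, h1, h2, h3⟩ := iht Γ x ρ st hΓ (by omega) hρ
    obtain ⟨ρ₂, hr', h1', h2', h3'⟩ := ihu Γ (x + 1) ρ₁ (ev w A (2 ^ s - 1) t (Γ.map ρ) st).2
      (fun y hy => (hΓ y hy).trans (Nat.lt_succ_self _)) (by omega) h3
    rw [map_congr_regs hΓ h2] at hr' h1'
    have hx : x < T := by omega
    simp only [ev]
    rw [← h1, ← h1', ← h2' x (by omega)]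
    set st' := (ev w A (2 ^ s - 1) u (Γ.map ρ) (ev w A (2 ^ s - 1) t (Γ.map ρ) st).2).2
    have key : (ifZero (.ofNat T (x + 1)) (act fun _ => { catWrite := some false })
          (act fun _ => { catWrite := some true })).Runs A
        (memAt T s w (update ρ₂ x 0) st' 1 (min (ρ₂ x) st'.cat.length + 1) 1)
        (memAt T s w (update ρ₂ x 0) { st' with cat := st'.cat.set (ρ₂ x) (ρ₂ (x + 1) != 0) } 1
          (min (ρ₂ x) st'.cat.length + 1) 1) := by
      -- Writing on the end marker has no effect, and neither has `List.set` beyond the end.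
      have hset : ∀ b, st'.cat.set (min (ρ₂ x) st'.cat.length) b = st'.cat.set (ρ₂ x) b := by
        intro b
        rcases le_total (ρ₂ x) st'.cat.length with h | h
        · rw [min_eq_left h]
        · rw [min_eq_right h, List.set_eq_of_length_le le_rfl, List.set_eq_of_length_le h]
      have hw : ∀ b, (act fun _ => { catWrite := some b }).Runs A
          (memAt T s w (update ρ₂ x 0) st' 1 (min (ρ₂ x) st'.cat.length + 1) 1)
          (memAt T s w (update ρ₂ x 0) { st' with cat := st'.cat.set (ρ₂ x) b } 1
            (min (ρ₂ x) st'.cat.length + 1) 1) := by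
        intro b
        have := act_runs (A := A) (fun _ => { catWrite := some b })
          (memAt T s w (update ρ₂ x 0) st' 1 (min (ρ₂ x) st'.cat.length + 1) 1)
        simpa [Eff.apply, memAt, Tape.move, Tape.write, hset] using this
      refine ifZero_runs (by omega) _ _ _ _ ?_ ?_
      · rw [Function.update_of_ne (by omega)]; exact h3' _
      · rw [Function.update_of_ne (by omega)]
        split_ifs with h0
        · simpa [h0] using hw false
        · have e : (ρ₂ (x + 1) != 0) = true := by simpa using h0
          rw [e]; exact hw true
    refine spec_update (seq_runs hr (seq_runs hr' (seq_runs (walk_cat_runs hx _ _ (h3' _))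
      (seq_runs key (rewind_cat_runs _ _ (by simp) _ _))))) ?_ h3' (Nat.two_pow_pos s)
    intro i hi
    rw [h2' i (by omega), h2 i hi]
  | ask t ih =>
    intro Γ x ρ st hΓ hT hρ
    have := t.size_pos
    simp only [Tm.size] at hT
    obtain ⟨ρ₁, hr, h1, h2, h3⟩ := ih Γ x ρ st hΓ hT hρ
    simp only [ev]
    rw [← h1]
    refine ⟨ρ₁, seq_runs hr (ifZero_runs (by omega) _ _ _ _ (h3 _) ?_), rfl, h2, h3⟩
    split_ifs with h0
    · simpa [h0, Eff.apply, memAt, Tape.move, Tape.write] using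
        act_runs (A := A) (fun _ => { ask := some false })
          (mem T s w ρ₁ (ev w A (2 ^ s - 1) t (Γ.map ρ) st).2)
    · have e : (ρ₁ x != 0) = true := by simpa using h0
      simpa [e, Eff.apply, memAt, Tape.move, Tape.write] using
        act_runs (A := A) (fun _ => { ask := some true })
          (mem T s w ρ₁ (ev w A (2 ^ s - 1) t (Γ.map ρ) st).2)
  | out t ih =>
    intro Γ x ρ st hΓ hT hρ
    have := t.size_pos
    simp only [Tm.size] at hT
    obtain ⟨ρ₁, hr, h1, h2, h3⟩ := ih Γ x ρ st hΓ hT hρ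
    simp only [ev]
    rw [← h1]
    refine ⟨ρ₁, seq_runs hr (ifZero_runs (by omega) _ _ _ _ (h3 _) ?_), rfl, h2, h3⟩
    split_ifs with h0
    · simpa [h0, Eff.apply, memAt, Tape.move, Tape.write] using
        act_runs (A := A) (fun _ => { out := some false })
          (mem T s w ρ₁ (ev w A (2 ^ s - 1) t (Γ.map ρ) st).2)
    · have e : (ρ₁ x != 0) = true := by simpa using h0
      simpa [e, Eff.apply, memAt, Tape.move, Tape.write] using
        act_runs (A := A) (fun _ => { out := some true })
          (mem T s w ρ₁ (ev w A (2 ^ s - 1) t (Γ.map ρ) st).2)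
  | query =>
    intro Γ x ρ st hΓ hT hρ
    classical
    simp only [Tm.size] at hT
    simp only [ev]
    have := oracle_setBit_runs (A := A) (w := w) (s := s) (T := T) (x := x) (by omega) hs
      (update ρ x 0) st (by simp)
    rw [Function.update_idem] at this
    convert spec_update (seq_runs (clear_runs (by omega) _ _) this) (fun _ _ => rfl) hρ
      (toNat_lt hs _) using 1
    rfl
  | seq t u iht ihu =>
    intro Γ x ρ st hΓ hT hρ
    simp only [Tm.size] at hT
    obtain ⟨ρ₁, hr, h1, h2, h3⟩ := iht Γ x ρ st hΓ (by omega) hρ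
    obtain ⟨ρ₂, hr', h1', h2', h3'⟩ := ihu Γ x ρ₁ (ev w A (2 ^ s - 1) t (Γ.map ρ) st).2
      hΓ (by omega) h3
    rw [map_congr_regs hΓ h2] at hr' h1'
    exact ⟨ρ₂, seq_runs hr hr', h1', fun i hi => (h2' i hi).trans (h2 i hi), h3'⟩
  | bind t u iht ihu =>
    intro Γ x ρ st hΓ hT hρ
    have := u.size_pos
    simp only [Tm.size] at hT
    obtain ⟨ρ₁, hr, h1, h2, h3⟩ := iht Γ x ρ st hΓ (by omega) hρ
    obtain ⟨ρ₂, hr', h1', h2', h3'⟩ := ihu (x :: Γ) (x + 1) ρ₁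
      (ev w A (2 ^ s - 1) t (Γ.map ρ) st).2 (by
        simp only [List.mem_cons, forall_eq_or_imp]
        exact ⟨Nat.lt_succ_self _, fun y hy => (hΓ y hy).trans (Nat.lt_succ_self _)⟩)
      (by omega) h3
    rw [List.map_cons, map_congr_regs hΓ h2, h1] at hr' h1'
    rw [ev]
    have := spec_update (seq_runs hr (seq_runs hr' (copy_runs (x := x) (y := x + 1) (by omega)
      (by omega) _ _))) (fun i hi => (h2' i (by omega)).trans (h2 i hi)) h3' (h3' _)
    rwa [h1'] at this
  | ifz t u v iht ihu ihv =>
    intro Γ x ρ st hΓ hT hρ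
    have := t.size_pos
    simp only [Tm.size] at hT
    obtain ⟨ρ₁, hr, h1, h2, h3⟩ := iht Γ x ρ st hΓ (by omega) hρ
    simp only [ev]
    rw [← h1]
    split_ifs with h0
    · obtain ⟨ρ₂, hr', h1', h2', h3'⟩ := ihu Γ x ρ₁ (ev w A (2 ^ s - 1) t (Γ.map ρ) st).2
        hΓ (by omega) h3
      rw [map_congr_regs hΓ h2] at hr' h1'
      exact ⟨ρ₂, seq_runs hr (ifZero_runs (by omega) _ _ _ _ (h3 _) (by rwa [if_pos h0])), h1',
        fun i hi => (h2' i hi).trans (h2 i hi), h3'⟩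
    · obtain ⟨ρ₂, hr', h1', h2', h3'⟩ := ihv Γ x ρ₁ (ev w A (2 ^ s - 1) t (Γ.map ρ) st).2
        hΓ (by omega) h3
      rw [map_congr_regs hΓ h2] at hr' h1'
      exact ⟨ρ₂, seq_runs hr (ifZero_runs (by omega) _ _ _ _ (h3 _) (by rwa [if_neg h0])), h1',
        fun i hi => (h2' i hi).trans (h2 i hi), h3'⟩
  | fold n a b ihn iha ihb =>
    intro Γ x ρ st hΓ hT hρ
    have := b.size_pos
    simp only [Tm.size] at hT
    obtain ⟨ρ₁, hr, h1, h2, h3⟩ := ihn Γ x ρ st hΓ (by omega) hρ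
    obtain ⟨ρ₂, hr', h1', h2', h3'⟩ := iha Γ (x + 1) ρ₁ (ev w A (2 ^ s - 1) n (Γ.map ρ) st).2
      (fun y hy => (hΓ y hy).trans (Nat.lt_succ_self _)) (by omega) h3
    rw [map_congr_regs hΓ h2] at hr' h1'
    simp only [ev]
    rw [← h1, ← h1', ← h2' x (by omega)]
    set st₂ := (ev w A (2 ^ s - 1) a (Γ.map ρ) (ev w A (2 ^ s - 1) n (Γ.map ρ) st).2).2
    set f := fun k v st => ev w A (2 ^ s - 1) b (v :: k :: Γ.map ρ) st
    obtain ⟨ρ₃, st₃, _, _, hr₃, rfl, rfl, h30, h31, h32, h33⟩ :=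
      forDown_runs (A := A) (w := w) (s := s) (T := T) (x := x) (by omega)
      (F := .seq (b.compile T ((x + 1) :: x :: Γ) (x + 2))
        (copy (.ofNat T (x + 1)) (.ofNat T (x + 2))))
      -- The invariant says that finishing the loop from the current accumulator in register `x + 1`
      -- gives the result of the whole loop.
      (fun k ρ' st' hi hc => hi = 1 ∧ hc = 1 ∧ ρ' x = k ∧ (∀ i < x, ρ' i = ρ i) ∧
        (∀ i, ρ' i < 2 ^ s) ∧ iter f k (ρ' (x + 1)) st' = iter f (ρ₂ x) (ρ₂ (x + 1)) st₂)
      (by rintro k ρ' st' hi hc ⟨-, -, h, -, h', -⟩; exact ⟨h' x, h⟩)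
      (by
        rintro k ρ' st' _ _ ⟨rfl, rfl, g0, g1, g2, g3⟩
        have hk : k < 2 ^ s := by have := g2 x; omega
        obtain ⟨ρ₄, hr₄, k1, k2, k3⟩ := ihb ((x + 1) :: x :: Γ) (x + 2) (update ρ' x k) st' (by
            simp only [List.mem_cons, forall_eq_or_imp]
            exact ⟨by omega, by omega, fun y hy => (hΓ y hy).trans (by omega)⟩) (by omega) (by
            intro i; rw [Function.update_apply]; split_ifs
            · exact hk
            · exact g2 i)
        have e : ((x + 1) :: x :: Γ).map (update ρ' x k) = ρ' (x + 1) :: k :: Γ.map ρ := by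
          rw [List.map_cons, List.map_cons, Function.update_self,
            Function.update_of_ne (by omega), map_congr_regs hΓ fun i hi => ?_]
          rw [Function.update_of_ne hi.ne, g1 i hi]
        rw [e] at hr₄ k1
        refine ⟨_, _, 1, 1, seq_runs hr₄ (copy_runs (by omega) (by omega) _ _), rfl, rfl, ?_, ?_,
          ?_, ?_⟩
        · rw [Function.update_of_ne (by omega), k2 x (by omega), Function.update_self]
        · intro i hi
          rw [Function.update_of_ne (by omega), k2 i (by omega), Function.update_of_ne hi.ne,
            g1 i hi]
        · intro i; rw [Function.update_apply]; split_ifs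
          · exact k3 _
          · exact k3 i
        · rw [Function.update_self, k1, ← g3, iter])
      (n := ρ₂ x) (ρ := ρ₂) (st := st₂) (hi := 1) (hc := 1)
      ⟨rfl, rfl, rfl, fun i hi => (h2' i (by omega)).trans (h2 i hi), h3', rfl⟩
    rw [← h33, iter]
    exact spec_update (seq_runs hr (seq_runs hr' (seq_runs hr₃ (copy_runs (by omega) (by omega)
      _ _)))) h31 h32 (h32 _)
  | wk k t ih =>
    intro Γ x ρ st hΓ hT hρ
    rw [ev, ← List.map_drop]
    exact ih (Γ.drop k) x ρ st (fun y hy => hΓ y (List.mem_of_mem_drop hy)) hT hρ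

end Compile

/-- A search problem is solved in catalytic logspace if it is solved by a term that has the value
`0` or `1`. -/
theorem searchInCL_of_ev {A : Language Bool} {S : List Bool → Set (List Bool)} (t : Tm) (k : ℕ)
    (hk : 0 < k)
    (h : ∀ w τ : List Bool, τ.length = w.length ^ k →
      ∃ (b : Bool) (z : List Bool),
        ev w A (2 ^ (k * (Nat.log 2 w.length + 1)) - 1) t [] ⟨τ, [], []⟩ =
          (b.toNat, ⟨τ, z, []⟩) ∧ if b then z ∈ S w else S w = ∅) :
    SearchInCL A S := by
  have : NeZero t.size := ⟨t.size_pos.ne'⟩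
  refine ⟨(t.compile t.size [] 0).toMachine (fun _ => false)
    (fun g => g.any fun g => g (.ofNat t.size 0)), k, fun w τ hτ => ?_⟩
  obtain ⟨b, z, hev, hz⟩ := h w τ hτ
  have hs : 0 < k * (Nat.log 2 w.length + 1) := by positivity
  obtain ⟨ρ', hr, h1, -, -⟩ := Tm.compile_spec (T := t.size) (A := A) (w := w) hs t [] 0 (fun _ => 0) ⟨τ, [], []⟩
    (by simp) (by omega) (by simp)
  set s := k * (Nat.log 2 w.length + 1)
  rw [List.map_nil, hev] at hr h1
  have hreach := reaches_of_runs _ (fun _ => false)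
    (fun g => g.any fun g => g (.ofNat t.size 0)) hr
  have hinit : ((t.compile t.size [] 0).toMachine (fun _ => false)
      (fun g => g.any fun g => g (.ofNat t.size 0))).init s w τ = cfg _ _ _
        (.inr (t.compile t.size [] 0).start) (mem t.size s w (fun _ => 0) ⟨τ, [], []⟩) := by
    simp only [CatalyticTM.init, cfg, memAt, toMachine, embTape, Tape.init,
      CatalyticTM.Cfg.mk.injEq, true_and, and_true]
    funext _
    simp only [Tape.mk.injEq, and_true]
    rw [cells, List.map_map]
    refine (List.ext_getElem (by simp) fun i _ _ => ?_)
    simp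
  refine ⟨_, hinit ▸ hreach, ?_, ?_⟩
  · rfl
  -- At the exit the work head is on the first cell, so the symbol that decides on acceptance
  -- contains the lowest bit of the result in register `0`.
  · have hb : Option.any (fun g : Fin t.size → Bool => g (.ofNat t.size 0))
        (mem t.size s w ρ' ⟨τ, z, []⟩).work.read = b := by
      have hc : (mem t.size s w ρ' ⟨τ, z, []⟩).work.read = (cells t.size s ρ')[0]? := rfl
      rw [hc, List.getElem?_eq_getElem (by simpa using hs), getElem_cells, Option.any_some]
      simp only [ofNat_val t.size_pos, h1]
      cases b <;> rfl
    cases b with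
    | true => exact .inl ⟨by rw [cfg]; simp only [hb]; rfl, (by simpa using hz : z ∈ S w)⟩
    | false => exact .inr ⟨by rw [cfg]; simp only [hb]; rfl, by simpa using hz⟩

/-! ### Terms without effects -/

section Val

variable {w : List Bool} {A : Language Bool} {N : ℕ}

/-- On states with `P` the term `t` has the value `v` and no effects. -/
def Val (w : List Bool) (A : Language Bool) (N : ℕ) (P : St → Prop) (t : Tm) (env : List ℕ)
    (v : ℕ) : Prop :=
  ∀ st, P st → ev w A N t env st = (v, st)

variable {P Q : St → Prop} {t u n a b : Tm} {env : List ℕ} {v v' c x y z : ℕ}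

theorem Val.mono (h : Val w A N P t env v) (hQ : ∀ st, Q st → P st) : Val w A N Q t env v :=
  fun st hst => h st (hQ st hst)

theorem Val.congr (h : Val w A N P t env v) (e : v = v') : Val w A N P t env v' := e ▸ h

theorem Val.var0 : Val w A N P (.var 0) (x :: env) x := fun _ _ => rfl

theorem Val.var1 : Val w A N P (.var 1) (x :: y :: env) y := fun _ _ => rfl

theorem Val.var2 : Val w A N P (.var 2) (x :: y :: z :: env) z := fun _ _ => rfl

theorem Val.zero : Val w A N P .zero env 0 := fun _ _ => rfl

theorem Val.top : Val w A N P .top env N := fun _ _ => rfl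

theorem Val.wk1 (h : Val w A N P t env v) : Val w A N P (.wk 1 t) (x :: env) v := h

theorem Val.wk2 (h : Val w A N P t env v) : Val w A N P (.wk 2 t) (x :: y :: env) v := h

theorem Val.succ_sat (h : Val w A N P t env v) : Val w A N P t.succ env (min (v + 1) N) :=
  fun st hst => by rw [ev, h st hst]

theorem Val.succ (h : Val w A N P t env v) (hv : v + 1 ≤ N) : Val w A N P t.succ env (v + 1) :=
  h.succ_sat.congr (min_eq_left hv)

theorem Val.pred (h : Val w A N P t env v) : Val w A N P t.pred env (v - 1) :=
  fun st hst => by rw [ev, h st hst]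

theorem Val.inp (f : Option Bool → Bool) (h : Val w A N P t env v) :
    Val w A N P (t.inp f) env (f w[v]?).toNat :=
  fun st hst => by rw [ev, h st hst]

theorem Val.cat {l : List Bool} (hP : ∀ st, P st → st.cat = l) (h : Val w A N P t env v) :
    Val w A N P t.cat env (l.getD v false).toNat :=
  fun st hst => by rw [ev, h st hst, hP st hst]

theorem Val.bind (h : Val w A N P t env v) (h' : Val w A N P u (v :: env) x) :
    Val w A N P (t.bind u) env x :=
  fun st hst => by rw [ev, h st hst, h' st hst]

theorem Val.ifz (h : Val w A N P t env v) (h₁ : v = 0 → Val w A N P a env x)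
    (h₂ : v ≠ 0 → Val w A N P b env x) : Val w A N P (.ifz t a b) env x := by
  intro st hst
  simp only [ev, h st hst]
  split_ifs with h0
  · exact h₁ h0 st hst
  · exact h₂ h0 st hst

theorem Val.ifz_ite {p : Prop} [Decidable p] (h : Val w A N P t env v) (hp : v ≠ 0 ↔ p)
    (h₁ : Val w A N P a env x) (h₂ : Val w A N P b env y) :
    Val w A N P (.ifz t a b) env (if p then y else x) := by
  refine h.ifz (fun h0 => ?_) (fun h0 => ?_)
  · rwa [if_neg (by rw [← hp]; simpa using h0)]
  · rwa [if_pos (hp.1 h0)]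

/-- The rule for loops with a descending counter. -/
theorem Val.fold (g : ℕ → ℕ) (hn : Val w A N P n env c) (ha : Val w A N P a env (g c))
    (hb : ∀ k < c, Val w A N P b (g (k + 1) :: k :: env) (g k)) :
    Val w A N P (.fold n a b) env (g 0) := by
  intro st hst
  simp only [ev, hn st hst, ha st hst]
  clear hn ha
  induction c with
  | zero => rfl
  | succ c ih =>
    rw [iter, hb c (Nat.lt_succ_self c) st hst]
    exact ih fun k hk => hb k (hk.trans (Nat.lt_succ_self c))

/-- The counter of `iter` descends, while `g` and `S` are indexed by the rounds already done. The
step is assumed for every counter `i`, so the two need not be matched. -/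
theorem iter_up (f : ℕ → ℕ → St → ℕ × St) (g : ℕ → ℕ) (S : ℕ → St) (c : ℕ)
    (h : ∀ k < c, ∀ i, f i (g k) (S k) = (g (k + 1), S (k + 1))) :
    iter f c (g 0) (S 0) = (g c, S c) := by
  induction c generalizing g S with
  | zero => rfl
  | succ c ih =>
    rw [iter, h 0 (Nat.succ_pos c) c]
    exact ih (fun k => g (k + 1)) (fun k => S (k + 1)) fun k hk i => h (k + 1) (by omega) i

/-- The rule for loops that do not use the counter. -/
theorem Val.foldUp (g : ℕ → ℕ) (hn : Val w A N P n env c) (ha : Val w A N P a env (g 0))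
    (hb : ∀ k < c, ∀ i, Val w A N P b (g k :: i :: env) (g (k + 1))) :
    Val w A N P (.fold n a b) env (g c) := by
  intro st hst
  simp only [ev, hn st hst, ha st hst]
  exact iter_up _ g (fun _ => st) c fun k hk i => hb k hk i st hst

end Val

/-! ### Arithmetic -/

namespace Tm

def one : Tm := succ zero

def add (t u : Tm) : Tm := fold u t (succ (var 0))

def sub (t u : Tm) : Tm := fold u t (pred (var 0))

def mul (t u : Tm) : Tm := fold u zero (add (var 0) (wk 2 t))

def parity (t : Tm) : Tm := fold t zero (ifz (var 0) one zero)

def half (t : Tm) : Tm := fold t zero (add (var 0) (parity (var 1)))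

def pow2 (t : Tm) : Tm := fold t one (add (var 0) (var 0))

def pow (t : Tm) : ℕ → Tm
  | 0 => one
  | k + 1 => mul (pow t k) t

/-- The least `k < n` for which the value of `t` in the environment `k :: i :: env` (`i` being the
counter of the loop) is not zero, and `n` if there is no such `k`. -/
def search (n t : Tm) : Tm := fold n zero (ifz t (succ (var 0)) (var 0))

/-- Zero if and only if `t` is not zero. -/
def not (t : Tm) : Tm := ifz t one zero

/-- Zero if and only if the values are equal. -/
def dist (t u : Tm) : Tm := add (sub t u) (sub u t)

end Tm

/-- The least `k < n` with `p k`, and `n` if there is none. -/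
def firstIdx (p : ℕ → Prop) [DecidablePred p] : ℕ → ℕ
  | 0 => 0
  | n + 1 => if p (firstIdx p n) then firstIdx p n else firstIdx p n + 1

/-! ### Least index with a given property. -/

section FirstIdx

variable (p : ℕ → Prop) [DecidablePred p] (n : ℕ)

theorem firstIdx_le : firstIdx p n ≤ n := by
  induction n with
  | zero => simp [firstIdx]
  | succ n ih => rw [firstIdx]; split_ifs <;> omega

/-- Each round either stays or moves on by one, and it moves on only from an index that fails `p`.
-/
theorem not_of_lt_firstIdx {k : ℕ} (h : k < firstIdx p n) : ¬ p k := by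
  induction n with
  | zero => simp [firstIdx] at h
  | succ n ih =>
    rw [firstIdx] at h
    split_ifs at h with h'
    · exact ih h
    · rcases Nat.lt_succ_iff_lt_or_eq.1 h with h | h
      · exact ih h
      · exact h ▸ h'

theorem firstIdx_spec (h : firstIdx p n < n) : p (firstIdx p n) := by
  induction n with
  | zero => simp at h
  | succ n ih =>
    rw [firstIdx] at h ⊢
    split_ifs at h ⊢ with h'
    · exact h'
    · exact absurd (ih (by omega)) h'

theorem firstIdx_eq {k : ℕ} (hk : k ≤ n) (h : ∀ j < k, ¬ p j) (h' : k < n → p k) :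
    firstIdx p n = k := by
  have h1 := firstIdx_le p n
  rcases lt_trichotomy (firstIdx p n) k with h2 | h2 | h2
  · exact absurd (firstIdx_spec p n (by omega)) (h _ h2)
  · exact h2
  · exact absurd (h' (by omega)) (not_of_lt_firstIdx p n h2)

theorem firstIdx_lt_iff : firstIdx p n < n ↔ ∃ k < n, p k := by
  refine ⟨fun h => ⟨_, h, firstIdx_spec p n h⟩, fun ⟨k, hk, hp⟩ => ?_⟩
  by_contra h
  exact not_of_lt_firstIdx p n (by omega) hp

end FirstIdx

/-! ### Arithmetic and search below the bound of the registers. -/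

section Arith

variable {w : List Bool} {A : Language Bool} {N : ℕ} {P : St → Prop} {t u n : Tm} {env : List ℕ}
  {x y c : ℕ}

theorem Val.one (hN : 1 ≤ N) : Val w A N P .one env 1 := Val.zero.succ hN

theorem Val.add_sat (h : Val w A N P t env x) (h' : Val w A N P u env y) (hx : x ≤ N) :
    Val w A N P (t.add u) env (min (x + y) N) := by
  refine Val.foldUp (fun k => min (x + k) N) h' (h.congr (by simp [hx])) fun k _ i => ?_
  exact Val.var0.succ_sat.congr (by omega)

theorem Val.add (h : Val w A N P t env x) (h' : Val w A N P u env y) (hxy : x + y ≤ N) :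
    Val w A N P (t.add u) env (x + y) :=
  (h.add_sat h' (by omega)).congr (min_eq_left hxy)

theorem Val.sub (h : Val w A N P t env x) (h' : Val w A N P u env y) :
    Val w A N P (t.sub u) env (x - y) := by
  refine Val.foldUp (fun k => x - k) h' h fun k _ i => ?_
  exact Val.var0.pred.congr (by omega)

theorem Val.mul (h : Val w A N P t env x) (h' : Val w A N P u env y) (hxy : x * y ≤ N) :
    Val w A N P (t.mul u) env (x * y) := by
  refine Val.foldUp (fun k => x * k) h' Val.zero fun k hk i => ?_
  have : x * (k + 1) ≤ x * y := Nat.mul_le_mul_left x hk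
  exact (Val.var0.add h.wk2 (by rw [mul_add] at this; omega)).congr (by ring)

theorem Val.parity (hN : 1 ≤ N) (h : Val w A N P t env x) :
    Val w A N P t.parity env (x % 2) := by
  refine Val.foldUp (fun k => k % 2) h Val.zero fun k hk i => ?_
  exact Val.var0.ifz (fun h0 => (Val.one hN).congr (by omega))
    (fun h0 => Val.zero.congr (by omega))

/-- The parities of `0, …, x - 1` add up to `x / 2`; since the counter descends, the partial sums
are `x / 2 - k / 2`. -/
theorem Val.half (hN : 1 ≤ N) (h : Val w A N P t env x) (hx : x ≤ N) :
    Val w A N P t.half env (x / 2) := by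
  refine (Val.fold (fun k => x / 2 - k / 2) h (Val.zero.congr (by omega)) fun k hk => ?_).congr
    (by simp)
  exact (Val.var0.add (Val.var1.parity hN) (by omega)).congr (by omega)

theorem Val.pow2 (h : Val w A N P t env x) (hx : 2 ^ x ≤ N) :
    Val w A N P t.pow2 env (2 ^ x) := by
  have h1 : 1 ≤ N := le_trans (Nat.one_le_two_pow) hx
  refine Val.foldUp (fun k => 2 ^ k) h (Val.one h1) fun k hk i => ?_
  have : 2 ^ (k + 1) ≤ 2 ^ x := Nat.pow_le_pow_right two_pos hk
  exact (Val.var0.add Val.var0 (by rw [pow_succ] at this; omega)).congr (by ring)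

theorem Val.pow (h : Val w A N P t env x) : ∀ k, (∀ i ≤ k, x ^ i ≤ N) →
    Val w A N P (t.pow k) env (x ^ k)
  | 0, hx => Val.one (by simpa using hx 0 le_rfl)
  | k + 1, hx => ((Val.pow h k fun i hi => hx i (by omega)).mul h
      (by simpa [pow_succ] using hx (k + 1) le_rfl)).congr (by ring)

/-- The test need only be correct at indices all of whose predecessors fail. Later this bounds the
numbers occurring in the test, such as positions on the input or powers of two. -/
theorem Val.search {p : ℕ → Prop} [DecidablePred p] (hn : Val w A N P n env c) (hc : c ≤ N)
    (h : ∀ k < c, (∀ j < k, ¬ p j) → ∀ i, ∃ v, Val w A N P t (k :: i :: env) v ∧ (v ≠ 0 ↔ p k)) :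
    Val w A N P (.search n t) env (firstIdx p c) := by
  refine Val.foldUp (firstIdx p) hn Val.zero fun k hk i => ?_
  have hle := firstIdx_le p k
  obtain ⟨v, hv, hp⟩ := h (firstIdx p k) (by omega) (fun j => not_of_lt_firstIdx p k) i
  exact hv.ifz_ite hp (Val.var0.succ (by omega)) Val.var0

theorem Val.not (hN : 1 ≤ N) (h : Val w A N P t env x) :
    Val w A N P t.not env (if x = 0 then 1 else 0) :=
  h.ifz (fun h0 => (Val.one hN).congr (by simp [h0])) (fun h0 => Val.zero.congr (by simp [h0]))

theorem Val.dist (h : Val w A N P t env x) (h' : Val w A N P u env y) (hx : x ≤ N) (hy : y ≤ N) :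
    Val w A N P (t.dist u) env (x - y + (y - x)) :=
  (h.sub h').add (h'.sub h) (by omega)

end Arith

/-! ### Writing on the query tape -/

section Emits

variable {w : List Bool} {A : Language Bool} {N : ℕ} {τ : List Bool} {t u n a b : Tm}
  {env : List ℕ} {x v c : ℕ} {l l' : List Bool}

/-- The term `t` has the value `v` and appends `l` to the query tape. -/
def Emits (w : List Bool) (A : Language Bool) (N : ℕ) (τ : List Bool) (t : Tm) (env : List ℕ)
    (v : ℕ) (l : List Bool) : Prop :=
  ∀ st, st.cat = τ → ev w A N t env st = (v, { st with ask := st.ask ++ l })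

/-- `Val` for terms that may depend on the catalytic tape. -/
abbrev CatVal (w : List Bool) (A : Language Bool) (N : ℕ) (τ : List Bool) :=
  Val w A N (fun st => st.cat = τ)

theorem Val.emits (h : CatVal w A N τ t env v) : Emits w A N τ t env v [] := by
  intro st hst
  rw [h st hst]; simp

theorem Emits.congr (h : Emits w A N τ t env v l) (e : l = l') : Emits w A N τ t env v l' := e ▸ h

theorem Val.ask (h : CatVal w A N τ t env v) : Emits w A N τ t.ask env v [v != 0] := by
  intro st hst
  simp only [ev, h st hst]

theorem Emits.seq (h : Emits w A N τ t env x l) (h' : Emits w A N τ u env v l') :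
    Emits w A N τ (t.seq u) env v (l ++ l') := by
  intro st hst
  have e := h' { st with ask := st.ask ++ l } hst
  rw [ev, h st hst]
  simpa using e

theorem Emits.foldUp (f : ℕ → List Bool) (hn : CatVal w A N τ n env c)
    (hb : ∀ k < c, ∀ i, Emits w A N τ b (k :: i :: env) (k + 1) (f k)) :
    Emits w A N τ (.fold n .zero b) env c ((List.range c).flatMap f) := by
  intro st hst
  simp only [ev, hn st hst]
  refine (congrArg (iter _ c 0) ?_).trans (iter_up _ (fun k => k) (fun k => { st with
      ask := st.ask ++ (List.range k).flatMap f }) c fun k hk i => ?_)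
  · simp
  · rw [hb k hk i _ (by exact hst), List.range_succ, List.flatMap_append]
    simp

end Emits

namespace Tm

/-- Test whether an input symbol is `true`. -/
def isTrue (t : Tm) : Tm := inp (· == some true) t

/-- Test whether a position is inside the input. -/
def inside (t : Tm) : Tm := inp Option.isSome t

/-- Copy the first `n` symbols of the input on the query tape. -/
def emitPrefix (n : Tm) : Tm := fold n zero (seq (ask (isTrue (var 0))) (succ (var 0)))

/-- Write the code of the binary expansion of a number on the query tape. -/
def emitNum (t : Tm) : Tm :=
  seq (fold top t (ifz (var 0) zero
    (seq (ask one) (seq (ask (parity (var 0))) (half (var 0)))))) (ask zero)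

end Tm

theorem Nat.bits_of_pos {n : ℕ} (h : n ≠ 0) : n.bits = (n % 2 == 1) :: (n / 2).bits := by
  conv_lhs => rw [← Nat.bit_bodd_div2 n]
  rw [Nat.bits_append_bit, Nat.bodd_eq_one_and_ne_zero, Nat.div2_val]
  · simp
  · intro h0
    rw [Nat.div2_val] at h0
    have : n = 1 := by omega
    subst this; rfl

section Emit

variable {w : List Bool} {A : Language Bool} {N : ℕ} {τ : List Bool} {t n : Tm}
  {env : List ℕ} {x c : ℕ}

theorem emits_prefix (hn : CatVal w A N τ n env c) (hc : c ≤ w.length) (hN : w.length ≤ N) :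
    Emits w A N τ n.emitPrefix env c (w.take c) := by
  refine (Emits.foldUp (fun k => [w.getD k false]) hn fun k hk i => ?_).congr ?_
  · have h := (Val.inp (fun o => o == some true) (Val.var0 (w := w) (A := A) (N := N)
      (P := fun st => st.cat = τ) (x := k) (env := i :: env))).ask
    refine (h.seq (Val.var0.succ (by omega)).emits).congr ?_
    have : k < w.length := by omega
    cases hb : w[k] <;> simp [this, hb]
  · rw [← List.map_eq_flatMap]
    refine List.ext_getElem (by simp [hc]) fun i h1 h2 => ?_
    have : i < w.length := by simp at h2; omega
    simp [this]

/-- Halving reaches zero within `x` rounds, and rounds at zero write nothing. So the loop may run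
for the largest possible number of rounds, without knowing the number of digits. -/
theorem iter_emit {f : ℕ → ℕ → St → ℕ × St} (h0 : ∀ i st, st.cat = τ → f i 0 st = (0, st))
    (h1 : ∀ i x st, x ≠ 0 → x ≤ N → st.cat = τ →
      f i x st = (x / 2, { st with ask := st.ask ++ [true, x % 2 == 1] })) :
    ∀ (K x : ℕ) (st : St), x ≤ K → x ≤ N → st.cat = τ → iter f K x st =
      (0, { st with ask := st.ask ++ x.bits.flatMap fun b => [true, b] }) := by
  intro K
  induction K with
  | zero =>
    intro x st hx _ hst
    obtain rfl : x = 0 := by omega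
    simp [iter]
  | succ K ih =>
    intro x st hx hN hst
    rw [iter]
    by_cases hx0 : x = 0
    · subst hx0
      rw [h0 K st hst]
      exact ih 0 st (by omega) hN hst
    · rw [h1 K x st hx0 hN hst]
      refine (ih (x / 2) { st with ask := st.ask ++ [true, x % 2 == 1] } (by omega) (by omega)
        hst).trans ?_
      rw [Nat.bits_of_pos hx0]
      simp

theorem emits_num (hN : 1 ≤ N) (h : CatVal w A N τ t env x) (hx : x ≤ N) :
    Emits w A N τ t.emitNum env 0 (encode [x.bits]) := by
  intro st hst
  rw [Tm.emitNum, ev]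
  simp only [ev, h st hst]
  have key := iter_emit (τ := τ) (N := N) (f := fun k v st => ev w A N (.ifz (.var 0) .zero
      (.seq (.ask .one) (.seq (.ask (.parity (.var 0))) (.half (.var 0))))) (v :: k :: env) st)
    (fun i st hst => rfl)
    (fun i x st hx0 hxN hst => by
      have h1 := (((Val.one (w := w) (A := A) (P := fun st => st.cat = τ)
        (env := x :: i :: env) hN).ask.seq
        ((Val.var0.parity hN).ask.seq (Val.var0.half hN hxN).emits))) st hst
      simp only [ev] at h1 ⊢
      refine (if_neg hx0).trans (h1.trans ?_)
      have : (x % 2 != 0) = (x % 2 == 1) := by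
        rcases Nat.mod_two_eq_zero_or_one x with h | h <;> simp [h]
      simp [this]) N x st hx hx hst
  simp only [ev] at key
  rw [key]
  simp [encode]

end Emit

/-! ### Encodings -/

/-- The code of a word, without the terminator. -/
def code (u : List Bool) : List Bool := u.flatMap fun b => [true, b]

@[simp] theorem encode_nil : encode [] = [] := rfl

theorem encode_cons (u : List Bool) (us : List (List Bool)) :
    encode (u :: us) = code u ++ false :: encode us := by
  simp [encode, code]

theorem encode_append (us vs : List (List Bool)) : encode (us ++ vs) = encode us ++ encode vs := by
  simp [encode]

@[simp] theorem length_code (u : List Bool) : (code u).length = 2 * u.length := by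
  induction u with
  | nil => rfl
  | cons b u ih => simp only [code, List.flatMap_cons] at ih ⊢; simp [ih]; omega

theorem getElem?_code (u : List Bool) (i : ℕ) :
    (i < u.length → (code u)[2 * i]? = some true) ∧ (code u)[2 * i + 1]? = u[i]? := by
  induction u generalizing i with
  | nil => simp [code]
  | cons b u ih =>
    have e : code (b :: u) = true :: b :: code u := rfl
    rw [e]
    cases i with
    | zero => simp
    | succ i =>
      have := ih i
      simpa [show 2 * (i + 1) = 2 * i + 1 + 1 by ring] using this

/-- The marker before each bit tells whether the word goes on, so codes with terminator form a
prefix code. -/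
theorem code_prefix {u v l l' : List Bool} (h : code u ++ false :: l = code v ++ false :: l') :
    u = v ∧ l = l' := by
  induction u generalizing v with
  | nil =>
    cases v with
    | nil => simpa [code] using h
    | cons b v => simp [code] at h
  | cons a u ih =>
    cases v with
    | nil => simp [code] at h
    | cons b v =>
      simp only [code, List.flatMap_cons, List.cons_append, List.nil_append, List.cons.injEq,
        true_and] at h ih
      obtain ⟨rfl, h⟩ := h
      simpa using ih h

theorem encode_injective : Function.Injective encode := by
  intro us vs h
  induction us generalizing vs with
  | nil =>
    cases vs with
    | nil => rfl
    | cons v vs => rw [encode_cons] at h; simp at h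
  | cons u us ih =>
    cases vs with
    | nil => rw [encode_cons] at h; simp at h
    | cons v vs =>
      rw [encode_cons, encode_cons] at h
      obtain ⟨rfl, h'⟩ := code_prefix h
      rw [ih h']

theorem exists_code {L : ℕ} {l : List Bool} (h : ∀ k < L, l[2 * k]? = some true)
    (hl : 2 * L ≤ l.length) : ∃ u : List Bool, u.length = L ∧ l.take (2 * L) = code u := by
  induction L generalizing l with
  | zero => exact ⟨[], rfl, by simp [code]⟩
  | succ L ih =>
    match l, hl with
    | [], hl => simp at hl
    | [_], hl => simp at hl; omega
    | a :: b :: l, hl =>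
      obtain rfl : a = true := by simpa using h 0 (Nat.succ_pos L)
      obtain ⟨u, hu, hl'⟩ := ih (l := l) (fun k hk => by
        have := h (k + 1) (by omega)
        simpa [show 2 * (k + 1) = 2 * k + 1 + 1 by ring] using this) (by simp at hl; omega)
      refine ⟨b :: u, by simp [hu], ?_⟩
      rw [show 2 * (L + 1) = 2 * L + 1 + 1 by ring]
      simp [hl', code]

/-- The number with a given binary expansion, the least significant bit being the first. -/
def numOf : List Bool → ℕ
  | [] => 0
  | b :: u => 2 * numOf u + b.toNat

@[simp] theorem numOf_bits (n : ℕ) : numOf n.bits = n := by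
  induction n using Nat.strong_induction_on with
  | _ n ih =>
    by_cases h : n = 0
    · subst h; simp [numOf]
    · rw [Nat.bits_of_pos h, numOf, ih _ (by omega)]
      rcases Nat.mod_two_eq_zero_or_one n with h | h <;> simp [h] <;> omega

theorem numOf_lt (u : List Bool) : numOf u < 2 ^ u.length := by
  induction u with
  | nil => simp [numOf]
  | cons b u ih =>
    have := b.toNat_lt
    rw [numOf, List.length_cons, pow_succ]; omega

theorem bits_ones (n : ℕ) : (2 ^ n - 1).bits = List.replicate n true := by
  induction n with
  | zero => simp
  | succ n ih =>
    have := Nat.two_pow_pos n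
    rw [Nat.bits_of_pos (by rw [pow_succ]; omega), List.replicate_succ,
      show (2 ^ (n + 1) - 1) / 2 = 2 ^ n - 1 by rw [pow_succ]; omega, ih,
      show (2 ^ (n + 1) - 1) % 2 = 1 by rw [pow_succ]; omega]
    rfl

/-! ### Reading the input -/

section Positions

variable (w : List Bool) (N : ℕ)

/-- The length of the word whose code starts at position `p`. -/
def wordLen (p : ℕ) : ℕ := firstIdx (fun k => w[p + 2 * k]? ≠ some true) N

/-- The start of the next word. -/
def nextPos (p : ℕ) : ℕ := p + 2 * wordLen w N p + 1

/-- The start of the word with index `j`. -/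
def wordPos (j : ℕ) : ℕ := (nextPos w N)^[j] 0

/-- The number of words. -/
def wordCount : ℕ := firstIdx (fun j => w.length ≤ wordPos w N j) N

variable {w N}

theorem wordPos_succ (j : ℕ) : wordPos w N (j + 1) = nextPos w N (wordPos w N j) :=
  Function.iterate_succ_apply' ..

theorem le_wordPos (j : ℕ) : j ≤ wordPos w N j := by
  induction j with
  | zero => simp
  | succ j ih => rw [wordPos_succ, nextPos]; omega

/-- All markers seen so far lie inside the input, so the next position to be probed is at most one
cell beyond its end. -/
theorem add_le_of_forall {p k : ℕ} (hp : p ≤ w.length)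
    (h : ∀ j < k, ¬ w[p + 2 * j]? ≠ some true) : p + 2 * k ≤ w.length + 1 := by
  cases k with
  | zero => omega
  | succ k =>
    obtain ⟨h1, -⟩ := List.getElem?_eq_some_iff.1 (not_not.1 (h k (Nat.lt_succ_self k)))
    omega

theorem wordLen_le {p : ℕ} (hp : p ≤ w.length) : p + 2 * wordLen w N p ≤ w.length + 1 :=
  add_le_of_forall hp fun _ => not_of_lt_firstIdx _ N

theorem wordCount_le : wordCount w N ≤ w.length := by
  by_contra h
  exact not_of_lt_firstIdx _ N (not_le.1 h) (le_wordPos _)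

theorem wordPos_lt {j : ℕ} (hj : j < wordCount w N) : wordPos w N j < w.length := by
  simpa using not_of_lt_firstIdx _ N hj

theorem length_le_wordPos_count (hN : w.length < N) :
    w.length ≤ wordPos w N (wordCount w N) :=
  firstIdx_spec (fun j => w.length ≤ wordPos w N j) N
    (lt_of_le_of_lt wordCount_le hN)

/-- Parsing can only go wrong by running off the end of the input. This is excluded by the bound on
`wordPos w N j`: the terminator of the last word is then a cell of the input. -/
theorem exists_encode (hN : w.length + 1 < N) (j : ℕ) (hj : ∀ i < j, wordPos w N i < w.length)
    (h : wordPos w N j ≤ w.length) :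
    ∃ us : List (List Bool), us.length = j ∧ w.take (wordPos w N j) = encode us := by
  induction j with
  | zero => exact ⟨[], rfl, by simp [wordPos]⟩
  | succ j ih =>
    have hp := hj j (Nat.lt_succ_self j)
    obtain ⟨us, hus, he⟩ := ih (fun i hi => hj i (by omega)) hp.le
    rw [wordPos_succ, nextPos] at h ⊢
    set p := wordPos w N j
    set L := wordLen w N p with hL
    obtain ⟨u, hu, hul⟩ := exists_code (L := L) (l := w.drop p) (fun k hk => by
      have : w[p + 2 * k]? = some true := not_not.1 (not_of_lt_firstIdx _ N hk)
      simpa using this) (by simp; omega)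
    have h1 : w[p + 2 * L]? ≠ some true :=
      firstIdx_spec (fun k => w[p + 2 * k]? ≠ some true) N
        (lt_of_le_of_lt (b := L) le_rfl (by omega))
    -- The cell exists, so the symbol that ended the scan is `false` and not `none`.
    have h2 : w[p + 2 * L]? = some false := by
      rw [List.getElem?_eq_getElem (by omega)] at h1 ⊢
      simpa using h1
    refine ⟨us ++ [u], by simp [hus], ?_⟩
    rw [encode_append, ← he, encode_cons, ← hul, encode_nil]
    rw [show p + 2 * L + 1 = p + (2 * L + 1) by ring, List.take_add, List.take_add_one,
      List.getElem?_drop, h2]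
    rfl

theorem wordLen_encode {us vs : List (List Bool)} {u : List Bool}
    (hN : (encode (us ++ u :: vs)).length ≤ N) :
    wordLen (encode (us ++ u :: vs)) N (encode us).length = u.length ∧
      ∀ i, i < u.length → (encode (us ++ u :: vs))[(encode us).length + 2 * i + 1]? = u[i]? := by
  have e : encode (us ++ u :: vs) = encode us ++ (code u ++ false :: encode vs) := by
    rw [encode_append, encode_cons]
  rw [e] at hN ⊢
  have hl : ∀ k, (encode us ++ (code u ++ false :: encode vs))[(encode us).length + k]? =
      (code u ++ false :: encode vs)[k]? := by
    intro k; rw [List.getElem?_append_right (by omega)]; simp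
  constructor
  · refine firstIdx_eq _ _ ?_ ?_ ?_
    · simp at hN; omega
    · intro j hj
      rw [hl, List.getElem?_append_left (by simp; omega), (getElem?_code u j).1 hj]
      simp
    · intro _
      rw [hl, List.getElem?_append_right (by simp)]
      simp
  · intro i hi
    rw [add_assoc, hl, List.getElem?_append_left (by simp; omega), (getElem?_code u i).2]

theorem wordPos_encode {us : List (List Bool)} (hN : (encode us).length ≤ N) {j : ℕ}
    (hj : j ≤ us.length) : wordPos (encode us) N j = (encode (us.take j)).length := by
  induction j with
  | zero => simp [wordPos]
  | succ j ih =>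
    have e : us = us.take j ++ us[j] :: us.drop (j + 1) := by simp
    rw [wordPos_succ, ih (by omega), nextPos]
    have := (wordLen_encode (us := us.take j) (u := us[j]) (vs := us.drop (j + 1)) (N := N)
      (by rwa [← e])).1
    rw [← e] at this
    rw [this, List.take_add_one, List.getElem?_eq_getElem hj, encode_append]
    simp [encode_cons]
    ring

theorem wordPos_encode_lt {us : List (List Bool)} (hN : (encode us).length ≤ N) {j : ℕ}
    (hj : j < us.length) : wordPos (encode us) N j < (encode us).length := by
  have e : us = us.take j ++ us[j] :: us.drop (j + 1) := by simp
  rw [wordPos_encode hN hj.le]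
  conv_rhs => rw [e, encode_append, encode_cons]
  simp

theorem wordCount_encode {us : List (List Bool)} (hN : (encode us).length < N) :
    wordCount (encode us) N = us.length := by
  have h1 : ∀ j < us.length, ¬ (encode us).length ≤ wordPos (encode us) N j :=
    fun j hj => not_le.2 (wordPos_encode_lt hN.le hj)
  have h2 : (encode us).length ≤ wordPos (encode us) N us.length := by
    rw [wordPos_encode hN.le le_rfl, List.take_length]
  refine firstIdx_eq _ _ ?_ h1 (fun _ => h2)
  have := le_wordPos (w := encode us) (N := N) us.length
  rw [wordPos_encode hN.le le_rfl, List.take_length] at this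
  omega

/-- After the last word the position is at least `w.length`, with equality iff the last terminator
is present. Truncated subtraction makes the test equivalent to this equality together with `w ≠ []`,
so the empty sequence of words is excluded as well. -/
theorem wellFormed_iff (hN : w.length + 1 < N) :
    wordPos w N (wordCount w N) - 1 < w.length ↔ ∃ us : List (List Bool), us ≠ [] ∧ w = encode us := by
  have h1 := length_le_wordPos_count (w := w) (N := N) (by omega)
  constructor
  · intro h
    have h2 : wordPos w N (wordCount w N) = w.length := by omega
    obtain ⟨us, -, h3⟩ := exists_encode hN _ (fun i => wordPos_lt) h2.le
    rw [h2, List.take_length] at h3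
    refine ⟨us, ?_, h3⟩
    rintro rfl
    subst h3
    simp at h
  · rintro ⟨us, h, rfl⟩
    rw [wordCount_encode (by omega), wordPos_encode (by omega) le_rfl, List.take_length]
    obtain ⟨u, us, rfl⟩ := List.exists_cons_of_ne_nil h
    rw [encode_cons]; simp

end Positions

namespace Tm

def wordLen (p : Tm) : Tm := search top (not (isTrue (add (wk 2 p) (add (var 0) (var 0)))))

def nextPos (p : Tm) : Tm := succ (add p (add (wordLen p) (wordLen p)))

def wordPos (j : Tm) : Tm := fold j zero (nextPos (var 0))

def wordCount : Tm := search top (not (inside (wordPos (var 0))))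

/-- Test whether the input is the code of a nonempty sequence of words. -/
def wellFormed : Tm := inside (pred (wordPos wordCount))

/-- The value of the word with index `j` as a binary number. -/
def wordVal (j : Tm) : Tm :=
  bind (wordPos j) (fold (wordLen (var 0)) zero
    (add (add (var 0) (var 0)) (isTrue (succ (add (var 2) (add (var 1) (var 1)))))))

end Tm

section Input

variable {w : List Bool} {A : Language Bool} {N : ℕ} {P : St → Prop} {t : Tm} {env : List ℕ}
  {x : ℕ}

theorem toNat_ne_zero (b : Bool) : b.toNat ≠ 0 ↔ b = true := by cases b <;> simp

theorem Val.wordLen (h : Val w A N P t env x) (hx : x ≤ w.length) (hN : w.length + 2 ≤ N) :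
    Val w A N P t.wordLen env (wordLen w N x) := by
  refine Val.search Val.top le_rfl fun k hk hj i => ?_
  have := add_le_of_forall hx hj
  refine ⟨_, ((h.wk2.add (Val.var0.add Val.var0 (by omega)) (by omega)).inp _).not (by omega), ?_⟩
  rw [← two_mul]
  cases w[x + 2 * k]? <;> simp

theorem Val.nextPos (h : Val w A N P t env x) (hx : x ≤ w.length) (hN : w.length + 2 ≤ N) :
    Val w A N P t.nextPos env (nextPos w N x) := by
  have := wordLen_le (N := N) hx
  have h' := h.wordLen hx hN
  exact ((h.add (h'.add h' (by omega)) (by omega)).succ (by omega)).congr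
    (by rw [CatalyticLogspace.nextPos]; ring)

theorem Val.wordPos (h : Val w A N P t env x) (hx : ∀ j < x, wordPos w N j ≤ w.length)
    (hN : w.length + 2 ≤ N) : Val w A N P t.wordPos env (wordPos w N x) := by
  refine Val.foldUp (fun j => CatalyticLogspace.wordPos w N j) h Val.zero fun k hk i => ?_
  exact (Val.var0.nextPos (hx k hk) hN).congr (wordPos_succ k).symm

theorem Val.wordCount (hN : w.length + 2 ≤ N) :
    Val w A N P .wordCount env (wordCount w N) := by
  refine Val.search Val.top le_rfl fun k hk hj i => ?_
  refine ⟨_, ((Val.var0.wordPos (fun j hj' => ?_) hN).inp _).not (by omega), ?_⟩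
  · have := hj j hj'; omega
  · by_cases h : CatalyticLogspace.wordPos w N k < w.length <;> simp [h]; omega

theorem Val.wellFormed (hN : w.length + 2 ≤ N) : ∃ v, Val w A N P .wellFormed env v ∧
    (v ≠ 0 ↔ ∃ us : List (List Bool), us ≠ [] ∧ w = encode us) := by
  refine ⟨_, ((Val.wordCount hN).wordPos (fun j hj => (wordPos_lt hj).le) hN).pred.inp _, ?_⟩
  rw [toNat_ne_zero, ← wellFormed_iff (N := N) (by omega)]
  simp

/-- Weights in the input may be far too long for a register, so their values are saturated at `N`;
this suffices for recognizing those that are too large. -/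
theorem Val.wordVal {us : List (List Bool)} (hw : w = encode us) (h : Val w A N P t env x)
    (hx : x < us.length) (hN : w.length + 2 ≤ N) :
    Val w A N P t.wordVal env (min (numOf us[x]) N) := by
  subst hw
  have hp := wordPos_encode_lt (N := N) (by omega) hx
  have e : us = us.take x ++ us[x] :: us.drop (x + 1) := by simp
  obtain ⟨h1, h2⟩ := wordLen_encode (us := us.take x) (u := us[x]) (vs := us.drop (x + 1)) (N := N)
    (by rw [← e]; omega)
  rw [← e, ← wordPos_encode (N := N) (by omega) hx.le] at h1 h2
  have hlen := wordLen_le (w := encode us) (N := N) hp.le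
  refine Val.bind (h.wordPos (fun j hj => (wordPos_encode_lt (by omega) (hj.trans hx)).le) hN) ?_
  set p := CatalyticLogspace.wordPos (encode us) N x
  -- The descending counter reads the most significant bit first, so the accumulator is the value of
  -- the digits from `k` on.
  refine (Val.fold (fun k => min (numOf (us[x].drop k)) N) (Val.var0.wordLen hp.le hN)
    (Val.zero.congr ?_) fun k hk => ?_).congr (by simp)
  · simp [h1, numOf]
  · rw [h1] at hk hlen
    have hb := (Val.var0 (w := encode us) (A := A) (N := N) (P := P)
      (x := min (numOf (us[x].drop (k + 1))) N) (env := k :: p :: env))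
    have h3 := h2 k hk
    rw [List.getElem?_eq_getElem hk] at h3
    refine ((hb.add_sat hb (min_le_right _ _)).add_sat ((Val.succ (Val.var2.add
      (Val.var1.add Val.var1 (by omega)) (by omega)) (by omega)).inp _) (min_le_right _ _)).congr ?_
    rw [← two_mul k, h3, List.drop_eq_getElem_cons hk, numOf]
    have : (some us[x][k] == some true) = us[x][k] := by cases us[x][k] <;> rfl
    rw [this]
    omega

end Input

/-! ### Witnesses of minimum weight -/

section MinWeight

variable {r : ℕ} (Y : (Fin r → Bool) → Prop)

/-- `y` has minimum weight among the words with `Y`. -/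
def IsMin (U : Fin r → ℕ) (y : Fin r → Bool) : Prop :=
  Y y ∧ ∀ y', Y y' → weight U y ≤ weight U y'

/-- The minimum weight of a word with `Y`. -/
noncomputable def minWeight (U : Fin r → ℕ) : ℕ := sInf {v | ∃ y, Y y ∧ weight U y = v}

/-- The weights `g`, increased by `e` at `i` and by `1` elsewhere. -/
def pert (g : Fin r → ℕ) (i : ℕ) (e : ℕ) : Fin r → ℕ := fun l => g l + if (l : ℕ) = i then e else 1

/-- Minimum weight words for `g + 1` may or may not contain `i`. -/
def Amb (g : Fin r → ℕ) (i : Fin r) : Prop :=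
  (∃ y, IsMin Y (fun l => g l + 1) y ∧ y i = true) ∧
    ∃ y, IsMin Y (fun l => g l + 1) y ∧ y i = false

variable {Y} {g g' : Fin r → ℕ} {i : Fin r} {y : Fin r → Bool}

theorem weight_le_card (U : Fin r → ℕ) {B : ℕ} (h : ∀ l, U l ≤ B) (y : Fin r → Bool) :
    weight U y ≤ r * B := by
  calc weight U y ≤ ∑ _l : Fin r, B :=
        Finset.sum_le_sum fun l _ => by split_ifs <;> simp [h l]
    _ = r * B := by simp

theorem weight_of_false (h : ∀ l, l ≠ i → g l = g' l) (hy : y i = false) :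
    weight g y = weight g' y := by
  refine Finset.sum_congr rfl fun l _ => ?_
  by_cases hl : l = i
  · subst hl; simp [hy]
  · rw [h l hl]

theorem weight_of_true (h : ∀ l, l ≠ i → g l = g' l) (hy : y i = true) :
    weight g y + g' i = weight g' y + g i := by
  unfold weight
  rw [← Finset.add_sum_erase _ _ (Finset.mem_univ i),
    ← Finset.add_sum_erase (Finset.univ) (fun l => if y l then g' l else 0) (Finset.mem_univ i)]
  have : ∑ l ∈ Finset.univ.erase i, (if y l then g l else 0) =
      ∑ l ∈ Finset.univ.erase i, (if y l then g' l else 0) :=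
    Finset.sum_congr rfl fun l hl => by rw [h l (Finset.ne_of_mem_erase hl)]
  simp only [hy, if_true, this]
  ring

theorem exists_isMin (U : Fin r → ℕ) (hY : ∃ y, Y y) :
    ∃ y, IsMin Y U y ∧ weight U y = minWeight Y U := by
  obtain ⟨y₀, h₀⟩ := hY
  obtain ⟨y, hy, hw⟩ := Nat.sInf_mem (s := {v | ∃ y, Y y ∧ weight U y = v}) ⟨_, y₀, h₀, rfl⟩
  exact ⟨y, ⟨hy, fun y' hy' => hw.le.trans (Nat.sInf_le ⟨y', hy', rfl⟩)⟩, hw⟩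

theorem minWeight_le (U : Fin r → ℕ) (hy : Y y) : minWeight Y U ≤ weight U y :=
  Nat.sInf_le ⟨y, hy, rfl⟩

theorem IsMin.eq {U : Fin r → ℕ} (h : IsMin Y U y) : weight U y = minWeight Y U := by
  obtain ⟨y', h', e⟩ := exists_isMin U ⟨y, h.1⟩
  exact le_antisymm (e ▸ h.2 y' h'.1) (minWeight_le U h.1)

theorem isMin_iff {U : Fin r → ℕ} : IsMin Y U y ↔ Y y ∧ weight U y ≤ minWeight Y U :=
  ⟨fun h => ⟨h.1, h.eq.le⟩, fun h => ⟨h.1, fun _ h' => h.2.trans (minWeight_le U h')⟩⟩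

-- The reference weights are `g + 1`, so that `e = 0, 1, 2` means lowering, keeping and raising a
-- weight by one within `ℕ`.
@[simp] theorem pert_one (g : Fin r → ℕ) (i : ℕ) : pert g i 1 = fun l => g l + 1 := by
  funext l; simp [pert]

theorem weight_pert (g : Fin r → ℕ) (i : Fin r) (e : ℕ) (y : Fin r → Bool) :
    (y i = false → weight (pert g i e) y = weight (fun l => g l + 1) y) ∧
      (y i = true → weight (pert g i e) y + 1 = weight (fun l => g l + 1) y + e) := by
  have h : ∀ l, l ≠ i → pert g i e l = g l + 1 := by
    intro l hl
    have : (l : ℕ) ≠ i := fun h => hl (Fin.ext h)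
    simp [pert, this]
  refine ⟨fun hy => weight_of_false h hy, fun hy => ?_⟩
  have := weight_of_true h hy
  have e : pert g i e i = g i + e := by simp [pert]
  rw [e] at this
  omega

/-- Lowering one weight by one lowers the weight of each word by at most one. If the minimum drops,
the new optimal words are those that drop with it: they contain `i` and were optimal before. -/
theorem isMin_pert_zero (h : minWeight Y (pert g i 0) < minWeight Y (fun l => g l + 1))
    (hy : IsMin Y (pert g i 0) y) : IsMin Y (fun l => g l + 1) y ∧ y i = true := by
  have h1 := hy.eq
  have h2 := minWeight_le (fun l => g l + 1) hy.1
  have h3 := weight_pert g i 0 y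
  cases hi : y i with
  | false => have := h3.1 hi; omega
  | true => have := h3.2 hi; exact ⟨isMin_iff.2 ⟨hy.1, by omega⟩, rfl⟩

theorem minWeight_pert_zero_lt (hY : ∃ y, Y y) :
    minWeight Y (pert g i 0) < minWeight Y (fun l => g l + 1) ↔
      ∃ y, IsMin Y (fun l => g l + 1) y ∧ y i = true := by
  constructor
  · intro h
    obtain ⟨y, hy, -⟩ := exists_isMin (pert g i 0) hY
    exact ⟨y, isMin_pert_zero h hy⟩
  · rintro ⟨y, hy, hi⟩
    have h1 := hy.eq
    have h2 := minWeight_le (pert g i 0) hy.1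
    have h3 := (weight_pert g i 0 y).2 hi
    omega

/-- A word that avoids `i` keeps its weight when `i` becomes more expensive, while words with `i`
get heavier. So the minimum stays the same exactly if an optimal word avoids `i`. -/
theorem minWeight_pert_two_le (hY : ∃ y, Y y) :
    minWeight Y (pert g i 2) ≤ minWeight Y (fun l => g l + 1) ↔
      ∃ y, IsMin Y (fun l => g l + 1) y ∧ y i = false := by
  constructor
  · intro h
    obtain ⟨y, hy, he⟩ := exists_isMin (pert g i 2) hY
    have h2 := minWeight_le (fun l => g l + 1) hy.1
    have h3 := weight_pert g i 2 y
    refine ⟨y, ?_⟩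
    cases hi : y i with
    | false => have := h3.1 hi; exact ⟨isMin_iff.2 ⟨hy.1, by omega⟩, rfl⟩
    | true => have := h3.2 hi; omega
  · rintro ⟨y, hy, hi⟩
    have h1 := hy.eq
    have h2 := minWeight_le (pert g i 2) hy.1
    have h3 := (weight_pert g i 2 y).1 hi
    omega

theorem amb_iff (hY : ∃ y, Y y) : Amb Y g i ↔
    minWeight Y (pert g i 0) < minWeight Y (fun l => g l + 1) ∧
      minWeight Y (pert g i 2) ≤ minWeight Y (fun l => g l + 1) := by
  rw [minWeight_pert_zero_lt hY, minWeight_pert_two_le hY, Amb]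

/-- An exchange argument. Compare an optimal word with `i` for `g'` and an optimal word without `i`
for `g`, each time against the other. The word without `i` weighs the same under both weights, and
the weight of the word with `i` changes by exactly the difference of the entries at `i`. -/
theorem Amb.le (h : Amb Y g i) (h' : Amb Y g' i) (hg : ∀ l, l ≠ i → g l = g' l) : g' i ≤ g i := by
  obtain ⟨⟨y₁, h₁, e₁⟩, y₀, h₀, e₀⟩ := h
  obtain ⟨⟨y₁', h₁', e₁'⟩, y₀', h₀', e₀'⟩ := h'
  have hg' : ∀ l, l ≠ i → g l + 1 = g' l + 1 := fun l hl => by rw [hg l hl]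
  have k1 := weight_of_true hg' e₁'
  have k2 := weight_of_false hg' e₀
  have k3 := h₁'.2 y₀ h₀.1
  have k4 := h₀.2 y₁' h₁'.1
  omega

theorem Amb.unique (h : Amb Y g i) (h' : Amb Y g' i) (hg : ∀ l, l ≠ i → g l = g' l) :
    g i = g' i :=
  le_antisymm (h'.le h fun l hl => (hg l hl).symm) (h.le h' hg)

/-- Without ambiguity the minimum weight word can be read off bit by bit. -/
theorem IsMin.apply_eq_true_iff (h : IsMin Y (fun l => g l + 1) y) (hi : ¬ Amb Y g i) :
    y i = true ↔ minWeight Y (pert g i 0) < minWeight Y (fun l => g l + 1) := by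
  rw [minWeight_pert_zero_lt ⟨y, h.1⟩]
  refine ⟨fun e => ⟨y, h, e⟩, fun h' => ?_⟩
  by_contra e
  exact hi ⟨h', y, h, by simpa using e⟩

/-- All perturbations together stay below one unit `S` of the scaled weights, so words are compared
by `W` first and ties are broken by `V`. -/
theorem isMin_of_scaled {W V : Fin r → ℕ} {S : ℕ} (hV : ∀ y : Fin r → Bool, weight V y < S)
    (hg : ∀ l, g l + 1 = W l * S + V l) (h : IsMin Y (fun l => g l + 1) y) : IsMin Y W y := by
  have e : ∀ y : Fin r → Bool, weight (fun l => g l + 1) y = weight W y * S + weight V y := by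
    intro y
    unfold weight
    rw [Finset.sum_mul, ← Finset.sum_add_distrib]
    refine Finset.sum_congr rfl fun l _ => ?_
    simp only [hg]; split_ifs <;> simp
  refine ⟨h.1, fun y' hy' => ?_⟩
  have h1 := h.2 y' hy'
  rw [e, e] at h1
  have h2 := hV y'
  by_contra h3
  have h4 : (weight W y' + 1) * S ≤ weight W y * S := Nat.mul_le_mul_right S (by omega)
  rw [add_mul, one_mul] at h4
  omega

/-- Decreasing the weight of an index that occurs in a minimum weight word removes the ambiguity of
this index, and creates no new ambiguities. -/
theorem not_amb_of_decrease (hY : ∃ y, Y y)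
    (hg : ∀ l, g' l + 1 = pert g i (if minWeight Y (pert g i 0) <
      minWeight Y (fun l => g l + 1) then 0 else 1) l) :
    ¬ Amb Y g' i ∧ ∀ j, ¬ Amb Y g j → ¬ Amb Y g' j := by
  by_cases h : minWeight Y (pert g i 0) < minWeight Y (fun l => g l + 1)
  -- The new optimal words all contain `i` and form a subset of the old ones; an ambiguity among
  -- them was there before.
  · simp only [h, if_true] at hg
    have key : ∀ y, IsMin Y (fun l => g' l + 1) y → IsMin Y (fun l => g l + 1) y ∧ y i = true := by
      intro y hy
      rw [funext hg] at hy
      exact isMin_pert_zero h hy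
    constructor
    · rintro ⟨-, y, hy, hi⟩
      rw [(key y hy).2] at hi
      exact Bool.noConfusion hi
    · rintro j hj ⟨⟨y, hy, hi⟩, y', hy', hi'⟩
      exact hj ⟨⟨y, (key y hy).1, hi⟩, y', (key y' hy').1, hi'⟩
  -- If the minimum does not drop, no optimal word contains `i`, so `i` is not ambiguous and the
  -- weights stay unchanged.
  · simp only [h, if_false, pert_one] at hg
    obtain rfl : g' = g := funext fun l => by have := hg l; omega
    refine ⟨fun hA => h ?_, fun _ => id⟩
    exact ((amb_iff hY).1 hA).1

end MinWeight

/-! ### Fields on the catalytic tape -/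

/-- The number in the `n` cells of the catalytic tape from position `p` on, in binary. -/
def field (τ : List Bool) (p : ℕ) : ℕ → ℕ
  | 0 => 0
  | n + 1 => 2 * field τ (p + 1) n + (τ.getD p false).toNat

theorem field_lt (τ : List Bool) (p n : ℕ) : field τ p n < 2 ^ n := by
  induction n generalizing p with
  | zero => simp [field]
  | succ n ih =>
    have := ih (p + 1)
    have := (τ.getD p false).toNat_lt
    rw [field, pow_succ]; omega

theorem testBit_field (τ : List Bool) (p n q : ℕ) :
    (field τ p n).testBit q = (decide (q < n) && τ.getD (p + q) false) := by
  induction n generalizing p q with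
  | zero => simp [field]
  | succ n ih =>
    rw [field]
    cases q with
    | zero => cases h : τ.getD p false <;> simp [Nat.testBit_zero, Nat.add_mod]
    | succ q =>
      rw [Nat.testBit_succ, show (2 * field τ (p + 1) n + (τ.getD p false).toNat) / 2 =
        field τ (p + 1) n by have := (τ.getD p false).toNat_lt; omega, ih,
        show p + 1 + q = p + (q + 1) by ring]
      simp

theorem field_congr {τ τ' : List Bool} {p p' n : ℕ}
    (h : ∀ q < n, τ.getD (p + q) false = τ'.getD (p' + q) false) : field τ p n = field τ' p' n := by
  refine Nat.eq_of_testBit_eq fun q => ?_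
  rw [testBit_field, testBit_field]
  by_cases hq : q < n
  · rw [h q hq]
  · simp [hq]

/-- Where the perturbation of the weight with index `l` is found: in the `width` cells of the
catalytic tape from `base + l * stride` on. The weights are multiplied by `S`. -/
structure Layout (α : Type) where
  S : α
  base : α
  stride : α
  width : α

namespace Tm

def field (p n : Tm) : Tm :=
  fold n zero (add (add (var 0) (var 0)) (cat (add (wk 2 p) (var 1))))

def wk2 (D : Layout Tm) : Layout Tm := ⟨wk 2 D.S, wk 2 D.base, wk 2 D.stride, wk 2 D.width⟩

/-- The weight of `l`, with `e` added if `l = i`, and with `1` added otherwise. -/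
def queryWeight (D : Layout Tm) (i e l : Tm) : Tm :=
  add (add (mul (wordVal (succ l)) D.S) (field (add D.base (mul l D.stride)) D.width))
    (ifz (dist l i) e one)

/-- Ask whether there is a witness with weight at most `w₀`. -/
def askWeight (D : Layout Tm) (r i e w₀ : Tm) : Tm :=
  seq (emitPrefix (wordPos one))
    (seq (fold r zero
        (seq (emitNum (queryWeight (wk2 D) (wk 2 i) (wk 2 e) (var 0))) (succ (var 0))))
      (seq (emitNum w₀) query))

/-- The minimum weight of a witness. -/
def minWeight (D : Layout Tm) (r i e : Tm) : Tm :=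
  search top (askWeight (wk2 D) (wk 2 r) (wk 2 i) (wk 2 e) (var 0))

/-- Test whether some witness of minimum weight contains `i`. -/
def occurs (D : Layout Tm) (r i : Tm) : Tm :=
  sub (minWeight D r i one) (minWeight D r i zero)

/-- Test whether `i` is ambiguous. -/
def amb (D : Layout Tm) (r i : Tm) : Tm :=
  ifz (occurs D r i) zero (not (sub (minWeight D r i (succ one)) (minWeight D r i one)))

/-- The first ambiguous index. -/
def firstAmb (D : Layout Tm) (r : Tm) : Tm := search r (amb (wk2 D) (wk 2 r) (var 0))

/-- Write the witness of minimum weight. -/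
def output (D : Layout Tm) (r : Tm) : Tm :=
  fold r zero (seq (out (occurs (wk2 D) (wk 2 r) (var 0))) (succ (var 0)))

end Tm

/-- The weights in the input. -/
def inputWeight (us : List (List Bool)) (l : Fin us.length) : ℕ := numOf us[l]

/-- The weights with the perturbations on the catalytic tape. -/
def layoutWeight (us : List (List Bool)) (τ : List Bool) (d : Layout ℕ) (l : Fin us.length) : ℕ :=
  inputWeight us l * d.S + field τ (d.base + l * d.stride) d.width

/-- The input is `(x, us)`, and `A` answers questions about the minimum weight of words with `Y`,
as long as the weights are at most `K`. -/
structure Setting (w x : List Bool) (us : List (List Bool)) (A : Language Bool) (N K : ℕ)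
    (Y : (Fin us.length → Bool) → Prop) : Prop where
  input : w = encode (x :: us)
  length_le : w.length + 2 ≤ N
  weight_le : ∀ l, inputWeight us l ≤ N
  mem_iff : ∀ (U : Fin us.length → ℕ) (w₀ : ℕ), (∀ l, U l ≤ K) →
    (encodeQuery x U w₀ ∈ A ↔ ∃ y, Y y ∧ weight U y ≤ w₀)
  total_lt : us.length * K < N
  exists_word : ∃ y, Y y

/-- The bounds that make sure that the numbers do not become too large. -/
structure Fits (us : List (List Bool)) (N K e : ℕ) (d : Layout ℕ) : Prop where
  weight_le : ∀ l, inputWeight us l * d.S + 2 ^ d.width + e ≤ K + 1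
  pos_le : d.base + us.length * d.stride + d.width ≤ N

theorem encode_eq_flatMap (us : List (List Bool)) :
    encode us = us.flatMap fun u => encode [u] := by
  simp [encode]

theorem encode_ofFn {r : ℕ} (f : ℕ → List Bool) :
    encode (List.ofFn fun l : Fin r => f l) = (List.range r).flatMap fun l => encode [f l] := by
  rw [encode_eq_flatMap, List.ofFn_eq_map, ← List.map_coe_finRange_eq_range, List.flatMap_map,
    List.flatMap_map]

section Field

variable {w : List Bool} {A : Language Bool} {N : ℕ} {P : St → Prop} {τ : List Bool} {t u : Tm}
  {env : List ℕ} {p n : ℕ}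

theorem Val.field (hP : ∀ st, P st → st.cat = τ) (ht : Val w A N P t env p)
    (hu : Val w A N P u env n) (hp : p + n ≤ N) (hn : 2 ^ n ≤ N) :
    Val w A N P (t.field u) env (field τ p n) := by
  refine Val.fold (fun k => CatalyticLogspace.field τ (p + k) (n - k)) hu
    (Val.zero.congr (by simp [CatalyticLogspace.field])) fun k hk => ?_
  have h := field_lt τ (p + k) (n - k)
  have h' : 2 ^ (n - k) ≤ 2 ^ n := Nat.pow_le_pow_right two_pos (Nat.sub_le n k)
  have e : CatalyticLogspace.field τ (p + k) (n - k) =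
      CatalyticLogspace.field τ (p + (k + 1)) (n - (k + 1)) +
      CatalyticLogspace.field τ (p + (k + 1)) (n - (k + 1)) + (τ.getD (p + k) false).toNat := by
    rw [show n - k = n - (k + 1) + 1 by omega, CatalyticLogspace.field,
      ← add_assoc p k 1, two_mul]
  rw [e] at h ⊢
  exact (Val.var0.add Val.var0 (by omega)).add (Val.cat hP (ht.wk2.add Val.var1 (by omega)))
    (by omega)

end Field

theorem ev_seq {w : List Bool} {A : Language Bool} {N : ℕ} (t u : Tm) (env : List ℕ) (st : St) :
    ev w A N (t.seq u) env st = ev w A N u env (ev w A N t env st).2 := rfl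

/-- `CatVal` for layouts. -/
structure LayoutVal (w : List Bool) (A : Language Bool) (N : ℕ) (τ : List Bool) (D : Layout Tm)
    (env : List ℕ) (d : Layout ℕ) : Prop where
  S : CatVal w A N τ D.S env d.S
  base : CatVal w A N τ D.base env d.base
  stride : CatVal w A N τ D.stride env d.stride
  width : CatVal w A N τ D.width env d.width

/-- `Val` for terms that may depend on the catalytic tape and may use the query tape. -/
abbrev QueryVal (w : List Bool) (A : Language Bool) (N : ℕ) (τ : List Bool) :=
  Val w A N (fun st => st.cat = τ ∧ st.ask = [])

theorem Val.queryVal {w : List Bool} {A : Language Bool} {N : ℕ} {τ : List Bool} {t : Tm}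
    {env : List ℕ} {v : ℕ} (h : CatVal w A N τ t env v) : QueryVal w A N τ t env v :=
  h.mono fun _ h => h.1

/-! ### Minimum weights and ambiguity by means of the oracle. -/

section Query

variable {w x : List Bool} {us : List (List Bool)} {A : Language Bool} {N K : ℕ}
  {Y : (Fin us.length → Bool) → Prop} {τ : List Bool} {D : Layout Tm} {R I E L W₀ : Tm}
  {env : List ℕ} {d : Layout ℕ} {i e e₀ l w₀ : ℕ}

theorem LayoutVal.wk2 (h : LayoutVal w A N τ D env d) (a b : ℕ) :
    LayoutVal w A N τ (Tm.wk2 D) (a :: b :: env) d :=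
  ⟨h.S.wk2, h.base.wk2, h.stride.wk2, h.width.wk2⟩

theorem Setting.one_le (hS : Setting w x us A N K Y) : 2 ≤ N := by
  have := hS.length_le; omega

theorem Setting.le_length (hS : Setting w x us A N K Y) : us.length + 1 ≤ N := by
  have h1 := hS.length_le
  have h2 := wordCount_le (w := w) (N := N)
  rw [hS.input] at h1 h2
  rw [wordCount_encode (by omega)] at h2
  simp only [List.length_cons] at h2
  omega

/-- A field holds at most `2 ^ width - 1`, which accounts for the `K + 1` in `Fits`. -/
theorem pert_le (hF : Fits us N K e₀ d) (he : e ≤ e₀) (he₀ : 1 ≤ e₀) (l : Fin us.length) :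
    pert (layoutWeight us τ d) i e l ≤ K := by
  have h1 := hF.weight_le l
  have h2 := field_lt τ (d.base + l * d.stride) d.width
  unfold pert layoutWeight
  split_ifs <;> omega

theorem Setting.le_of_fin (hS : Setting w x us A N K Y) (l : Fin us.length) : K < N := by
  have h1 := hS.total_lt
  have h2 := Nat.le_mul_of_pos_left K l.pos
  omega

theorem Val.queryWeight (hS : Setting w x us A N K Y) (hF : Fits us N K e₀ d)
    (hD : LayoutVal w A N τ D env d) (hI : CatVal w A N τ I env i) (hi : i ≤ N)
    (hE : CatVal w A N τ E env e) (he : e ≤ e₀) (he₀ : 1 ≤ e₀) (hl : l < us.length)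
    (hL : CatVal w A N τ L env l) :
    CatVal w A N τ (Tm.queryWeight D I E L) env (pert (layoutWeight us τ d) i e ⟨l, hl⟩) := by
  have hN := hS.length_le
  have h2 := hS.one_le
  have hr := hS.le_length
  have hK := hS.le_of_fin ⟨l, hl⟩
  have hw := hF.weight_le ⟨l, hl⟩
  have hp := hF.pos_le
  have hlt := field_lt τ (d.base + l * d.stride) d.width
  have hls : l * d.stride ≤ us.length * d.stride := Nat.mul_le_mul_right _ hl.le
  have h1 : CatVal w A N τ (Tm.wordVal L.succ) env (inputWeight us ⟨l, hl⟩) :=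
    (Val.wordVal hS.input (hL.succ (by omega)) (by simpa using hl) hN).congr
      (min_eq_left (hS.weight_le ⟨l, hl⟩))
  refine Val.congr (((h1.mul hD.S (by omega)).add (Val.field (fun _ h => h) (hD.base.add
    (hL.mul hD.stride (by omega)) (by omega)) hD.width (by omega) (by omega)) (by omega)).add
    ((hL.dist hI (by omega) hi).ifz_ite (p := l ≠ i) (by omega) hE (Val.one (by omega))) ?_) ?_
  · split_ifs <;> omega
  · unfold pert layoutWeight
    by_cases h : l = i <;> simp [h]

/-- The word `x` is copied from the input cell by cell, and the perturbed weights are computed one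
after another and written digit by digit; only single numbers are ever stored. As the query erases
the query tape, the term has no lasting effect if that tape was empty before. -/
theorem Val.askWeight (hS : Setting w x us A N K Y) (hF : Fits us N K e₀ d)
    (hD : LayoutVal w A N τ D env d) (hR : CatVal w A N τ R env us.length)
    (hI : CatVal w A N τ I env i) (hi : i ≤ N) (hE : CatVal w A N τ E env e) (he : e ≤ e₀) (he₀ : 1 ≤ e₀)
    (hW : CatVal w A N τ W₀ env w₀) (hw₀ : w₀ ≤ N) :
    ∃ v, QueryVal w A N τ (Tm.askWeight D R I E W₀) env v ∧
      (v ≠ 0 ↔ ∃ y, Y y ∧ weight (pert (layoutWeight us τ d) i e) y ≤ w₀) := by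
  classical
  have hN := hS.length_le
  have h2 := hS.one_le
  have hr := hS.le_length
  rw [← hS.mem_iff _ _ (pert_le hF he he₀)]
  refine ⟨(decide (encodeQuery x (pert (layoutWeight us τ d) i e) w₀ ∈ A)).toNat, ?_,
    by rw [toNat_ne_zero, decide_eq_true_iff]⟩
  have hpos : CatalyticLogspace.wordPos w N 1 = (encode [x]).length := by
    rw [hS.input] at hN ⊢
    rw [wordPos_encode (by omega) (by simp)]; simp
  have he1 : w.take (encode [x]).length = encode [x] := by
    rw [hS.input, ← List.singleton_append (l := us), encode_append, List.take_left]
  have hle1 : (encode [x]).length ≤ w.length := by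
    rw [hS.input, ← List.singleton_append (l := us), encode_append]; simp
  have h1 := emits_prefix (A := A) (N := N) (τ := τ) (env := env) (w := w)
    ((Val.one (by omega)).wordPos (fun j hj => by
      obtain rfl : j = 0 := by omega
      simp [CatalyticLogspace.wordPos]) hN) (by rw [hpos]; exact hle1) (by omega)
  rw [hpos, he1] at h1
  let f : ℕ → List Bool := fun l =>
    if h : l < us.length then (pert (layoutWeight us τ d) i e ⟨l, h⟩).bits else []
  have h3 := Emits.foldUp (fun l => encode [f l]) hR (b := .seq (.emitNum
    (.queryWeight (Tm.wk2 D) (.wk 2 I) (.wk 2 E) (.var 0))) (.succ (.var 0))) fun k hk j => by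
      have := emits_num (by omega) (Val.queryWeight hS hF (hD.wk2 k j) hI.wk2 hi hE.wk2 he he₀ hk
        Val.var0) ((pert_le hF he he₀ ⟨k, hk⟩).trans (hS.le_of_fin ⟨k, hk⟩).le)
      refine (this.seq (Val.var0.succ (by omega)).emits).congr ?_
      simp [f, hk]
  have h4 := emits_num (by omega) hW hw₀
  intro st hst
  set weights := (List.range us.length).flatMap fun l => encode [f l] with hweights
  have h5 : ev w A N (Tm.askWeight D R I E W₀) env st = ev w A N .query env
      { st with ask := st.ask ++ encode [x] ++ weights ++ encode [w₀.bits] } := by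
    rw [Tm.askWeight, ev_seq, h1 st hst.1, ev_seq]
    dsimp only
    rw [h3 { st with ask := st.ask ++ encode [x] } hst.1, ev_seq]
    dsimp only
    rw [h4 { st with ask := st.ask ++ encode [x] ++ weights } hst.1]
  rw [h5, ev, hst.2, List.nil_append, hweights, ← encode_ofFn, ← encode_append, ← encode_append]
  have h6 : encodeQuery x (pert (layoutWeight us τ d) i e) w₀ =
      encode ([x] ++ List.ofFn (fun l : Fin us.length => f l) ++ [w₀.bits]) := by
    simp [encodeQuery, f]
  rw [h6, ← hst.2]

/-- The minimum is at most `us.length * K < N`, so trying all bounds in turn finds it. -/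
theorem Val.minWeight (hS : Setting w x us A N K Y) (hF : Fits us N K e₀ d)
    (hD : LayoutVal w A N τ D env d) (hR : CatVal w A N τ R env us.length)
    (hI : CatVal w A N τ I env i) (hi : i ≤ N) (hE : CatVal w A N τ E env e) (he : e ≤ e₀) (he₀ : 1 ≤ e₀) :
    QueryVal w A N τ (Tm.minWeight D R I E) env (minWeight Y (pert (layoutWeight us τ d) i e)) := by
  classical
  set U := pert (layoutWeight us τ d) i e with hU
  refine (Val.search (p := fun k => ∃ y, Y y ∧ weight U y ≤ k) Val.top le_rfl
    fun k hk _ j => ?_).congr ?_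
  · exact Val.askWeight hS hF (hD.wk2 k j) hR.wk2 hI.wk2 hi hE.wk2 he he₀ Val.var0 hk.le
  · obtain ⟨y, hy, he'⟩ := exists_isMin U hS.exists_word
    have := weight_le_card U (pert_le hF he he₀) y
    have := hS.total_lt
    refine firstIdx_eq _ _ (by omega) ?_ (fun _ => ⟨y, hy.1, he'.le⟩)
    rintro j hj ⟨y', hy', hle⟩
    have := minWeight_le U hy'
    omega

theorem Val.occurs (hS : Setting w x us A N K Y) (hF : Fits us N K e₀ d) (he₀ : 1 ≤ e₀)
    (hD : LayoutVal w A N τ D env d) (hR : CatVal w A N τ R env us.length)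
    (hI : CatVal w A N τ I env i) (hi : i ≤ N) :
    ∃ v, QueryVal w A N τ (Tm.occurs D R I) env v ∧ (v ≠ 0 ↔
      CatalyticLogspace.minWeight Y (pert (layoutWeight us τ d) i 0) <
        CatalyticLogspace.minWeight Y (fun l => layoutWeight us τ d l + 1)) := by
  have h2 := hS.one_le
  refine ⟨_, (Val.minWeight hS hF hD hR hI hi (Val.one (by omega)) he₀ he₀).sub
    (Val.minWeight hS hF hD hR hI hi Val.zero (Nat.zero_le _) he₀), ?_⟩
  rw [pert_one]; omega

/-- `Amb` for natural numbers. -/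
def AmbAt (Y : (Fin us.length → Bool) → Prop) (g : Fin us.length → ℕ) (i : ℕ) : Prop :=
  ∃ h : i < us.length, Amb Y g ⟨i, h⟩

theorem Val.amb (hS : Setting w x us A N K Y) (hF : Fits us N K e₀ d) (h2e : 2 ≤ e₀)
    (hD : LayoutVal w A N τ D env d) (hR : CatVal w A N τ R env us.length)
    (hi : i < us.length) (hI : CatVal w A N τ I env i) :
    ∃ v, QueryVal w A N τ (Tm.amb D R I) env v ∧ (v ≠ 0 ↔ AmbAt Y (layoutWeight us τ d) i) := by
  classical
  have h2 := hS.one_le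
  have hr := hS.le_length
  obtain ⟨v, hv, hv'⟩ := Val.occurs hS hF (by omega) hD hR hI (by omega)
  have h3 := ((Val.minWeight hS hF hD hR hI (by omega) ((Val.one (by omega)).succ (by omega))
    h2e (by omega)).sub (Val.minWeight hS hF hD hR hI (by omega) (Val.one (by omega)) (by omega) (by omega))).not
    (by omega)
  refine ⟨_, hv.ifz_ite hv' Val.zero h3, ?_⟩
  have h4 : AmbAt Y (layoutWeight us τ d) i ↔ Amb Y (layoutWeight us τ d) ⟨i, hi⟩ :=
    ⟨fun ⟨_, h⟩ => h, fun h => ⟨hi, h⟩⟩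
  rw [h4, amb_iff hS.exists_word, pert_one]
  simp only [Nat.sub_eq_zero_iff_le]
  split_ifs with h5 h6 <;> simp_all

open Classical in
/-- The first ambiguous index. -/
noncomputable def firstAmb (Y : (Fin us.length → Bool) → Prop) (g : Fin us.length → ℕ) : ℕ :=
  firstIdx (AmbAt Y g) us.length

theorem Val.firstAmb (hS : Setting w x us A N K Y) (hF : Fits us N K e₀ d) (h2e : 2 ≤ e₀)
    (hD : LayoutVal w A N τ D env d) (hR : CatVal w A N τ R env us.length) :
    QueryVal w A N τ (Tm.firstAmb D R) env (firstAmb Y (layoutWeight us τ d)) := by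
  classical
  have hr := hS.le_length
  refine (Val.search (p := AmbAt Y (layoutWeight us τ d)) hR.queryVal (by omega)
    fun k hk _ j => ?_).congr (by unfold CatalyticLogspace.firstAmb; congr)
  exact Val.amb hS hF h2e (hD.wk2 k j) hR.wk2 hk Val.var0

/-- Without ambiguities, index `k` belongs to the optimal word `y` iff it occurs in some optimal
word, which can be tested. Only the perturbations `e = 0, 1` are needed, whence `1 ≤ e₀` rather than
`2 ≤ e₀`. -/
theorem ev_output (hS : Setting w x us A N K Y) (hF : Fits us N K e₀ d) (he₀ : 1 ≤ e₀)
    (hD : LayoutVal w A N τ D env d) (hR : CatVal w A N τ R env us.length)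
    (h : firstAmb Y (layoutWeight us τ d) = us.length) {y : Fin us.length → Bool}
    (hy : IsMin Y (fun l => layoutWeight us τ d l + 1) y) {st : St} (hc : st.cat = τ)
    (ha : st.ask = []) :
    ev w A N (Tm.output D R) env st =
      (us.length, { st with out := st.out ++ List.ofFn y }) := by
  classical
  have hr := hS.le_length
  simp only [Tm.output, ev, hR st hc]
  let S : ℕ → St := fun k => { st with out := st.out ++ (List.ofFn y).take k }
  have key := iter_up (fun k v st => ev w A N (.seq (.out (Tm.occurs (Tm.wk2 D) (.wk 2 R) (.var 0)))
    (.succ (.var 0))) (v :: k :: env) st) (fun k => k) S us.length fun k hk j => by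
      obtain ⟨v, hv, hv'⟩ := Val.occurs hS hF he₀ (hD.wk2 k j) hR.wk2 (Val.var0 (x := k)) (by omega)
      have hna : ¬ Amb Y (layoutWeight us τ d) ⟨k, hk⟩ := fun hA =>
        not_of_lt_firstIdx (AmbAt Y (layoutWeight us τ d)) us.length (k := k)
          (by unfold firstAmb at h; convert hk) ⟨hk, hA⟩
      have h1 := hy.apply_eq_true_iff hna
      simp only at h1
      rw [← hv'] at h1
      have h2 : (v != 0) = y ⟨k, hk⟩ := by
        rw [Bool.eq_iff_iff, h1]; simp
      simp only [ev, hv (S k) ⟨hc, ha⟩, h2]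
      have h3 : min (k + 1) N = k + 1 := by omega
      simp [S, h3, List.take_add_one, hk]
  simp only [ev] at key
  have h0 : S 0 = st := by simp [S]
  rw [h0] at key
  rw [key]
  simp [S]

end Query

/-! ### Writing on the catalytic tape -/

/-- Overwrite `n` cells from position `p` on. -/
def setBits (τ : List Bool) (p : ℕ) : ℕ → (ℕ → Bool) → List Bool
  | 0, _ => τ
  | n + 1, f => (setBits τ p n f).set (p + n) (f n)

@[simp] theorem length_setBits (τ : List Bool) (p n : ℕ) (f : ℕ → Bool) :
    (setBits τ p n f).length = τ.length := by
  induction n with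
  | zero => rfl
  | succ n ih => rw [setBits, List.length_set, ih]

theorem getD_set (τ : List Bool) (p x : ℕ) (b : Bool) :
    (τ.set p b).getD x false = if x = p ∧ x < τ.length then b else τ.getD x false := by
  rw [List.getD_eq_getElem?_getD, List.getD_eq_getElem?_getD, List.getElem?_set]
  by_cases h : p = x
  · subst h
    by_cases h' : p < τ.length <;> simp [h']
  · simp [h, Ne.symm h]

theorem getD_setBits (τ : List Bool) (p n x : ℕ) (f : ℕ → Bool) :
    (setBits τ p n f).getD x false =
      if p ≤ x ∧ x < p + n ∧ x < τ.length then f (x - p) else τ.getD x false := by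
  induction n with
  | zero => rw [setBits, if_neg (by omega)]
  | succ n ih =>
    rw [setBits, getD_set, length_setBits, ih]
    by_cases h1 : x = p + n
    · subst h1
      by_cases h2 : p + n < τ.length <;> simp [h2]
    · rw [if_neg (fun h => h1 h.1)]
      exact if_congr (by omega) rfl rfl

theorem eq_of_getD {τ τ' : List Bool} (h : τ.length = τ'.length)
    (h' : ∀ x, τ.getD x false = τ'.getD x false) : τ = τ' := by
  refine List.ext_getElem h fun i h1 h2 => ?_
  have := h' i
  rwa [List.getD_eq_getElem _ _ h1, List.getD_eq_getElem _ _ h2] at this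

theorem setBits_setBits (τ : List Bool) (p n : ℕ) (f f' : ℕ → Bool) :
    setBits (setBits τ p n f) p n f' = setBits τ p n f' := by
  refine eq_of_getD (by simp) fun x => ?_
  simp only [getD_setBits, length_setBits]
  split_ifs <;> rfl

theorem setBits_self (τ : List Bool) (p n : ℕ) :
    setBits τ p n (fun q => τ.getD (p + q) false) = τ := by
  refine eq_of_getD (by simp) fun x => ?_
  rw [getD_setBits]
  split_ifs with hx
  · rw [show p + (x - p) = x by omega]
  · rfl

namespace Tm

/-- Run `t` for `0`, `1`, … below the value of `n`. -/
def loop (n t : Tm) : Tm := fold n zero (seq t (succ (var 0)))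

/-- Copy `n` cells of the catalytic tape from position `p` to position `p'`. -/
def copyCells (p p' n : Tm) : Tm :=
  loop n (wr (add (wk 2 p') (var 0)) (cat (add (wk 2 p) (var 0))))

/-- Write a number in binary into `n` cells of the catalytic tape. -/
def writeCells (p n v : Tm) : Tm :=
  loop n (wr (add (wk 2 p) (var 0)) (parity (fold (var 0) (wk 2 v) (half (var 0)))))

end Tm

section Cells

variable {w : List Bool} {A : Language Bool} {N : ℕ} {t u v : Tm} {env : List ℕ} {p p' n x : ℕ}

/-- `Val` for terms that do not depend on the state. -/
abbrev PureVal (w : List Bool) (A : Language Bool) (N : ℕ) := Val w A N (fun _ => True)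

theorem Val.catVal (τ : List Bool) (h : PureVal w A N t env x) : CatVal w A N τ t env x :=
  h.mono fun _ _ => trivial

theorem ev_wr {P : St → Prop} {y : ℕ} (ht : Val w A N P t env x) (hu : Val w A N P u env y) {st : St}
    (h : P st) : ev w A N (t.wr u) env st = (0, { st with cat := st.cat.set x (y != 0) }) := by
  simp only [ev, ht st h, hu st h]

theorem iter_inv {f : ℕ → ℕ → St → ℕ × St} (Inv : ℕ → ℕ → St → Prop) {c a : ℕ} {st : St}
    (h : ∀ k < c, ∀ i a st, Inv k a st → Inv (k + 1) (f i a st).1 (f i a st).2)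
    (h0 : Inv 0 a st) : Inv c (iter f c a st).1 (iter f c a st).2 := by
  induction c generalizing a st Inv with
  | zero => exact h0
  | succ c ih =>
    exact ih (fun k => Inv (k + 1)) (fun k hk => h (k + 1) (by omega)) (h 0 (by omega) c a st h0)

theorem ev_loop (Inv : ℕ → St → Prop) {st : St} (hu : ev w A N u env st = (n, st)) (hn : n ≤ N)
    (h : ∀ k < n, ∀ i st, Inv k st → Inv (k + 1) (ev w A N t (k :: i :: env) st).2)
    (h0 : Inv 0 st) : ∃ st', ev w A N (u.loop t) env st = (n, st') ∧ Inv n st' := by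
  have key := iter_inv (f := fun k v st => ev w A N (t.seq (.succ (.var 0))) (v :: k :: env) st)
    (fun k v st => v = k ∧ Inv k st) (c := n) (a := 0) (st := st) (by
      rintro k hk i v st ⟨rfl, h1⟩
      exact ⟨show min (v + 1) N = v + 1 by omega, h v hk i st h1⟩) ⟨rfl, h0⟩
  have e : ev w A N (u.loop t) env st =
      iter (fun k v st => ev w A N (t.seq (.succ (.var 0))) (v :: k :: env) st) n 0 st := by
    rw [Tm.loop, ev, hu]; rfl
  rw [e]
  exact ⟨_, Prod.ext key.1 rfl, key.2⟩

/-- Cells are copied in place, one by one, so source and target must be equal or disjoint; otherwise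
an overwritten cell might be read. The two are equal when the ambiguous index is `0`. -/
theorem ev_copyCells (ht : PureVal w A N t env p) (hu : PureVal w A N u env p')
    (hv : PureVal w A N v env n) (h : p = p' ∨ p + n ≤ p' ∨ p' + n ≤ p) (hN : p + n ≤ N)
    (hN' : p' + n ≤ N) (st : St) : ev w A N (Tm.copyCells t u v) env st =
      (n, { st with cat := setBits st.cat p' n fun q => st.cat.getD (p + q) false }) := by
  obtain ⟨_, h1, rfl⟩ := ev_loop (t := .wr (.add (.wk 2 u) (.var 0)) (.cat (.add (.wk 2 t) (.var 0))))
    (fun k st' => st' = { st with cat := setBits st.cat p' k fun q => st.cat.getD (p + q) false })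
    (hv st trivial) (by omega) (fun k hk i st' hst' => by
      have h2 : st'.cat.getD (p + k) false = st.cat.getD (p + k) false := by
        rw [hst', getD_setBits, if_neg (by omega)]
      rw [ev_wr (P := fun s => s.cat = st'.cat) ((hu.catVal st'.cat).wk2.add Val.var0 (by omega))
        (Val.cat (fun _ h => h) ((ht.catVal st'.cat).wk2.add Val.var0 (by omega))) rfl, h2]
      have h3 : ∀ b : Bool, (b.toNat != 0) = b := by decide
      rw [h3, hst']
      rfl) rfl
  exact h1

theorem ev_writeCells (ht : PureVal w A N t env p) (hu : PureVal w A N u env n)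
    (hv : PureVal w A N v env x) (hx : x ≤ N) (h1 : 1 ≤ N) (hN : p + n ≤ N) (st : St) :
    ev w A N (Tm.writeCells t u v) env st =
      (n, { st with cat := setBits st.cat p n x.testBit }) := by
  obtain ⟨_, h1, rfl⟩ := ev_loop (t := .wr (.add (.wk 2 t) (.var 0))
    (.parity (.fold (.var 0) (.wk 2 v) (.half (.var 0)))))
    (fun k st' => st' = { st with cat := setBits st.cat p k x.testBit })
    (hu st trivial) (by omega) (fun k hk i st' hst' => by
      have h3 : PureVal w A N (.fold (.var 0) (.wk 2 v) (.half (.var 0))) (k :: i :: env)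
          (x / 2 ^ k) := by
        refine Val.foldUp (fun j => x / 2 ^ j) Val.var0 (hv.wk2.congr (by simp)) fun j hj i' => ?_
        exact (Val.var0.half h1 ((Nat.div_le_self _ _).trans hx)).congr
          (by rw [Nat.div_div_eq_div_mul, pow_succ])
      have h5 : (x / 2 ^ k % 2 != 0) = x.testBit k := by
        rw [Nat.testBit_eq_decide_div_mod_eq]
        rcases Nat.mod_two_eq_zero_or_one (x / 2 ^ k) with h | h <;> simp [h]
      rw [ev_wr (ht.wk2.add Val.var0 (by omega)) (h3.parity h1) trivial, h5, hst']
      rfl) rfl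
  exact h1

end Cells

/-! ### Blocks of weights -/

section Blocks

variable {us : List (List Bool)} {a : ℕ}

/-- The position of the field with index `l` of the block with index `j`. -/
def addr (r a j l : ℕ) : ℕ := (j * r + l) * (a + 1)

/-- The layout of the block with index `j`. -/
def blockLayout (r S a j : ℕ) : Layout ℕ := ⟨S, addr r a j 0, a + 1, a + 1⟩

/-- The layout of the weights in the last bits of the first fields of the blocks. -/
def freeLayout (r S a : ℕ) : Layout ℕ := ⟨S, a, r * (a + 1), 1⟩

/-- Uniqueness of mixed-radix digits, with `q` taken modulo `a + 1` and `l` modulo `r`. -/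
theorem addr_inj {r j l q j' l' q' : ℕ} (hl : l < r) (hl' : l' < r) (hq : q < a + 1)
    (hq' : q' < a + 1) (h : addr r a j l + q = addr r a j' l' + q') : j = j' ∧ l = l' ∧ q = q' := by
  unfold addr at h
  have h1 : q = q' := by
    have := congrArg (· % (a + 1)) h
    simpa [Nat.mul_add_mod', Nat.mod_eq_of_lt hq, Nat.mod_eq_of_lt hq'] using this
  subst h1
  have h2 : j * r + l = j' * r + l' := Nat.eq_of_mul_eq_mul_right (Nat.succ_pos a)
    (by simpa using h : (j * r + l) * (a + 1) = (j' * r + l') * (a + 1))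
  have h3 : l = l' := by
    have := congrArg (· % r) h2
    simpa [Nat.mul_add_mod', Nat.mod_eq_of_lt hl, Nat.mod_eq_of_lt hl'] using this
  subst h3
  exact ⟨Nat.eq_of_mul_eq_mul_right (by omega) (by omega : j * r = j' * r), rfl, rfl⟩

theorem addr_add_le {r j l : ℕ} (hj : j < r) (hl : l < r) :
    addr r a j l + (a + 1) ≤ r * r * (a + 1) := by
  have h1 : j * r + l + 1 ≤ r * r := by
    calc j * r + l + 1 ≤ j * r + r := by omega
      _ = (j + 1) * r := by ring
      _ ≤ r * r := Nat.mul_le_mul_right r hj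
  calc addr r a j l + (a + 1) = (j * r + l + 1) * (a + 1) := by unfold addr; ring
    _ ≤ _ := Nat.mul_le_mul_right _ h1

theorem exists_addr {r x : ℕ} (hx : x < r * r * (a + 1)) :
    ∃ j < r, ∃ l < r, ∃ q < a + 1, x = addr r a j l + q := by
  have h1 : x / (a + 1) < r * r := (Nat.div_lt_iff_lt_mul (Nat.succ_pos a)).2 hx
  have hr : 0 < r := by
    rcases Nat.eq_zero_or_pos r with rfl | h
    · simp at h1
    · exact h
  refine ⟨x / (a + 1) / r, Nat.div_lt_of_lt_mul h1, x / (a + 1) % r, Nat.mod_lt _ hr, x % (a + 1),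
    Nat.mod_lt _ (Nat.succ_pos a), ?_⟩
  rw [addr, Nat.div_add_mod', Nat.div_add_mod']

theorem getD_setBits_addr {r : ℕ} {τ : List Bool} (hτ : r * r * (a + 1) ≤ τ.length) {j l q j' l' : ℕ}
    (hj : j < r) (hl : l < r) (hl' : l' < r) (hq : q < a + 1) (f : ℕ → Bool) :
    (setBits τ (addr r a j' l') (a + 1) f).getD (addr r a j l + q) false =
      if j = j' ∧ l = l' then f q else τ.getD (addr r a j l + q) false := by
  rw [getD_setBits]
  have h1 := addr_add_le (a := a) hj hl
  by_cases h : j = j' ∧ l = l'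
  · obtain ⟨rfl, rfl⟩ := h
    rw [if_pos (by omega), if_pos ⟨rfl, rfl⟩, Nat.add_sub_cancel_left]
  · rw [if_neg h, if_neg]
    rintro ⟨h2, h3, -⟩
    obtain ⟨rfl, rfl, -⟩ := addr_inj (q' := addr r a j l + q - addr r a j' l') hl hl' hq
      (by omega) (by omega : addr r a j l + q = addr r a j' l' + (addr r a j l + q - addr r a j' l'))
    exact h ⟨rfl, rfl⟩

theorem layoutWeight_block {S j : ℕ} (τ : List Bool) (l : Fin us.length) :
    layoutWeight us τ (blockLayout us.length S a j) l =
      inputWeight us l * S + field τ (addr us.length a j l) (a + 1) := by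
  simp only [layoutWeight, blockLayout, addr]
  congr 2; ring

theorem layoutWeight_free {S : ℕ} (τ : List Bool) (l : Fin us.length) :
    layoutWeight us τ (freeLayout us.length S a) l =
      inputWeight us l * S + (τ.getD (addr us.length a l 0 + a) false).toNat := by
  simp only [layoutWeight, freeLayout, addr, field]
  rw [show a + (l : ℕ) * (us.length * (a + 1)) = (l * us.length + 0) * (a + 1) + a by ring]
  simp

variable (us a) in
/-- The fields of block `j` are the same on both tapes. -/
def SameBlock (τ c : List Bool) (j : ℕ) : Prop :=
  ∀ l < us.length, ∀ q < a + 1,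
    c.getD (addr us.length a j l + q) false = τ.getD (addr us.length a j l + q) false

variable (Y : (Fin us.length → Bool) → Prop) (S : ℕ)

/-- The first ambiguous index of block `j`. -/
noncomputable def blockAmb (a : ℕ) (τ : List Bool) (j : ℕ) : ℕ :=
  firstAmb Y (layoutWeight us τ (blockLayout us.length S a j))

/-- The tape `c` has block `j` of `τ` in compressed form: the first field has been moved to the
field of the first ambiguous index, and replaced by this index. -/
structure Packed (a : ℕ) (τ c : List Bool) (j : ℕ) : Prop where
  index : ∀ q < a, c.getD (addr us.length a j 0 + q) false = (blockAmb Y S a τ j).testBit q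
  moved : blockAmb Y S a τ j ≠ 0 → ∀ q < a + 1,
    c.getD (addr us.length a j (blockAmb Y S a τ j) + q) false =
      τ.getD (addr us.length a j 0 + q) false
  same : ∀ l < us.length, l ≠ 0 → l ≠ blockAmb Y S a τ j → ∀ q < a + 1,
    c.getD (addr us.length a j l + q) false = τ.getD (addr us.length a j l + q) false

/-- The tape `c` is `τ`, with the blocks in `J` compressed. -/
structure Partly (a : ℕ) (τ c : List Bool) (J : ℕ → Prop) : Prop where
  length_eq : c.length = τ.length
  rest : ∀ x, us.length * us.length * (a + 1) ≤ x → c.getD x false = τ.getD x false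
  packed : ∀ j < us.length, J j → Packed Y S a τ c j
  same : ∀ j < us.length, ¬ J j → SameBlock us a τ c j

variable {Y S}

theorem SameBlock.layoutWeight_eq {τ c : List Bool} {j : ℕ} (h : SameBlock us a τ c j) :
    layoutWeight us c (blockLayout us.length S a j) =
      layoutWeight us τ (blockLayout us.length S a j) := by
  funext l
  rw [layoutWeight_block, layoutWeight_block, field_congr (h l l.2)]

/-- The condition `l ≠ 0 ∨ q ≠ a` spares exactly the free bit, on which `Packed` puts no constraint.
Hence compressed blocks remain valid while the free bits are being used. -/
theorem Packed.congr {τ c c' : List Bool} {j : ℕ} (h : Packed Y S a τ c j)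
    (hi : blockAmb Y S a τ j < us.length)
    (hc : ∀ l < us.length, ∀ q < a + 1, (l ≠ 0 ∨ q ≠ a) →
      c'.getD (addr us.length a j l + q) false = c.getD (addr us.length a j l + q) false) :
    Packed Y S a τ c' j where
  index q hq := (hc 0 (by omega) q (by omega) (by omega)).trans (h.index q hq)
  moved h0 q hq := (hc _ hi q hq (by omega)).trans (h.moved h0 q hq)
  same l hl h0 h1 q hq := (hc l hl q hq (by omega)).trans (h.same l hl h0 h1 q hq)

theorem Partly.eq {τ c : List Bool} (h : Partly Y S a τ c fun _ => False) : c = τ := by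
  refine eq_of_getD h.length_eq fun x => ?_
  by_cases hx : x < us.length * us.length * (a + 1)
  · obtain ⟨j, hj, l, hl, q, hq, rfl⟩ := exists_addr hx
    exact h.same j hj not_false l hl q hq
  · exact h.rest x (by omega)

/-- Compression of a block. -/
theorem Partly.compress {τ c : List Bool} {k : ℕ} (h : Partly Y S a τ c (· < k))
    (hk : k < us.length) (hτ : us.length * us.length * (a + 1) ≤ τ.length)
    (ha : us.length ≤ 2 ^ a) (hi : ∀ j < us.length, blockAmb Y S a τ j < us.length) :
    let c' := setBits (setBits c (addr us.length a k (blockAmb Y S a τ k)) (a + 1)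
      fun q => c.getD (addr us.length a k 0 + q) false) (addr us.length a k 0) (a + 1)
      (blockAmb Y S a τ k + 2 ^ a).testBit
    Partly Y S a τ c' (· < k + 1) ∧
      ∀ j < us.length, c'.getD (addr us.length a j 0 + a) false =
        if j = k then true else c.getD (addr us.length a j 0 + a) false := by
  intro c'
  have hik := hi k hk
  set i := blockAmb Y S a τ k with hi'
  have hlen := h.length_eq
  have h0 : 0 < us.length := by omega
  have hc : ∀ j < us.length, ∀ l < us.length, ∀ q < a + 1,
      c'.getD (addr us.length a j l + q) false =
        if j = k ∧ l = 0 then (i + 2 ^ a).testBit q else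
          if j = k ∧ l = i then c.getD (addr us.length a k 0 + q) false
          else c.getD (addr us.length a j l + q) false := by
    intro j hj l hl q hq
    rw [getD_setBits_addr (by simpa [hlen] using hτ) hj hl h0 hq,
      getD_setBits_addr (by simpa [hlen] using hτ) hj hl hik hq]
  have hs := h.same k hk (lt_irrefl k)
  -- Adding `2 ^ a` does not affect the `a` bits of the index; as the index is below `2 ^ a`, it
  -- sets the free bit to one.
  have hbit : ∀ q < a, (i + 2 ^ a).testBit q = i.testBit q := by
    intro q hq
    rw [add_comm, Nat.testBit_two_pow_add_gt hq]
  refine ⟨⟨by simp [c', hlen], fun x hx => ?_, fun j hj hjk => ?_, fun j hj hjk => ?_⟩,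
    fun j hj => ?_⟩
  · have h1 := addr_add_le (a := a) hk (hi k hk)
    have h2 := addr_add_le (a := a) hk h0
    rw [getD_setBits, if_neg (by omega), getD_setBits, if_neg (by omega), h.rest x hx]
  · rcases Nat.lt_succ_iff_lt_or_eq.1 hjk with hjk | rfl
    · have hj' := h.packed j hj hjk
      constructor
      · intro q hq
        rw [hc j hj 0 h0 q (by omega), if_neg (by omega), if_neg (by omega), hj'.index q hq]
      · intro hne q hq
        rw [hc j hj _ (hi j hj) q hq, if_neg (by omega), if_neg (by omega), hj'.moved hne q hq]
      · intro l hl hl0 hl1 q hq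
        rw [hc j hj l hl q hq, if_neg (by omega), if_neg (by omega), hj'.same l hl hl0 hl1 q hq]
    · constructor
      · intro q hq
        rw [hc j hj 0 h0 q (by omega), if_pos ⟨rfl, rfl⟩, hbit q hq]
      · intro hne q hq
        rw [← hi', hc j hj i hik q hq, if_neg (by omega), if_pos ⟨rfl, rfl⟩, hs 0 h0 q hq]
      · intro l hl hl0 hl1 q hq
        rw [hc j hj l hl q hq, if_neg (by omega), if_neg (by omega), hs l hl q hq]
  · intro l hl q hq
    have hjk' : ¬ j < k + 1 := hjk
    rw [hc j hj l hl q hq, if_neg (by omega), if_neg (by omega),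
      h.same j hj (by omega) l hl q hq]
  · rw [hc j hj 0 h0 a (by omega)]
    by_cases hjk : j = k
    · subst hjk
      rw [if_pos ⟨rfl, rfl⟩, if_pos rfl, add_comm, Nat.testBit_two_pow_add_eq,
        Nat.testBit_lt_two_pow (lt_of_lt_of_le hik ha)]
      rfl
    · rw [if_neg (by omega), if_neg (by omega), if_neg hjk]

/-- The index can be read off a compressed block. -/
theorem Packed.field_eq {τ c : List Bool} {j : ℕ} (h : Packed Y S a τ c j)
    (ha : us.length ≤ 2 ^ a) (hi : blockAmb Y S a τ j < us.length) :
    field c (addr us.length a j 0) a = blockAmb Y S a τ j := by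
  refine Nat.eq_of_testBit_eq fun q => ?_
  rw [testBit_field]
  by_cases hq : q < a
  · rw [h.index q hq]; simp [hq]
  · rw [Nat.testBit_lt_two_pow (lt_of_lt_of_le (hi.trans_le ha)
      (Nat.pow_le_pow_right two_pos (by omega : a ≤ q)))]
    simp [hq]

/-- Decompression of a block, up to the field of the ambiguous index. -/
theorem Packed.unmove {τ c : List Bool} {j : ℕ} (h : Packed Y S a τ c j) (hj : j < us.length)
    (hc : us.length * us.length * (a + 1) ≤ c.length)
    (hi : blockAmb Y S a τ j < us.length) (f : ℕ → Bool) {l q : ℕ} (hl : l < us.length)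
    (hq : q < a + 1) :
    (setBits (setBits c (addr us.length a j 0) (a + 1)
      fun q => c.getD (addr us.length a j (blockAmb Y S a τ j) + q) false)
      (addr us.length a j (blockAmb Y S a τ j)) (a + 1) f).getD (addr us.length a j l + q) false =
    if l = blockAmb Y S a τ j then f q else τ.getD (addr us.length a j l + q) false := by
  rw [getD_setBits_addr (by simpa using hc) hj hl hi hq,
    getD_setBits_addr hc hj hl (by omega) hq]
  by_cases h1 : l = blockAmb Y S a τ j
  · rw [if_pos ⟨rfl, h1⟩, if_pos h1]
  · rw [if_neg (by omega), if_neg h1]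
    by_cases h2 : l = 0
    · subst h2
      rw [if_pos ⟨rfl, rfl⟩, h.moved (Ne.symm h1) q hq]
    · rw [if_neg (by omega), h.same l hl h2 h1 q hq]

/-- The field of the ambiguous index is determined by the others. -/
theorem Packed.ambAt_iff {τ c : List Bool} {j : ℕ} (h : Packed Y S a τ c j) (hj : j < us.length)
    (hc : us.length * us.length * (a + 1) ≤ c.length)
    (hi : blockAmb Y S a τ j < us.length) {v : ℕ} (hv : v < 2 ^ (a + 1)) :
    AmbAt Y (layoutWeight us (setBits (setBits c (addr us.length a j 0) (a + 1)
      fun q => c.getD (addr us.length a j (blockAmb Y S a τ j) + q) false)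
      (addr us.length a j (blockAmb Y S a τ j)) (a + 1) v.testBit)
      (blockLayout us.length S a j)) (blockAmb Y S a τ j) ↔
    v = field τ (addr us.length a j (blockAmb Y S a τ j)) (a + 1) := by
  classical
  set i := blockAmb Y S a τ j with hi'
  set c' := setBits (setBits c (addr us.length a j 0) (a + 1)
      fun q => c.getD (addr us.length a j i + q) false)
      (addr us.length a j i) (a + 1) v.testBit
  have hget : ∀ l < us.length, ∀ q < a + 1, c'.getD (addr us.length a j l + q) false =
      if l = i then v.testBit q else τ.getD (addr us.length a j l + q) false :=
    fun l hl q hq => h.unmove hj hc hi v.testBit hl hq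
  -- In a compressible block the first ambiguous index is smaller than the number of indices, so the
  -- search for it has succeeded and the index is ambiguous for the original tape.
  have hamb : Amb Y (layoutWeight us τ (blockLayout us.length S a j)) ⟨i, hi⟩ := by
    obtain ⟨_, h⟩ : AmbAt Y (layoutWeight us τ (blockLayout us.length S a j)) i := by
      rw [hi', blockAmb, firstAmb]
      exact firstIdx_spec _ _ (by rw [hi', blockAmb, firstAmb] at hi; exact hi)
    exact h
  have hne : ∀ l : Fin us.length, l ≠ ⟨i, hi⟩ →
      layoutWeight us c' (blockLayout us.length S a j) l =
        layoutWeight us τ (blockLayout us.length S a j) l := by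
    intro l hl
    rw [layoutWeight_block, layoutWeight_block, field_congr fun q hq => ?_]
    rw [hget l l.2 q hq, if_neg fun e => hl (Fin.ext e)]
  have hfv : field c' (addr us.length a j i) (a + 1) = v := by
    refine Nat.eq_of_testBit_eq fun q => ?_
    rw [testBit_field]
    by_cases hq : q < a + 1
    · rw [hget i hi q hq]; simp [hq]
    · rw [Nat.testBit_lt_two_pow (hv.trans_le (Nat.pow_le_pow_right two_pos (by omega : a + 1 ≤ q)))]
      simp [hq]
  constructor
  -- Both tapes make `i` ambiguous and agree at all other indices, so uniqueness applies.
  · rintro ⟨_, h'⟩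
    have := h'.unique hamb hne
    rw [layoutWeight_block, layoutWeight_block, hfv] at this
    exact Nat.add_left_cancel this
  · intro hv'
    refine ⟨hi, ?_⟩
    have : layoutWeight us c' (blockLayout us.length S a j) =
        layoutWeight us τ (blockLayout us.length S a j) := by
      funext l
      by_cases hl : l = ⟨i, hi⟩
      · subst hl
        rw [layoutWeight_block, layoutWeight_block, hfv, hv']
      · exact hne l hl
    rw [this]; exact hamb

/-- Decompression of a block. -/
theorem Partly.decompress {τ c : List Bool} {k : ℕ} (h : Partly Y S a τ c (k ≤ ·))
    (hk : k < us.length) (hτ : us.length * us.length * (a + 1) ≤ τ.length)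
    (hi : ∀ j < us.length, blockAmb Y S a τ j < us.length) :
    Partly Y S a τ (setBits (setBits c (addr us.length a k 0) (a + 1)
      fun q => c.getD (addr us.length a k (blockAmb Y S a τ k) + q) false)
      (addr us.length a k (blockAmb Y S a τ k)) (a + 1)
      (field τ (addr us.length a k (blockAmb Y S a τ k)) (a + 1)).testBit) (k + 1 ≤ ·) := by
  set c' := setBits (setBits c (addr us.length a k 0) (a + 1)
      fun q => c.getD (addr us.length a k (blockAmb Y S a τ k) + q) false)
      (addr us.length a k (blockAmb Y S a τ k)) (a + 1)
      (field τ (addr us.length a k (blockAmb Y S a τ k)) (a + 1)).testBit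
  have hlen := h.length_eq
  have hc : us.length * us.length * (a + 1) ≤ c.length := by omega
  have h0 : 0 < us.length := by omega
  have hother : ∀ j < us.length, j ≠ k → ∀ l < us.length, ∀ q < a + 1,
      c'.getD (addr us.length a j l + q) false = c.getD (addr us.length a j l + q) false := by
    intro j hj hjk l hl q hq
    rw [getD_setBits_addr (by simpa using hc) hj hl (hi k hk) hq,
      getD_setBits_addr hc hj hl h0 hq, if_neg (by omega), if_neg (by omega)]
  refine ⟨by simp [c', hlen], fun x hx => ?_, fun j hj hjk => ?_, fun j hj hjk => ?_⟩
  · have h1 := addr_add_le (a := a) hk (hi k hk)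
    have h2 := addr_add_le (a := a) hk h0
    rw [getD_setBits, if_neg (by omega), getD_setBits, if_neg (by omega), h.rest x hx]
  · have hjk' : k + 1 ≤ j := hjk
    exact (h.packed j hj (by omega)).congr (hi j hj)
      fun l hl q hq _ => hother j hj (by omega) l hl q hq
  · intro l hl q hq
    by_cases hjk' : j = k
    · subst hjk'
      rw [(h.packed j hj le_rfl).unmove hj hc (hi j hj) _ hl hq]
      split_ifs with h1
      · rw [testBit_field, ← h1]; simp [hq]
      · rfl
    · rw [hother j hj hjk' l hl q hq, h.same j hj (by omega) l hl q hq]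

end Blocks

/-! ### The main part of the program -/

/-- Terms for the number of weights, for the width of a field without its last bit, and for the
scaling factor. -/
structure Params where
  r : Tm
  a : Tm
  S : Tm

def Params.weaken (k : ℕ) (T : Params) : Params := ⟨.wk k T.r, .wk k T.a, .wk k T.S⟩

/-- The position of field `l` of block `j`. -/
def Params.addr (T : Params) (j l : Tm) : Tm := .mul (.add (.mul j T.r) l) (.succ T.a)

def Params.block (T : Params) (j : Tm) : Layout Tm :=
  ⟨T.S, T.addr j .zero, .succ T.a, .succ T.a⟩

def Params.free (T : Params) : Layout Tm := ⟨T.S, T.a, .mul T.r (.succ T.a), .one⟩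

namespace Tm

/-- Compress block `j`, with first ambiguous index `i`. -/
def compressAt (T : Params) (j i : Tm) : Tm :=
  seq (copyCells (T.addr j zero) (T.addr j i) (succ T.a))
    (writeCells (T.addr j zero) (succ T.a) (add i (pow2 T.a)))

/-- Compress all blocks. -/
def compress (T : Params) : Tm :=
  loop T.r (bind (firstAmb ((T.weaken 2).block (var 0)) (T.weaken 2).r)
    (compressAt ((T.weaken 2).weaken 1) (var 1) (var 0)))

/-- Decompress block `j`, with first ambiguous index `i`. -/
def decompressAt (T : Params) (j i : Tm) : Tm :=
  seq (copyCells (T.addr j i) (T.addr j zero) (succ T.a))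
    (fold top zero (seq (writeCells ((T.weaken 2).addr (wk 2 j) (wk 2 i)) (succ (T.weaken 2).a) (var 0))
      (ifz (amb ((T.weaken 2).block (wk 2 j)) (T.weaken 2).r (wk 2 i)) (succ (var 0)) (var 0))))

/-- Decompress all blocks. -/
def decompress (T : Params) : Tm :=
  loop T.r (bind (field ((T.weaken 2).addr (var 0) zero) (T.weaken 2).a)
    (decompressAt ((T.weaken 2).weaken 1) (var 1) (var 0)))

/-- Remove all ambiguities by decreasing weights. -/
def isolate (T : Params) : Tm :=
  loop T.r (ifz (occurs (T.weaken 2).free (T.weaken 2).r (var 0)) zero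
    (wr (add ((T.weaken 2).addr (var 0) zero) (T.weaken 2).a) zero))

/-- Write a witness of minimum weight. -/
def minWitness (T : Params) : Tm :=
  bind (search T.r (not (sub (T.weaken 2).r (firstAmb ((T.weaken 2).block (var 0)) (T.weaken 2).r))))
    (ifz (sub (T.weaken 1).r (var 0))
      (wk 1 (seq (compress T) (seq (isolate T) (seq (output T.free T.r) (decompress T)))))
      (output ((T.weaken 1).block (var 0)) (T.weaken 1).r))

end Tm

/-- The values of the parameters. -/
structure ParamsVal (w : List Bool) (A : Language Bool) (N : ℕ) (T : Params) (env : List ℕ)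
    (r a S : ℕ) : Prop where
  r : PureVal w A N T.r env r
  a : PureVal w A N T.a env a
  S : PureVal w A N T.S env S

/-- The bounds on the parameters. -/
structure Sized (us : List (List Bool)) (N K n a S : ℕ) : Prop where
  length_le : us.length ≤ 2 ^ a
  tape_le : us.length * us.length * (a + 1) ≤ n
  pos_le : (us.length * us.length + 1) * (a + 1) ≤ N
  weight_le : ∀ l, inputWeight us l * S + 2 ^ (a + 1) + 1 ≤ K
  scale : us.length * 2 ^ (a + 1) < S

/-! ### Correctness of compression, isolation and restoration. -/

section Main

variable {w x : List Bool} {us : List (List Bool)} {A : Language Bool} {N K : ℕ}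
  {Y : (Fin us.length → Bool) → Prop} {τ c : List Bool} {T : Params} {J L : Tm}
  {env : List ℕ} {a S j l n : ℕ}

theorem ParamsVal.wk1 {r : ℕ} (h : ParamsVal w A N T env r a S) (x : ℕ) :
    ParamsVal w A N (T.weaken 1) (x :: env) r a S :=
  ⟨h.r.wk1, h.a.wk1, h.S.wk1⟩

theorem ParamsVal.wk2 {r : ℕ} (h : ParamsVal w A N T env r a S) (x y : ℕ) :
    ParamsVal w A N (T.weaken 2) (x :: y :: env) r a S :=
  ⟨h.r.wk2, h.a.wk2, h.S.wk2⟩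

theorem Sized.addr_le (hZ : Sized us N K n a S) (hj : j < us.length) (hl : l < us.length) :
    addr us.length a j l + (a + 1) ≤ N := by
  have h1 := addr_add_le (a := a) hj hl
  have h2 := hZ.pos_le
  rw [add_mul] at h2
  omega

theorem Val.addr (hZ : Sized us N K n a S) (hT : ParamsVal w A N T env us.length a S)
    (hj : j < us.length) (hl : l < us.length) (hJ : PureVal w A N J env j)
    (hL : PureVal w A N L env l) :
    PureVal w A N (T.addr J L) env (addr us.length a j l) := by
  have h1 := hZ.addr_le hj hl
  have h2 : j * us.length + l ≤ CatalyticLogspace.addr us.length a j l :=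
    Nat.le_mul_of_pos_right _ (Nat.succ_pos a)
  exact ((hJ.mul hT.r (by omega)).add hL (by omega)).mul (hT.a.succ (by omega))
    (by unfold CatalyticLogspace.addr at h1; omega)

theorem Sized.block_val (hZ : Sized us N K n a S) (hT : ParamsVal w A N T env us.length a S)
    (hj : j < us.length) (hJ : PureVal w A N J env j) (τ : List Bool) :
    LayoutVal w A N τ (T.block J) env (blockLayout us.length S a j) := by
  have h1 := hZ.addr_le hj (by omega : 0 < us.length)
  exact ⟨hT.S.catVal τ, (Val.addr hZ hT hj (by omega) hJ Val.zero).catVal τ,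
    (hT.a.succ (by omega)).catVal τ, (hT.a.succ (by omega)).catVal τ⟩

theorem Sized.free_val (hS : Setting w x us A N K Y) (hZ : Sized us N K n a S)
    (hT : ParamsVal w A N T env us.length a S) (τ : List Bool) :
    LayoutVal w A N τ T.free env (freeLayout us.length S a) := by
  have h1 := hZ.pos_le
  have h2 := hS.one_le
  have h3 : us.length * (a + 1) ≤ us.length * us.length * (a + 1) :=
    Nat.mul_le_mul_right _ (Nat.le_mul_self _)
  rw [add_mul] at h1
  exact ⟨hT.S.catVal τ, hT.a.catVal τ,
    (hT.r.mul (hT.a.succ (by omega)) (by omega)).catVal τ, Val.one (by omega)⟩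

theorem Sized.block_fits (hZ : Sized us N K n a S) (hj : j < us.length) :
    Fits us N K 2 (blockLayout us.length S a j) where
  weight_le l := by have := hZ.weight_le l; simp only [blockLayout]; omega
  pos_le := by
    have h1 := addr_add_le (a := a) hj (by omega : us.length - 1 < us.length)
    have h2 := hZ.pos_le
    have h3 : addr us.length a j (us.length - 1) + (a + 1) =
        addr us.length a j 0 + us.length * (a + 1) := by
      obtain ⟨m, hm⟩ : ∃ m, us.length = m + 1 := ⟨us.length - 1, by omega⟩
      simp only [addr, hm, Nat.add_sub_cancel]; ring
    rw [add_mul] at h2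
    simp only [blockLayout]; omega

theorem Sized.free_fits (hZ : Sized us N K n a S) : Fits us N K 2 (freeLayout us.length S a) where
  weight_le l := by
    have h1 := hZ.weight_le l
    have h2 : 2 ^ 1 ≤ 2 ^ (a + 1) := Nat.pow_le_pow_right two_pos (by omega)
    simp only [freeLayout]; omega
  pos_le := by
    have h2 := hZ.pos_le
    rw [add_mul, mul_assoc] at h2
    simp only [freeLayout]; omega

theorem Sized.pow_le (hS : Setting w x us A N K Y) (hZ : Sized us N K n a S) (hj : j < us.length) :
    2 ^ (a + 1) + 1 ≤ N := by
  have h1 := hS.le_of_fin ⟨j, hj⟩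
  have h2 := hZ.weight_le ⟨j, hj⟩
  omega

/-- The side condition of `ev_copyCells` for moves between the first field and another field of a
block. -/
theorem addr_sep (r a j l : ℕ) :
    addr r a j 0 = addr r a j l ∨ addr r a j 0 + (a + 1) ≤ addr r a j l := by
  rcases Nat.eq_zero_or_pos l with rfl | h
  · exact .inl rfl
  · right
    have h1 : 1 * (a + 1) ≤ l * (a + 1) := Nat.mul_le_mul_right _ h
    unfold addr
    rw [add_mul, add_mul]
    omega

theorem Partly.mono {J J' : ℕ → Prop} (h : Partly Y S a τ c J)
    (hJ : ∀ j < us.length, J j ↔ J' j) : Partly Y S a τ c J' :=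
  ⟨h.length_eq, h.rest, fun j hj hj' => h.packed j hj ((hJ j hj).2 hj'),
    fun j hj hj' => h.same j hj (mt (hJ j hj).1 hj')⟩

theorem SameBlock.refl (τ : List Bool) (j : ℕ) : SameBlock us a τ τ j := fun _ _ _ _ => rfl

theorem Partly.refl (τ : List Bool) : Partly Y S a τ τ fun _ => False :=
  ⟨rfl, fun _ _ => rfl, fun _ _ h => h.elim, fun j _ _ => SameBlock.refl τ j⟩

theorem ev_bind {t u : Tm} {st : St} {v : ℕ} (h : ev w A N t env st = (v, st)) :
    ev w A N (t.bind u) env st = ev w A N u (v :: env) st := by rw [ev, h]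

/-- Blocks do not overlap, so block `k` still has its original contents when its turn comes, and the
index found is that of the original tape. -/
theorem ev_compress (hS : Setting w x us A N K Y) (hZ : Sized us N K τ.length a S)
    (hT : ParamsVal w A N T env us.length a S)
    (hi : ∀ j < us.length, blockAmb Y S a τ j < us.length) {st : St} (hc : st.cat = τ)
    (ha : st.ask = []) :
    ∃ c v, ev w A N (Tm.compress T) env st = (v, { st with cat := c }) ∧
      Partly Y S a τ c (fun _ => True) ∧
      ∀ j < us.length, c.getD (addr us.length a j 0 + a) false = true := by
  have hr := hS.le_length
  obtain ⟨st', h1, c, rfl, h2, h3⟩ := ev_loop (fun k st' => ∃ c, st' = { st with cat := c } ∧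
    Partly Y S a τ c (· < k) ∧ ∀ j < k, c.getD (addr us.length a j 0 + a) false = true)
    (hT.r st trivial) (by omega) (t := .bind (.firstAmb ((T.weaken 2).block (.var 0)) (T.weaken 2).r)
    (.compressAt ((T.weaken 2).weaken 1) (.var 1) (.var 0))) (by
      rintro k hk i _ ⟨c, rfl, h2, h3⟩
      have hT' := hT.wk2 k i
      have h0 := Val.firstAmb hS (hZ.block_fits hk) le_rfl (hZ.block_val hT' hk Val.var0 c)
        (hT'.r.catVal c) { st with cat := c } ⟨rfl, ha⟩
      rw [(h2.same k hk (lt_irrefl k)).layoutWeight_eq] at h0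
      change _ = (blockAmb Y S a τ k, _) at h0
      have hik := hi k hk
      have hpow := hZ.pow_le hS hk
      rw [pow_succ] at hpow
      have hlen := hZ.length_le
      have h4 := hZ.addr_le hk hik
      have h5 := hZ.addr_le hk (by omega : 0 < us.length)
      have h6 := h2.compress hk hZ.tape_le hZ.length_le hi
      have hT'' := hT'.wk1 (blockAmb Y S a τ k)
      have v0 := Val.addr hZ hT'' hk (by omega) Val.var1 Val.zero
      have v1 := Val.addr hZ hT'' hk hik Val.var1 Val.var0
      have vb := hT''.a.succ (by omega)
      rw [ev_bind h0, Tm.compressAt, ev_seq, ev_copyCells v0 v1 vb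
        (by have := addr_sep us.length a k (blockAmb Y S a τ k); omega) (by omega) (by omega),
        ev_writeCells v0 vb (Val.var0.add (hT''.a.pow2 (by omega)) (by omega)) (by omega)
          (by omega) (by omega)]
      refine ⟨_, rfl, h6.1, fun j hj => ?_⟩
      rw [h6.2 j (by omega)]
      split_ifs with h7
      · rfl
      · exact h3 j (by omega))
    ⟨τ, by rw [← hc], (Partly.refl τ).mono (by simp), by simp⟩
  exact ⟨c, _, h1, h2.mono fun j hj => by simpa using hj, h3⟩

/-- Candidates for the lost field are written on the tape and tested by ambiguity of `i`. By
`Packed.ambAt_iff` the test succeeds at the original value and nowhere else. -/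
theorem ev_decompressAt (hS : Setting w x us A N K Y) (hZ : Sized us N K τ.length a S)
    (hT : ParamsVal w A N T env us.length a S) (hj : j < us.length)
    (hi : blockAmb Y S a τ j < us.length) (h : Packed Y S a τ c j) (hl : c.length = τ.length)
    (hJ : PureVal w A N J env j) (hL : PureVal w A N L env (blockAmb Y S a τ j))
    {st : St} (hc : st.cat = c) (ha : st.ask = []) :
    (ev w A N (Tm.decompressAt T J L) env st).2 = { st with cat := (
      setBits (setBits c (addr us.length a j 0) (a + 1)
      fun q => c.getD (addr us.length a j (blockAmb Y S a τ j) + q) false)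
      (addr us.length a j (blockAmb Y S a τ j)) (a + 1)
      (field τ (addr us.length a j (blockAmb Y S a τ j)) (a + 1)).testBit) } := by
  have hr := hS.le_length
  have hpow := hZ.pow_le hS hj
  have h4 := hZ.addr_le hj hi
  have h5 := hZ.addr_le hj (by omega : 0 < us.length)
  have v0 := Val.addr hZ hT hj (by omega) hJ Val.zero
  have v1 := Val.addr hZ hT hj hi hJ hL
  have vb := hT.a.succ (by omega)
  have htape := hZ.tape_le
  rw [← hl] at htape
  set p := addr us.length a j (blockAmb Y S a τ j) with hp
  have hflt := field_lt τ p (a + 1)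
  set v := field τ p (a + 1) with hv
  rw [Tm.decompressAt, ev_seq, ev_copyCells v1 v0 vb
    (by have := addr_sep us.length a j (blockAmb Y S a τ j); omega) (by omega) (by omega), hc]
  set c₁ := setBits c (addr us.length a j 0) (a + 1) fun q => c.getD (p + q) false with hc₁
  have key := iter_inv (f := fun k v st => ev w A N (.seq
    (.writeCells ((T.weaken 2).addr (.wk 2 J) (.wk 2 L)) (.succ (T.weaken 2).a) (.var 0))
      (.ifz (.amb ((T.weaken 2).block (.wk 2 J)) (T.weaken 2).r (.wk 2 L))
        (.succ (.var 0)) (.var 0))) (v :: k :: env) st)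
    -- The candidate advances up to the true value `v` and then stays there. From round `v + 1` on,
    -- the last value written is `v`; since `v < N`, the `N` rounds suffice.
    (fun k b st' => b = min k v ∧ ∃ f, st' = { st with cat := setBits c₁ p (a + 1) f } ∧
      (v < k → f = v.testBit)) (c := N) (a := 0) (st := { st with cat := c₁ }) (by
        rintro k hk i b _ ⟨hb, f, rfl, hf⟩
        have hT' := hT.wk2 b i
        have h1 := ev_writeCells (Val.addr hZ hT' hj hi hJ.wk2 hL.wk2) (hT'.a.succ (by omega))
          (Val.var0 (x := b)) (by omega) (by omega) (by omega)
          { st with cat := setBits c₁ p (a + 1) f }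
        simp only [setBits_setBits, ← hp] at h1
        obtain ⟨m, hm, hm'⟩ := Val.amb hS (hZ.block_fits hj) le_rfl
          (hZ.block_val hT' hj hJ.wk2 (setBits c₁ p (a + 1) b.testBit)) (hT'.r.catVal _) hi
          (hL.wk2.catVal _)
        have h2 := h.ambAt_iff hj htape hi (v := b) (by omega)
        rw [← hp, ← hc₁, ← hv] at h2
        rw [h2] at hm'
        have h3 := hm { st with cat := setBits c₁ p (a + 1) b.testBit } ⟨rfl, ha⟩
        change ev w A N (.writeCells ((T.weaken 2).addr (.wk 2 J) (.wk 2 L))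
          (.succ (T.weaken 2).a) (.var 0)) (b :: i :: env) _ = _ at h1
        change ev w A N (.amb ((T.weaken 2).block (.wk 2 J)) (T.weaken 2).r (.wk 2 L))
          (b :: i :: env) _ = _ at h3
        have h6 : ev w A N (.seq
            (.writeCells ((T.weaken 2).addr (.wk 2 J) (.wk 2 L)) (.succ (T.weaken 2).a) (.var 0))
            (.ifz (.amb ((T.weaken 2).block (.wk 2 J)) (T.weaken 2).r (.wk 2 L))
            (.succ (.var 0)) (.var 0))) (b :: i :: env) { st with cat := setBits c₁ p (a + 1) f } =
            (if m = 0 then min (b + 1) N else b,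
              { st with cat := setBits c₁ p (a + 1) b.testBit }) := by
          rw [ev_seq, h1, ev]
          simp only [h3]
          split_ifs <;> rfl
        rw [h6]
        refine ⟨?_, _, rfl, fun hk => ?_⟩
        · by_cases h0 : m = 0
          · rw [if_pos h0]
            have : b ≠ v := fun e => hm'.2 e h0
            omega
          · rw [if_neg h0]
            have := hm'.1 h0
            omega
        · rw [show b = v by omega])
      ⟨by simp, fun q => c₁.getD (p + q) false, by rw [setBits_self], by omega⟩
  obtain ⟨-, f, h1, h2⟩ := key
  rw [← h2 (by omega)]
  exact h1

theorem ev_decompress (hS : Setting w x us A N K Y) (hZ : Sized us N K τ.length a S)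
    (hT : ParamsVal w A N T env us.length a S)
    (hi : ∀ j < us.length, blockAmb Y S a τ j < us.length)
    (h : Partly Y S a τ c fun _ => True) {st : St} (hc : st.cat = c) (ha : st.ask = []) :
    ∃ v, ev w A N (Tm.decompress T) env st = (v, { st with cat := τ }) := by
  have hr := hS.le_length
  obtain ⟨st', h1, c, rfl, h2⟩ := ev_loop (fun k st' => ∃ c, st' = { st with cat := c } ∧
    Partly Y S a τ c (k ≤ ·))
    (hT.r st trivial) (by omega) (t := .bind (.field ((T.weaken 2).addr (.var 0) .zero) (T.weaken 2).a)
    (.decompressAt ((T.weaken 2).weaken 1) (.var 1) (.var 0))) (by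
      rintro k hk i _ ⟨c, rfl, h2⟩
      have hT' := hT.wk2 k i
      have hpow := hZ.pow_le hS hk
      rw [pow_succ] at hpow
      have h5 := hZ.addr_le hk (by omega : 0 < us.length)
      have h0 := Val.field (τ := c) (P := fun st => st.cat = c) (fun _ h => h)
        ((Val.addr hZ hT' hk (by omega) Val.var0 Val.zero).catVal c) (hT'.a.catVal c) (by omega)
        (by omega) { st with cat := c } rfl
      rw [(h2.packed k hk le_rfl).field_eq hZ.length_le (hi k hk)] at h0
      have h7 := ev_bind (u := .decompressAt ((T.weaken 2).weaken 1) (.var 1) (.var 0)) h0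
      rw [h7, ev_decompressAt (st := { st with cat := c }) hS hZ (hT'.wk1 _) hk (hi k hk) (h2.packed k hk le_rfl)
        h2.length_eq Val.var1 Val.var0 rfl ha]
      exact ⟨_, rfl, h2.decompress hk hZ.tape_le hi⟩)
    ⟨c, by rw [← hc], h.mono (by simp)⟩
  have h3 : Partly Y S a τ c fun _ => False := h2.mono fun j hj => by
    simp only [iff_false]; omega
  rw [h3.eq] at h1
  exact ⟨_, h1⟩

/-- Before round `k` the indices below `k` are unambiguous, and the free bits from `k` on are still
one, so there is room for a decrease at `k`. The changes affect free bits only, so all blocks stay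
compressed. -/
theorem ev_isolate (hS : Setting w x us A N K Y) (hZ : Sized us N K τ.length a S)
    (hT : ParamsVal w A N T env us.length a S)
    (hi : ∀ j < us.length, blockAmb Y S a τ j < us.length)
    (h : Partly Y S a τ c fun _ => True)
    (htop : ∀ j < us.length, c.getD (addr us.length a j 0 + a) false = true)
    {st : St} (hc : st.cat = c) (ha : st.ask = []) :
    ∃ c' v, ev w A N (Tm.isolate T) env st = (v, { st with cat := c' }) ∧
      (Partly Y S a τ c' fun _ => True) ∧
      firstAmb Y (layoutWeight us c' (freeLayout us.length S a)) = us.length := by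
  classical
  have hr := hS.le_length
  obtain ⟨st', h1, c', rfl, h2, h3, h4⟩ := ev_loop (fun k st' => ∃ c', st' = { st with cat := c' } ∧
    (Partly Y S a τ c' fun _ => True) ∧
    (∀ j < us.length, k ≤ j → c'.getD (addr us.length a j 0 + a) false = true) ∧
    ∀ j < k, ¬ AmbAt Y (layoutWeight us c' (freeLayout us.length S a)) j)
    (hT.r st trivial) (by omega) (t := .ifz (.occurs (T.weaken 2).free (T.weaken 2).r (.var 0)) .zero
    (.wr (.add ((T.weaken 2).addr (.var 0) .zero) (T.weaken 2).a) .zero)) (by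
      rintro k hk i _ ⟨c, rfl, h2, h3, h4⟩
      have hT' := hT.wk2 k i
      have hpow := hZ.pow_le hS hk
      have h0k : 0 < us.length := by omega
      have h5 := hZ.addr_le hk h0k
      obtain ⟨v, hv, hv'⟩ := Val.occurs hS hZ.free_fits one_le_two (hZ.free_val hS hT' c)
        (hT'.r.catVal c) (Val.var0 (x := k)) (by omega)
      have h0 := hv { st with cat := c } ⟨rfl, ha⟩
      have h6 := ev_wr (P := fun _ => True) ((Val.addr hZ hT' hk h0k Val.var0 Val.zero).add hT'.a
        (by omega)) Val.zero (st := { st with cat := c }) trivial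
      set g := layoutWeight us c (freeLayout us.length S a) with hg
      set c' := if v = 0 then c else c.set (addr us.length a k 0 + a) false with hc'
      have h7 : (ev w A N (.ifz (.occurs (T.weaken 2).free (T.weaken 2).r (.var 0)) .zero
          (.wr (.add ((T.weaken 2).addr (.var 0) .zero) (T.weaken 2).a) .zero)) (k :: i :: env)
          { st with cat := c }).2 = { st with cat := c' } := by
        change ev w A N (.occurs (T.weaken 2).free (T.weaken 2).r (.var 0)) _ _ = _ at h0
        change ev w A N (.wr (.add ((T.weaken 2).addr (.var 0) .zero) (T.weaken 2).a) .zero) _ _ = _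
          at h6
        rw [ev]
        simp only [h0]
        rw [hc']
        split_ifs
        · rfl
        · rw [h6]; rfl
      have h8 : ∀ j < us.length, ∀ l < us.length, ∀ q < a + 1,
          c'.getD (addr us.length a j l + q) false = if j = k ∧ l = 0 ∧ q = a ∧ v ≠ 0 then false
            else c.getD (addr us.length a j l + q) false := by
        intro j hj l hl q hq
        rw [hc']
        by_cases hv0 : v = 0
        · simp [hv0]
        · rw [if_neg hv0, getD_set]
          have h9 : addr us.length a j l + q = addr us.length a k 0 + a ↔ j = k ∧ l = 0 ∧ q = a :=
            ⟨fun e => addr_inj hl h0k hq (by omega) e, by rintro ⟨rfl, rfl, rfl⟩; rfl⟩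
          have h10 := addr_add_le (a := a) hj hl
          have h11 := hZ.tape_le
          have h12 := h2.length_eq
          exact if_congr (by rw [h9]; omega) rfl rfl
      -- As the free bit of `k` is one, clearing it lowers the weight by one; this is the
      -- perturbation with `e = 0` of the old weights.
      have h9 : ∀ l, layoutWeight us c' (freeLayout us.length S a) l + 1 =
          pert g k (if minWeight Y (pert g k 0) < minWeight Y (fun l => g l + 1) then 0 else 1) l := by
        intro l
        rw [layoutWeight_free, h8 l l.2 0 h0k a (by omega), if_congr hv'.symm rfl rfl, hg, pert, layoutWeight_free]
        by_cases hl : (l : ℕ) = k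
        · have := h3 l l.2 (by omega)
          by_cases hv0 : v = 0
          · simp [hv0]
          · simp [hl, hv0]
            rw [hl, List.getD_eq_getElem?_getD] at this
            simp [this]
        · simp [hl]
      have h10 := not_amb_of_decrease (i := ⟨k, hk⟩) hS.exists_word h9
      rw [h7]
      refine ⟨c', rfl, ⟨?_, fun y hy => ?_, fun j hj _ => ?_, fun j hj hj' => (hj' trivial).elim⟩,
        fun j hj hkj => ?_, fun j hj => ?_⟩
      · rw [hc', ← h2.length_eq]; split_ifs <;> simp
      · rw [← h2.rest y hy, hc']
        have := addr_add_le (a := a) hk h0k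
        split_ifs
        · rfl
        · rw [getD_set, if_neg (by omega)]
      · refine (h2.packed j hj trivial).congr (hi j hj) fun l hl q hq hlq => ?_
        rw [h8 j hj l hl q hq, if_neg (by omega)]
      · rw [h8 j hj 0 h0k a (by omega), if_neg (by omega), h3 j hj (by omega)]
      · rintro ⟨hj', hA⟩
        rcases Nat.lt_succ_iff_lt_or_eq.1 hj with hjk | rfl
        · exact h10.2 _ (fun h => h4 j hjk ⟨hj', h⟩) hA
        · exact h10.1 hA)
    ⟨c, by rw [← hc], h, fun j hj _ => htop j hj, by simp⟩
  refine ⟨c', _, h1, h2, ?_⟩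
  exact firstIdx_eq _ _ le_rfl h4 (fun h => absurd h (lt_irrefl _))

theorem isMin_of_layout (hZ : Sized us N K n a S) {V : Fin us.length → ℕ}
    (hV : ∀ l, V l ≤ 2 ^ (a + 1)) {g : Fin us.length → ℕ}
    (hg : ∀ l, g l + 1 = inputWeight us l * S + V l) {y : Fin us.length → Bool}
    (h : IsMin Y (fun l => g l + 1) y) : IsMin Y (inputWeight us) y :=
  isMin_of_scaled (fun y => (weight_le_card V hV y).trans_lt hZ.scale) hg h

theorem ev_minWitness (hS : Setting w x us A N K Y) (hZ : Sized us N K τ.length a S)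
    (hT : ParamsVal w A N T env us.length a S) {st : St} (hc : st.cat = τ) (ha : st.ask = []) :
    ∃ v y, ev w A N (Tm.minWitness T) env st = (v, { st with out := st.out ++ List.ofFn y }) ∧
      IsMin Y (inputWeight us) y := by
  classical
  have hr := hS.le_length
  have h1 : QueryVal w A N τ (.search T.r (.not (.sub (T.weaken 2).r
      (.firstAmb ((T.weaken 2).block (.var 0)) (T.weaken 2).r)))) env
      (firstIdx (fun j => blockAmb Y S a τ j = us.length) us.length) := by
    refine Val.search (hT.r.mono fun _ _ => trivial) (by omega) fun j hj _ i => ?_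
    have hT' := hT.wk2 j i
    have h2 := Val.firstAmb hS (hZ.block_fits hj) le_rfl (hZ.block_val hT' hj Val.var0 τ)
      (hT'.r.catVal τ)
    refine ⟨_, (Val.sub (hT'.r.mono fun _ _ => trivial) h2).not (by omega), ?_⟩
    have h3 := firstIdx_le (AmbAt Y (layoutWeight us τ (blockLayout us.length S a j))) us.length
    unfold blockAmb firstAmb
    split_ifs <;> omega
  have h2 := h1 st ⟨hc, ha⟩
  set j := firstIdx (fun j => blockAmb Y S a τ j = us.length) us.length with hj
  have hle : j ≤ us.length := firstIdx_le _ _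
  have hT' := hT.wk1 j
  have h3 : ev w A N (.sub (T.weaken 1).r (.var 0)) (j :: env) st = (us.length - j, st) :=
    (hT'.r.sub Val.var0) st trivial
  rw [Tm.minWitness, ev_bind h2, ev]
  simp only [h3]
  split_ifs with h0
  -- Every block has an ambiguous index: compress, isolate with the free bits, write the witness,
  -- restore.
  · have hi : ∀ j < us.length, blockAmb Y S a τ j < us.length := fun k hk =>
      lt_of_le_of_ne (firstIdx_le _ _) (not_of_lt_firstIdx (fun j => blockAmb Y S a τ j = us.length) us.length
        (by omega : k < j))
    obtain ⟨c, v₁, e₁, hc₁, htop⟩ := ev_compress hS hZ hT hi hc ha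
    obtain ⟨c', v₂, e₂, hc₂, hamb⟩ := ev_isolate (st := { st with cat := c }) hS hZ hT hi hc₁ htop
      rfl ha
    obtain ⟨y, hy, -⟩ := exists_isMin
      (fun l => layoutWeight us c' (freeLayout us.length S a) l + 1) hS.exists_word
    have e₃ := ev_output (st := { st with cat := c' }) hS hZ.free_fits one_le_two
      (hZ.free_val hS hT c') (hT.r.catVal c') hamb hy rfl ha
    obtain ⟨v, e₄⟩ := ev_decompress (st := { st with cat := c', out := st.out ++ List.ofFn y })
      hS hZ hT hi hc₂ rfl ha
    refine ⟨v, y, ?_, isMin_of_layout hZ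
      -- The perturbation is the free bit plus the `1` from the reference weights `g + 1`.
      (V := fun l => (c'.getD (addr us.length a l 0 + a) false).toNat + 1) (fun l => ?_)
      (fun l => ?_) hy⟩
    · change ev w A N (.seq (.compress T) (.seq (.isolate T)
        (.seq (.output T.free T.r) (.decompress T)))) env st = _
      rw [ev_seq, e₁, ev_seq]
      dsimp only
      rw [e₂, ev_seq]
      dsimp only
      rw [e₃, e₄, ← hc]
    · have := (c'.getD (addr us.length a l 0 + a) false).toNat_lt
      have : 2 ^ 1 ≤ 2 ^ (a + 1) := Nat.pow_le_pow_right two_pos (by omega)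
      omega
    · rw [layoutWeight_free, add_assoc]
  -- Block `j` isolates a witness by itself, and nothing is written on the catalytic tape.
  · have hlt : j < us.length := by omega
    have hj' : blockAmb Y S a τ j = us.length :=
      firstIdx_spec (fun j => blockAmb Y S a τ j = us.length) us.length hlt
    obtain ⟨y, hy, -⟩ := exists_isMin
      (fun l => layoutWeight us τ (blockLayout us.length S a j) l + 1) hS.exists_word
    refine ⟨_, y, ev_output hS (hZ.block_fits hlt) one_le_two (hZ.block_val hT' hlt Val.var0 τ)
      (hT'.r.catVal τ) hj' hy hc ha, isMin_of_layout hZ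
      (V := fun l => field τ (addr us.length a j l) (a + 1) + 1) (fun l => field_lt _ _ _)
      (fun l => ?_) hy⟩
    rw [layoutWeight_block, add_assoc]

end Main

/-! ### The whole program -/

namespace Tm

/-- Ask whether the input is an instance that has a witness, by means of a weight that exceeds all
weights of witnesses. -/
def validate : Tm :=
  seq (emitPrefix (wordPos wordCount))
    (seq (fold (add (wordPos wordCount) (wordPos wordCount)) zero
        (seq (ask one) (seq (ask one) (succ (var 0)))))
      (seq (ask zero) query))

/-- The first weight that is larger than `r ^ c`. -/
def firstLarge (c : ℕ) (r : Tm) : Tm :=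
  search r (sub (wordVal (succ (var 0))) (pow (wk 2 r) c))

/-- The least `a` with `r ≤ 2 ^ a`. -/
def log (r : Tm) : Tm := search r (not (sub (wk 2 r) (pow2 (var 0))))

/-- The parameters for `r`, and the main part of the program. -/
def withParams (r : Tm) : Tm :=
  bind (log r) (bind (succ (mul (wk 1 r) (pow2 (succ (var 0)))))
    (minWitness ⟨wk 1 (wk 1 r), var 1, var 0⟩))

/-- The program for the search problem. -/
def searchMinWeight (c : ℕ) : Tm :=
  ifz wellFormed zero (bind (pred wordCount) (ifz validate zero
    (ifz (sub (var 0) (firstLarge c (var 0)))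
      (seq (ifz (pred (var 0)) (output ⟨zero, zero, zero, zero⟩ (var 0)) (withParams (var 0))) one)
      zero)))

end Tm

/-! ### Instances, and validation by a single query. -/

section Instance

variable {w x : List Bool} {us : List (List Bool)} {A : Language Bool} {N n c : ℕ} {m : ℕ → ℕ}
  {R : List Bool → List Bool → Prop} {d : ℕ} {env : List ℕ}

/-- What is used about the oracle. -/
structure IsDecision (A : Language Bool) (m : ℕ → ℕ) (R : List Bool → List Bool → Prop) (d : ℕ) :
    Prop where
  sound : ∀ q ∈ A, q ∈ weightedDecision m R
  complete : ∀ (x : List Bool) (W : Fin (m x.length) → ℕ) (w₀ : ℕ), (∀ i, W i ≤ m x.length ^ d) →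
    (∃ y : Fin (m x.length) → Bool, R x (List.ofFn y) ∧ weight W y ≤ w₀) → encodeQuery x W w₀ ∈ A

theorem isDecision_weightedDecision : IsDecision (weightedDecision m R) m R d :=
  ⟨fun _ h => h, fun x W w₀ _ h => ⟨x, W, w₀, rfl, h⟩⟩

theorem isDecision_weightedDecisionBdd : IsDecision (weightedDecisionBdd m R d) m R d :=
  ⟨fun _ ⟨x, W, w₀, h, _, hy⟩ => ⟨x, W, w₀, h, hy⟩, fun x W w₀ hW h => ⟨x, W, w₀, rfl, hW, h⟩⟩

theorem Nat.bits_injective : Function.Injective Nat.bits := fun a b h => by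
  rw [← numOf_bits a, h, numOf_bits]

/-- The words `us` are the binary expansions of numbers. -/
def Canonical (us : List (List Bool)) : Prop :=
  List.ofFn (fun l => (inputWeight us l).bits) = us

theorem canonical_ofFn {r : ℕ} (W : Fin r → ℕ) :
    Canonical (List.ofFn fun l => (W l).bits) := by
  refine List.ext_getElem (by simp) fun i h1 h2 => ?_
  simp [inputWeight]

theorem encodeInstance_inputWeight (h : Canonical us) :
    encodeInstance x (inputWeight us) = encode (x :: us) := by
  rw [encodeInstance, h]

theorem IsDecision.mem_iff (hA : IsDecision A m R d) {r : ℕ} (hr : r = m x.length) (U : Fin r → ℕ)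
    (w₀ : ℕ) (hU : ∀ l, U l ≤ r ^ d) :
    encodeQuery x U w₀ ∈ A ↔ ∃ y : Fin r → Bool, R x (List.ofFn y) ∧ weight U y ≤ w₀ := by
  subst hr
  refine ⟨fun h => ?_, hA.complete x U w₀ hU⟩
  obtain ⟨x', W, w₁, e, y, hy, hw⟩ := hA.sound _ h
  have e' := encode_injective e
  simp only [List.cons_append, List.cons.injEq] at e'
  obtain ⟨rfl, e'⟩ := e'
  obtain ⟨e₁, e₂⟩ := List.append_inj e' (by simp)
  have h1 : U = W := funext fun l =>
    Nat.bits_injective (congrFun (List.ofFn_injective e₁) l)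
  have h2 : w₀ = w₁ := Nat.bits_injective (by simpa using e₂)
  subst h1 h2
  exact ⟨y, hy, hw⟩

theorem mem_minWeightSearch {r : ℕ} (hr : r = m x.length) {U : Fin r → ℕ}
    (hU : ∀ l, U l ≤ r ^ c) {y : Fin r → Bool}
    (hy : IsMin (fun y => R x (List.ofFn y)) U y) :
    List.ofFn y ∈ minWeightSearch m R c (encodeInstance x U) := by
  subst hr
  exact ⟨x, U, rfl, hU, y, rfl, hy.1, hy.2⟩

theorem inputWeight_lt (l : Fin us.length) (hw : (encode (x :: us)).length ≤ n) :
    inputWeight us l < 2 ^ n := by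
  refine (numOf_lt _).trans_le (Nat.pow_le_pow_right two_pos ?_)
  have h1 : (us[l]).length ≤ (encode us).length := by
    rw [encode_eq_flatMap, List.length_flatMap]
    have h2 : (encode [us[l]]).length ∈ us.map fun u => (encode [u]).length :=
      List.mem_map.2 ⟨us[l], by simp, rfl⟩
    have h3 := List.single_le_sum (by simp) _ h2
    rw [encode_cons] at h3
    simp only [List.length_append, length_code] at h3
    omega
  rw [encode_cons] at hw
  simp only [List.length_append, List.length_cons] at hw
  omega

/-- At most `n` numbers below `2 ^ n` are added. The resulting bound for `validate` does not fit
into a register, but its expansion consists of `2 * n` ones and can be written directly. -/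
theorem weight_inputWeight_le (hr : us.length ≤ n) (hw : (encode (x :: us)).length ≤ n)
    (y : Fin us.length → Bool) : weight (inputWeight us) y ≤ 2 ^ (n + n) - 1 := by
  have h1 := weight_le_card (inputWeight us) (B := 2 ^ n - 1)
    (fun l => by have := inputWeight_lt l hw; omega) y
  have h2 : us.length * (2 ^ n - 1) ≤ (2 ^ n - 1) * 2 ^ n := by
    rw [mul_comm]
    exact Nat.mul_le_mul_left _ (hr.trans Nat.lt_two_pow_self.le)
  have h3 := Nat.one_le_two_pow (n := n)
  rw [Nat.sub_mul, one_mul, ← pow_add] at h2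
  omega

/-- The word written by `validate`. -/
def validateQuery (x : List Bool) (us : List (List Bool)) : List Bool :=
  encode (x :: us ++ [(2 ^ ((encode (x :: us)).length + (encode (x :: us)).length) - 1).bits])

theorem length_le_encode : us.length ≤ (encode us).length := by
  have := wordCount_le (w := encode us) (N := (encode us).length + 1)
  rwa [wordCount_encode (by omega)] at this

/-- If the query is answered positively, the input is an instance that has a witness. -/
theorem IsDecision.of_validate (hA : IsDecision A m R d) (h : validateQuery x us ∈ A) :
    us.length = m x.length ∧ Canonical us ∧ ∃ y : Fin us.length → Bool, R x (List.ofFn y) := by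
  -- Membership in the language forces the format: since the encoding is injective, there are
  -- exactly `m x.length` words `us`, and they are binary expansions of numbers. So `m` need not be
  -- computed.
  obtain ⟨x', W, w₁, e, y, hy, -⟩ := hA.sound _ h
  have e' := encode_injective e
  simp only [List.cons_append, List.cons.injEq] at e'
  obtain ⟨rfl, e'⟩ := e'
  obtain ⟨rfl, -⟩ := List.append_inj' e' (by simp)
  refine ⟨by simp, canonical_ofFn W, fun l => y (l.cast (by simp)), ?_⟩
  convert hy using 1
  exact List.ext_getElem (by simp) fun i h1 h2 => by simp

/-- If the query is answered negatively, there is no solution. -/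
theorem IsDecision.not_validate (hA : IsDecision A m R d) (hc : c ≤ d)
    (h : validateQuery x us ∉ A) : minWeightSearch m R c (encode (x :: us)) = ∅ := by
  refine Set.eq_empty_iff_forall_notMem.2 fun z hz => h ?_
  obtain ⟨x', W, e, hW, y, -, hy, -⟩ := hz
  have e' := encode_injective e
  simp only [List.cons.injEq] at e'
  obtain ⟨rfl, rfl⟩ := e'
  refine hA.complete x W _ (fun i => (hW i).trans (Nat.pow_le_pow_right i.pos hc)) ⟨y, hy, ?_⟩
  have h1 := weight_inputWeight_le (x := x) (n := (encode (x :: List.ofFn fun l => (W l).bits)).length)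
    (us := List.ofFn fun l => (W l).bits) ?_ le_rfl (fun l => y (l.cast (by simp)))
  · refine le_trans (le_of_eq ?_) h1
    unfold weight
    refine Fintype.sum_equiv (finCongr (by simp)) _ _ fun l => ?_
    simp [inputWeight]
  · exact le_trans (by simp) (length_le_encode (us := x :: List.ofFn fun l => (W l).bits))

/-- If some weight is too large, there is no solution. -/
theorem not_large {l : Fin us.length} (hr : us.length = m x.length)
    (h : us.length ^ c < inputWeight us l) : minWeightSearch m R c (encode (x :: us)) = ∅ := by
  refine Set.eq_empty_iff_forall_notMem.2 fun z hz => ?_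
  obtain ⟨x', W, e, hW, -⟩ := hz
  have e' := encode_injective e
  simp only [List.cons.injEq] at e'
  obtain ⟨rfl, rfl⟩ := e'
  have h1 := hW (l.cast (by simp))
  rw [hr] at h
  have h2 : inputWeight (List.ofFn fun l => (W l).bits) l = W (l.cast (by simp)) := by
    simp only [inputWeight, Fin.getElem_fin, List.getElem_ofFn, numOf_bits]
    rfl
  rw [h2] at h
  exact absurd h1 (not_le.2 h)

theorem ev_validate (hN : 2 * w.length + 2 ≤ N) (hw : w = encode (x :: us)) {st : St}
    (ha : st.ask = []) [Decidable (validateQuery x us ∈ A)] :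
    ev w A N Tm.validate env st = ((decide (validateQuery x us ∈ A)).toNat, st) := by
  have h0 : CatVal w A N st.cat (.wordPos .wordCount) env w.length := by
    refine ((Val.wordCount (by omega)).wordPos (fun j hj => (wordPos_lt hj).le) (by omega)).congr ?_
    subst hw
    rw [wordCount_encode (by omega), wordPos_encode (by omega) le_rfl, List.take_length]
  have h1 := emits_prefix h0 le_rfl (by omega)
  have h2 := Emits.foldUp (fun _ => [true, true]) (h0.add h0 (by omega))
    (b := .seq (.ask .one) (.seq (.ask .one) (.succ (.var 0)))) fun k hk j =>
      ((Val.one (by omega)).ask.seq ((Val.one (by omega)).ask.seq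
        (Val.var0.succ (by omega)).emits)).congr (by simp)
  have h3 : Emits w A N st.cat (.ask .zero) env 0 [false] := Val.zero.ask
  have h4 := (h1.seq (h2.seq h3)) st rfl
  have h5 : ev w A N Tm.validate env st = ev w A N .query env
      (ev w A N (.seq (.emitPrefix (.wordPos .wordCount)) (.seq
        (.fold (.add (.wordPos .wordCount) (.wordPos .wordCount)) .zero
        (.seq (.ask .one) (.seq (.ask .one) (.succ (.var 0))))) (.ask .zero))) env st).2 := rfl
  have h6 : validateQuery x us = w ++ ((List.range (w.length + w.length)).flatMap
      (fun _ => [true, true]) ++ [false]) := by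
    rw [validateQuery, encode_append, ← hw, bits_ones, encode_cons, code, encode_nil]
    congr 2
    generalize w.length + w.length = k
    induction k with
    | zero => rfl
    | succ k ih => rw [List.range_succ, List.flatMap_append, List.replicate_succ', ← ih]; simp
  rw [h5, h4, ev]
  simp only [ha, List.nil_append, List.take_length, ← h6]
  ext1
  · dsimp only
  · dsimp only; rw [← ha]

end Instance

/-! ### Size estimates. -/

section Bounds

/-- The numbers that occur are small. -/
structure Small (n N c : ℕ) : Prop where
  length : 2 * n + 2 ≤ N
  pow : ∀ i ≤ c, n ^ i ≤ N
  total : ∀ r ≤ n, r * r ^ c < N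
  cube : ∀ r ≤ n, r ^ 3 + r ≤ N

/-- With `h = 2 ^ (Nat.log 2 n + 1) > n` the bound is `h ^ (c + 2) - 1`. One factor `h` beyond `h ^
(c + 1)` gives the slack, as `h ≥ 2`. -/
theorem small (n c : ℕ) (hc : 5 ≤ c) : Small n (2 ^ ((c + 2) * (Nat.log 2 n + 1)) - 1) c := by
  have h1 : n + 1 ≤ 2 ^ (Nat.log 2 n + 1) := Nat.lt_pow_succ_log_self one_lt_two n
  have h2 : 2 ^ 1 ≤ 2 ^ (Nat.log 2 n + 1) := Nat.pow_le_pow_right two_pos (by omega)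
  rw [mul_comm, pow_mul]
  set h := 2 ^ (Nat.log 2 n + 1)
  have h3 : ∀ i, h ^ i * 2 ≤ h ^ (i + 1) := fun i => by
    rw [pow_succ]; exact Nat.mul_le_mul_left _ (by omega)
  have h4 : ∀ i, 1 ≤ h ^ i := fun i => Nat.one_le_pow _ _ (by omega)
  have h5 : h ^ (c + 1) * 2 ≤ h ^ (c + 2) := h3 (c + 1)
  have h6 := h3 c
  have h7 : ∀ i ≤ c, h ^ i ≤ h ^ c := fun i hi => Nat.pow_le_pow_right (by omega) hi
  have h8 := h4 c
  have h9 := h7 3 (by omega)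
  have h10 := h7 1 (by omega)
  have h11 := h3 1
  have h12 := h7 2 (by omega)
  rw [pow_one] at h10 h11
  refine ⟨by omega, fun i hi => ?_, fun r hr => ?_, fun r hr => ?_⟩
  · have := Nat.pow_le_pow_left (by omega : n ≤ h) i
    have := h7 i hi
    omega
  · have := Nat.pow_le_pow_left (by omega : r ≤ h) (c + 1)
    rw [pow_succ'] at this
    omega
  · have := Nat.pow_le_pow_left (by omega : r ≤ h) 3
    omega

/-- The bound for the weights in the queries. -/
theorem query_bound {r c W p : ℕ} (hr : 2 ≤ r) (hW : W ≤ r ^ c) (hp : p ≤ 2 * r) :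
    W * (r * (2 * p) + 1) + 2 * p + 1 ≤ r ^ (c + 5) := by
  have h1 : W * (r * (2 * p) + 1) ≤ r ^ c * (r * (4 * r) + 1) :=
    Nat.mul_le_mul hW (by
      have : r * (2 * p) ≤ r * (4 * r) := Nat.mul_le_mul_left r (by omega)
      omega)
  have h2 : 1 ≤ r ^ c := Nat.one_le_pow _ _ (by omega)
  have h3 : 2 * p + 1 ≤ r ^ c * (4 * r + 1) :=
    (by omega : 2 * p + 1 ≤ 4 * r + 1).trans (Nat.le_mul_of_pos_left _ h2)
  -- This fixes the exponent `c + 5`: at `r = 2` the left-hand side is `26`, so `r ^ 4` would be too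
  -- small.
  have h4 : r * (4 * r) + 1 + (4 * r + 1) ≤ r ^ 5 := by
    have a2 : 2 * r ≤ r * r := Nat.mul_le_mul_right r hr
    have a3 : 2 * (r * r) ≤ r * (r * r) := Nat.mul_le_mul_right (r * r) hr
    have a4 : 2 * (r * (r * r)) ≤ r * (r * (r * r)) := Nat.mul_le_mul_right _ hr
    have a5 : 2 * (r * (r * (r * r))) ≤ r * (r * (r * (r * r))) := Nat.mul_le_mul_right _ hr
    have e1 : r ^ 5 = r * (r * (r * (r * r))) := by ring
    have e2 : r * (4 * r) = 4 * (r * r) := by ring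
    rw [e1, e2]
    omega
  calc W * (r * (2 * p) + 1) + 2 * p + 1
      ≤ r ^ c * (r * (4 * r) + 1) + r ^ c * (4 * r + 1) := by omega
    _ = r ^ c * (r * (4 * r) + 1 + (4 * r + 1)) := by ring
    _ ≤ r ^ c * r ^ 5 := Nat.mul_le_mul_left _ h4
    _ = r ^ (c + 5) := by ring

end Bounds

/-! ### Parameters, small cases and the whole program. -/

section Program

variable {w x : List Bool} {us : List (List Bool)} {A : Language Bool} {N n c k : ℕ} {m : ℕ → ℕ}
  {R : List Bool → List Bool → Prop} {d : ℕ} {env : List ℕ} {τ : List Bool}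
  {Y : (Fin us.length → Bool) → Prop} {T : Tm}

/-- The least `a` with `r ≤ 2 ^ a`. -/
theorem Val.log {r : ℕ} (hr : 0 < r) (h : PureVal w A N T env r) (hN : 2 * r + 1 ≤ N) :
    ∃ a < r, r ≤ 2 ^ a ∧ 2 ^ a ≤ 2 * r ∧ PureVal w A N (Tm.log T) env a := by
  -- As `k - 1` fails, `2 ^ k` is less than `2 * r`; so the width `a + 1` of a field is logarithmic
  -- and the perturbations are linear in `r`.
  have hp : ∀ k, (∀ j < k, ¬ r ≤ 2 ^ j) → 2 ^ k ≤ 2 * r := fun k hk => by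
    cases k with
    | zero => simp; omega
    | succ k => have := hk k (by omega); rw [pow_succ]; omega
  have h1 : firstIdx (fun k => r ≤ 2 ^ k) r < r := by
    rw [firstIdx_lt_iff]
    have := Nat.lt_two_pow_self (n := r - 1)
    exact ⟨r - 1, by omega, by omega⟩
  refine ⟨_, h1, firstIdx_spec (fun k => r ≤ 2 ^ k) r h1,
    hp _ fun j => not_of_lt_firstIdx (fun k => r ≤ 2 ^ k) r, ?_⟩
  refine Val.search h (by omega) fun k hk hj i => ?_
  have := hp k hj
  refine ⟨_, (h.wk2.sub (Val.var0.pow2 (by omega))).not (by omega), ?_⟩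
  split_ifs <;> omega

/-- The scale `us.length * 2 ^ (a + 1) + 1` just exceeds the largest possible sum of perturbations.
The blocks need at most `us.length ^ 3` cells because `a + 1 ≤ us.length`, which explains `3 ≤ k`.
-/
theorem ev_withParams (hS : Setting w x us A N (us.length ^ (c + 5)) Y) (hr : 2 ≤ us.length)
    (hW : ∀ l, inputWeight us l ≤ us.length ^ c) (hs : Small w.length N (c + 5))
    (hn : us.length ≤ w.length) (hk : 3 ≤ k) {st : St} (hτ : st.cat.length = w.length ^ k)
    (hT : PureVal w A N T env us.length) (ha : st.ask = []) :
    ∃ v y, ev w A N (Tm.withParams T) env st = (v, { st with out := st.out ++ List.ofFn y }) ∧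
      IsMin Y (inputWeight us) y := by
  have h1 := hs.length
  obtain ⟨a, har, h2, h3, h4⟩ := Val.log (by omega) hT (by omega)
  have hcube := hs.cube _ hn
  have hcube' : us.length ^ 3 = us.length * us.length * us.length := by ring
  rw [hcube'] at hcube
  have h5 : us.length * (2 * us.length) ≤ us.length * us.length * us.length := by
    rw [mul_assoc]; exact Nat.mul_le_mul_left _ (Nat.mul_le_mul_right _ hr)
  have h6 : us.length * us.length * (a + 1) ≤ us.length * us.length * us.length :=
    Nat.mul_le_mul_left _ har
  have h7 := hS.le_of_fin ⟨0, by omega⟩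
  have hZ : Sized us N (us.length ^ (c + 5)) st.cat.length a (us.length * 2 ^ (a + 1) + 1) := by
    refine ⟨h2, ?_, ?_, fun l => ?_, Nat.lt_succ_self _⟩
    · rw [hτ]
      refine h6.trans ?_
      rw [← hcube']
      exact (Nat.pow_le_pow_left hn 3).trans (Nat.pow_le_pow_right (by omega) hk)
    · rw [add_mul]; omega
    · have := query_bound hr (hW l) h3
      rwa [pow_succ, mul_comm (2 ^ a) 2]
  have h8 := hZ.weight_le ⟨0, by omega⟩
  have h9 : us.length * 2 ^ (a + 1) + 1 ≤ N := by
    have := query_bound (c := c) hr (le_refl (us.length ^ c)) h3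
    have h10 : 1 ≤ us.length ^ c := Nat.one_le_pow _ _ (by omega)
    have h11 := Nat.le_mul_of_pos_left (us.length * (2 * 2 ^ a) + 1) h10
    rw [pow_succ, mul_comm (2 ^ a) 2]
    omega
  have h10 : PureVal w A N (.succ (.mul (.wk 1 T) (.pow2 (.succ (.var 0))))) (a :: env)
      (us.length * 2 ^ (a + 1) + 1) :=
    (hT.wk1.mul ((Val.var0.succ (by omega)).pow2 (by omega)) (by omega)).succ (by omega)
  rw [Tm.withParams, ev_bind (h4 st trivial), ev_bind (h10 st trivial)]
  exact ev_minWitness hS hZ ⟨hT.wk1.wk1, Val.var1, Val.var0⟩ rfl ha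

/-- With at most one position, a word with the fewest ones has minimum weight for any weights. -/
theorem isMin_of_length_le_one {r : ℕ} (hr : r ≤ 1) {Y : (Fin r → Bool) → Prop} (W : Fin r → ℕ)
    {y : Fin r → Bool} (h : IsMin Y (fun _ => 0 + 1) y) : IsMin Y W y := by
  refine ⟨h.1, fun y' hy' => ?_⟩
  have h1 := h.2 y' hy'
  interval_cases r
  · simp [weight]
  · simp only [weight, Finset.univ_unique, Finset.sum_singleton] at h1 ⊢
    split_ifs at h1 ⊢ <;> simp_all

/-- For `us.length ≤ 1` the bound `us.length ^ d` is at most `1` and leaves no room for scaling. The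
layout of zeros replaces all weights by `1`, and its queries only use the weights `0` and `1`. -/
theorem ev_output_of_length_le_one (hS : Setting w x us A N (us.length ^ d) Y)
    (hr : us.length ≤ 1) (hT : PureVal w A N T env us.length) {st : St} (ha : st.ask = []) :
    ∃ v y, ev w A N (Tm.output ⟨.zero, .zero, .zero, .zero⟩ T) env st =
      (v, { st with out := st.out ++ List.ofFn y }) ∧ IsMin Y (inputWeight us) y := by
  classical
  have h2 := hS.one_le
  have hF : Fits us N (us.length ^ d) 1 ⟨0, 0, 0, 0⟩ := by
    refine ⟨fun l => ?_, by simp⟩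
    have : us.length = 1 := by have := l.pos; omega
    simp [this]
  have hD : LayoutVal w A N st.cat ⟨.zero, .zero, .zero, .zero⟩ env ⟨0, 0, 0, 0⟩ :=
    ⟨Val.zero, Val.zero, Val.zero, Val.zero⟩
  have hg : layoutWeight us st.cat ⟨0, 0, 0, 0⟩ = fun _ => 0 := by
    funext l; simp [layoutWeight, field]
  obtain ⟨y, hy, -⟩ := exists_isMin (fun _ : Fin us.length => 0 + 1) hS.exists_word
  refine ⟨_, y, ev_output hS hF le_rfl hD (hT.catVal _) ?_ (by rw [hg]; exact hy) rfl ha,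
    isMin_of_length_le_one hr _ hy⟩
  rw [hg]
  refine firstIdx_eq _ _ le_rfl ?_ (fun h => absurd h (lt_irrefl _))
  -- With a single position, a word containing it weighs at least one and a word avoiding it weighs
  -- zero, so they cannot both be optimal.
  rintro j hj ⟨hj', ⟨y₁, h₁, e₁⟩, y₀, h₀, e₀⟩
  have h3 : weight (fun _ => 0 + 1) y₁ ≤ weight (fun _ => 0 + 1) y₀ := h₁.2 y₀ h₀.1
  have h4 : ∀ l : Fin us.length, l = ⟨j, hj'⟩ := fun l => Fin.ext (by have := l.2; simp; omega)
  have h5 : weight (fun _ => 0 + 1) y₀ = 0 := by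
    unfold weight
    refine Finset.sum_eq_zero fun l _ => ?_
    rw [h4 l, e₀]; simp
  have h6 : 1 ≤ weight (fun _ => 0 + 1) y₁ := by
    unfold weight
    refine le_trans ?_ (Finset.single_le_sum (fun _ _ => Nat.zero_le _)
      (Finset.mem_univ (⟨j, hj'⟩ : Fin us.length)))
    simp [e₁]
  omega

theorem IsDecision.setting (hA : IsDecision A m R d) (hw : w = encode (x :: us))
    (hr : us.length = m x.length) (hY : ∃ y : Fin us.length → Bool, R x (List.ofFn y))
    (hN : w.length + 2 ≤ N) (hW : ∀ l, inputWeight us l ≤ N)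
    (ht : us.length * us.length ^ d < N) :
    Setting w x us A N (us.length ^ d) fun y => R x (List.ofFn y) :=
  ⟨hw, hN, hW, fun U w₀ hU => hA.mem_iff hr U w₀ hU, ht, hY⟩

/-- Saturation of the weights at `N` does no harm, since the threshold `us.length ^ c` is below `N`.
-/
theorem Val.firstLarge (hw : w = encode (x :: us)) (hN : w.length + 2 ≤ N)
    (hT : PureVal w A N T env us.length) (hc : ∀ i ≤ c, us.length ^ i ≤ N)
    (hlt : us.length ^ c < N) : ∃ v, PureVal w A N (Tm.firstLarge c T) env v ∧ v ≤ us.length ∧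
      (us.length ≤ v → ∀ l, inputWeight us l ≤ us.length ^ c) ∧
      (v < us.length → ∃ l, us.length ^ c < inputWeight us l) := by
  classical
  have hr : us.length ≤ w.length := by
    have := length_le_encode (us := x :: us)
    rw [← hw] at this
    simp only [List.length_cons] at this
    omega
  let p : ℕ → Prop := fun k => ∃ h : k < us.length, us.length ^ c < inputWeight us ⟨k, h⟩
  refine ⟨firstIdx p us.length, Val.search hT (by omega) fun k hk _ i => ?_, firstIdx_le _ _,
    fun h l => ?_, fun h => ?_⟩
  · refine ⟨_, (Val.wordVal hw (Val.var0.succ (by omega)) (by simpa using hk) hN).sub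
      (hT.wk2.pow c hc), ?_⟩
    simp only [p, hk, exists_true_left, List.getElem_cons_succ, inputWeight, Fin.getElem_fin]
    omega
  · by_contra h1
    exact not_of_lt_firstIdx p us.length (l.2.trans_le h) ⟨l.2, not_le.1 h1⟩
  · obtain ⟨h1, h2⟩ := firstIdx_spec p us.length h
    exact ⟨_, h2⟩

/-- Validation does not replace the check of the weights: the oracle may also accept weights above
`us.length ^ c`, for which the search problem has no solution. -/
theorem ev_searchMinWeight (hA : IsDecision A m R (c + 5)) (hs : Small w.length N (c + 5))
    (hk : 3 ≤ k) (hτ : τ.length = w.length ^ k) :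
    ∃ (b : Bool) (z : List Bool), ev w A N (Tm.searchMinWeight c) [] ⟨τ, [], []⟩ =
      (b.toNat, ⟨τ, z, []⟩) ∧
      if b then z ∈ minWeightSearch m R c w else minWeightSearch m R c w = ∅ := by
  classical
  have hN := hs.length
  set st : St := ⟨τ, [], []⟩ with hst
  have reject : ∀ {t : Tm}, t = Tm.searchMinWeight c →
      ev w A N t [] st = (0, st) → minWeightSearch m R c w = ∅ →
      ∃ (b : Bool) (z : List Bool), ev w A N (Tm.searchMinWeight c) [] st = (b.toNat, ⟨τ, z, []⟩) ∧
      if b then z ∈ minWeightSearch m R c w else minWeightSearch m R c w = ∅ := by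
    rintro _ rfl h h'
    exact ⟨false, [], h, by simpa using h'⟩
  obtain ⟨v, hv, hv'⟩ := Val.wellFormed (w := w) (A := A) (P := fun _ => True) (env := []) (N := N)
    (by omega)
  by_cases hwf : v = 0
  · refine reject rfl ?_ ?_
    · rw [Tm.searchMinWeight, ev]
      simp only [hv st trivial, if_pos hwf]
      rfl
    · refine Set.eq_empty_iff_forall_notMem.2 ?_
      rintro z ⟨x, W, e, -⟩
      exact hv'.2 ⟨_, List.cons_ne_nil _ _, e⟩ hwf
  obtain ⟨us', hne, hw⟩ := hv'.1 hwf
  obtain ⟨x, us, rfl⟩ := List.exists_cons_of_ne_nil hne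
  have hr : us.length + 1 ≤ w.length := by
    have := length_le_encode (us := x :: us)
    rwa [← hw] at this
  have hcount : PureVal w A N (.pred .wordCount) [] us.length := by
    refine (Val.wordCount (by omega)).pred.congr ?_
    rw [hw] at hN ⊢
    rw [wordCount_encode (by omega)]; rfl
  have e₁ : ev w A N (Tm.searchMinWeight c) [] st = ev w A N (.ifz .validate .zero
    (.ifz (.sub (.var 0) (.firstLarge c (.var 0)))
      (.seq (.ifz (.pred (.var 0)) (.output ⟨.zero, .zero, .zero, .zero⟩ (.var 0))
        (.withParams (.var 0))) .one) .zero)) [us.length] st := by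
    rw [Tm.searchMinWeight, ev]
    simp only [hv st trivial, if_neg hwf]
    exact ev_bind (hcount st trivial)
  have e₂ := ev_validate (env := [us.length]) (A := A) hN hw (st := st) rfl
  by_cases hq : validateQuery x us ∈ A
  swap
  · refine reject rfl ?_ (by rw [hw]; exact hA.not_validate (by omega) hq)
    rw [e₁, ev]
    simp only [e₂]
    rw [if_pos (by simpa using hq)]
    rfl
  obtain ⟨hm, hcan, hY⟩ := hA.of_validate hq
  have hpow : ∀ i ≤ c, us.length ^ i ≤ N := fun i hi =>
    (Nat.pow_le_pow_left (by omega) i).trans (hs.pow i (by omega))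
  have htotal := hs.total us.length (by omega)
  have hlt : us.length ^ c < N := by
    rcases Nat.eq_zero_or_pos us.length with h0 | h0
    -- `0 ^ c` is `1` for `c = 0`, so this case needs its own bound.
    · rw [h0]
      have : 0 ^ c ≤ 1 ^ c := Nat.pow_le_pow_left (Nat.zero_le _) c
      rw [one_pow] at this
      omega
    · have h1 : us.length ^ c ≤ us.length ^ (c + 5) := Nat.pow_le_pow_right h0 (by omega)
      have h2 := Nat.le_mul_of_pos_left (us.length ^ (c + 5)) h0
      omega
  obtain ⟨u, hu, hle, hsmall, hlarge⟩ := Val.firstLarge (A := A) (env := [us.length]) hw (by omega)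
    Val.var0 hpow hlt
  have e₃ : ev w A N (Tm.searchMinWeight c) [] st = ev w A N
      (.ifz (.sub (.var 0) (.firstLarge c (.var 0)))
      (.seq (.ifz (.pred (.var 0)) (.output ⟨.zero, .zero, .zero, .zero⟩ (.var 0))
        (.withParams (.var 0))) .one) .zero) [us.length] st := by
    rw [e₁, ev]
    simp only [e₂]
    rw [if_neg (by simpa using hq)]
  have e₄ := (Val.var0.sub hu) st trivial
  by_cases hlg : u < us.length
  · obtain ⟨l, hl⟩ := hlarge hlg
    refine reject rfl ?_ (by rw [hw]; exact not_large hm hl)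
    rw [e₃, ev]
    simp only [e₄]
    rw [if_neg (by omega)]
    rfl
  have hW := hsmall (not_lt.1 hlg)
  have hS := hA.setting hw hm hY (by omega) (fun l => (hW l).trans hlt.le) htotal
  obtain ⟨v', y, e₅, hy⟩ : ∃ v y, ev w A N (.ifz (.pred (.var 0))
      (.output ⟨.zero, .zero, .zero, .zero⟩ (.var 0)) (.withParams (.var 0))) [us.length] st =
      (v, { st with out := st.out ++ List.ofFn y }) ∧
      IsMin (fun y : Fin us.length → Bool => R x (List.ofFn y)) (inputWeight us) y := by
    have e₆ : ev w A N (.pred (.var 0)) [us.length] st = (us.length - 1, st) := rfl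
    rw [ev]
    simp only [e₆]
    split_ifs with h
    · exact ev_output_of_length_le_one hS (by omega) Val.var0 rfl
    · exact ev_withParams hS (by omega) hW hs (by omega) hk hτ Val.var0 rfl
  refine ⟨true, List.ofFn y, ?_, ?_⟩
  · rw [e₃, ev]
    simp only [e₄]
    rw [if_pos (by omega), ev_seq, e₅]
    exact Val.one (P := fun _ => True) (by omega) _ trivial
  · rw [if_pos rfl, hw, ← encodeInstance_inputWeight hcan]
    exact mem_minWeightSearch hm hW hy

/-- The exponent `c + 5 + 2` serves twice: registers of this many times `Nat.log 2 n + 1` bits hold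
all numbers by `small`, and the catalytic tape is long enough for all blocks. -/
theorem IsDecision.searchInCL (hA : IsDecision A m R (c + 5)) :
    SearchInCL A (minWeightSearch m R c) :=
  searchInCL_of_ev (Tm.searchMinWeight c) (c + 5 + 2) (by omega) fun _ _ hτ =>
    ev_searchMinWeight hA (small _ _ (by omega)) (by omega) hτ

end Program

end CatalyticLogspace

theorem mainTheorem1
    (m : ℕ → ℕ) (hm : ∃ p : Polynomial ℕ, ∀ n, m n ≤ p.eval n)
    (R : List Bool → List Bool → Prop)
    (hR : CatalyticLogspace.InPSPACE (CatalyticLogspace.relationLanguage R))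
    (c : ℕ) :
    CatalyticLogspace.SearchInCL (CatalyticLogspace.weightedDecision m R)
        (CatalyticLogspace.minWeightSearch m R c) ∧
      ∃ d : ℕ, CatalyticLogspace.SearchInCL (CatalyticLogspace.weightedDecisionBdd m R d)
        (CatalyticLogspace.minWeightSearch m R c) :=
  ⟨CatalyticLogspace.isDecision_weightedDecision.searchInCL,
    c + 5, CatalyticLogspace.isDecision_weightedDecisionBdd.searchInCL⟩
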